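/- Let $-\infty\le a<b\le\infty$ and $n\ge 0$, $N\ge 1$ be integers. Let $J$ be a constant, invertible, skew-Hermitian complex $n\times n$-matrix, and let $q$ and $w$ be $n\times n$-matrices of finite complex Borel measures on $(a,b)$ (distributions of order $0$ for which both endpoints are regular), $q$ Hermitian and $w$ non-negative. A solution of $Ju'+qu=\lambda wu$ on an open subinterval is a function $u$ of locally bounded variation with values in $\mathbb C^n$ which is balanced, i.e. $u=(u^++u^-)/2$, and satisfies the equation as an identity between measures. Put $\Delta_q(x)=q(\{x\})$, $\Delta_w(x)=w(\{x\})$, and $$B_\pm(x,\lambda)=J\pm\tfrac12\big(\Delta_q(x)-\lambda\Delta_w(x)\big).$$ Let $a=x_0<x_1<\dots<x_N<x_{N+1}=b$ be a partition such that $\{x_1,\dots,x_N\}$ contains all $x\in(a,b)$ for which $B_+(x,0)$ or $B_-(x,0)$ is not invertible. Let $\Omega_0$ be the set of all $\lambda\in\mathbb C$ such that $B_+(x,\lambda)$ and $B_-(x,\lambda)$ are invertible for all $x\in(a,b)\setminus\{x_1,\dots,x_N\}$. For $\lambda\in\Omega_0$ and $0\le j\le N-1$ let $U_j(\cdot,\lambda)$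 be the fundamental matrix of balanced solutions of $Ju'+qu=\lambda wu$ on $(x_j,x_{j+1})$ with $\lim_{x\downarrow x_j}U_j(x,\lambda)=I$, and let $U_j(x_{j+1},\lambda)=\lim_{x\uparrow x_{j+1}}U_j(x,\lambda)$. Let $\mathbb B(\lambda)\in\mathbb C^{nN\times n(N+1)}$ be the two-diagonal block matrix whose $j$-th block row ($j=1,\dots,N$; the block columns are numbered $0,\dots,N$) has the block $-B_-(x_j,\lambda)U_{j-1}(x_j,\lambda)$ in block column $j-1$, the block $B_+(x_j,\lambda)$ in block column $j$, and zeros elsewhere. Let $\mathbb B_m(\lambda)$ be $\mathbb B(\lambda)$ without its first and last $n$ columns, and let $$\tilde n(\lambda)=\dim\big(\ker\mathbb B_m(\overline\lambda)^*/\ker\mathbb B(\overline\lambda)^*\big).$$ Let $\tilde{\mathbb B}$ be any row-echelon form of $\mathbb B$ over the field of meromorphic functions on $\mathbb C$, i.e. an $nN\times n(N+1)$-matrix in row-echelon form with meromorphic entries such that, for vectors $v$ of meromorphic functions, $\mathbb Bv=0$ if and only if $\tilde{\mathbb B}v=0$. Let $\Omega$ be the set of all $\lambda\in\Omega_0$ such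 that neither $\lambda$ nor $\overline\lambda$ is a pole of an entry of $\tilde{\mathbb B}$ or a zero of a pivot of $\tilde{\mathbb B}$. Then $\mathbb C\setminus\Omega$ is a discrete set without accumulation points in $\mathbb C$, and for every $\lambda\in\Omega$ $$\dim\ker\mathbb B(\lambda)=\dim\ker\mathbb B(\overline\lambda)\qquad\text{and}\qquad\tilde n(\lambda)=n.$$ Moreover, for every $\lambda\in\Omega$ the space of all solutions of $Ju'+qu=\lambda wu$ on $(a,b)$ modulo the subspace of solutions with compact support in $(a,b)$ has dimension $n$. -/

import Mathlib

open MeasureTheory Set Filter Topology Matrix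
open scoped ComplexOrder ComplexConjugate

namespace FirstOrderSystem

/-! ### Auxiliary facts about functions of locally bounded variation -/

section Auxiliary

variable {E : Type*} [NormedAddCommGroup E]

theorem boundedVariationOn_add {f g : ℝ → E} {s : Set ℝ} (hf : BoundedVariationOn f s)
    (hg : BoundedVariationOn g s) : BoundedVariationOn (f + g) s := by
  have h : eVariationOn (f + g) s ≤ eVariationOn f s + eVariationOn g s := by
    apply iSup_le
    intro p
    calc ∑ i ∈ Finset.range p.1, edist ((f + g) (p.2.1 (i + 1))) ((f + g) (p.2.1 i))
        ≤ ∑ i ∈ Finset.range p.1, (edist (f (p.2.1 (i + 1))) (f (p.2.1 i)) +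
            edist (g (p.2.1 (i + 1))) (g (p.2.1 i))) := by
          gcongr
          exact edist_add_add_le _ _ _ _
      _ = _ := Finset.sum_add_distrib
      _ ≤ _ := by
          gcongr
          · exact le_iSup (fun p : ℕ × { u : ℕ → ℝ // Monotone u ∧ ∀ i, u i ∈ s } ↦
              ∑ i ∈ Finset.range p.1, edist (f (p.2.1 (i + 1))) (f (p.2.1 i))) p
          · exact le_iSup (fun p : ℕ × { u : ℕ → ℝ // Monotone u ∧ ∀ i, u i ∈ s } ↦
              ∑ i ∈ Finset.range p.1, edist (g (p.2.1 (i + 1))) (g (p.2.1 i))) p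
  exact ne_top_of_le_ne_top (ENNReal.add_ne_top.2 ⟨hf, hg⟩) h

theorem boundedVariationOn_smul [NormedSpace ℂ E] {f : ℝ → E} {s : Set ℝ} (c : ℂ) (hf : BoundedVariationOn f s) :
    BoundedVariationOn (c • f) s := by
  have h : LipschitzOnWith ‖c‖₊ (fun y : E ↦ c • y) univ :=
    (lipschitzWith_smul c).lipschitzOnWith
  exact h.comp_boundedVariationOn (mapsTo_univ _ _) hf

variable [CompleteSpace E]

/-- On an open set a function of locally bounded variation has left limits. -/
theorem tendsto_leftLim_of_locBV {f : ℝ → E} {s : Set ℝ} (hs : IsOpen s)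
    (hf : LocallyBoundedVariationOn f s) {x : ℝ} (hx : x ∈ s) :
    Tendsto f (𝓝[<] x) (𝓝 (Function.leftLim f x)) := by
  obtain ⟨e, he, hes⟩ := Metric.isOpen_iff.1 hs x hx
  have hc : x - e / 2 ∈ s := hes (by rw [Metric.mem_ball, Real.dist_eq, abs_lt]; constructor <;> linarith)
  obtain ⟨l, hl⟩ := (hf _ _ hc hx).exists_tendsto_left x
  have hn : 𝓝[s ∩ Icc (x - e / 2) x ∩ Iio x] x = 𝓝[<] x := by
    apply le_antisymm (nhdsWithin_mono _ inter_subset_right)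
    apply nhdsWithin_le_iff.2
    have h1 : Metric.ball x (e / 2) ∈ 𝓝[<] x :=
      mem_nhdsWithin_of_mem_nhds (Metric.ball_mem_nhds x (by linarith))
    filter_upwards [h1, self_mem_nhdsWithin] with y hy hy'
    rw [Metric.mem_ball, Real.dist_eq, abs_lt] at hy
    have hy'' : y < x := hy'
    refine ⟨⟨hes ?_, by linarith, hy''.le⟩, hy'⟩
    rw [Metric.mem_ball, Real.dist_eq, abs_lt]
    constructor <;> linarith
  rw [hn] at hl
  exact tendsto_leftLim_of_tendsto ⟨l, hl⟩

/-- On an open set a function of locally bounded variation has right limits. -/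
theorem tendsto_rightLim_of_locBV {f : ℝ → E} {s : Set ℝ} (hs : IsOpen s)
    (hf : LocallyBoundedVariationOn f s) {x : ℝ} (hx : x ∈ s) :
    Tendsto f (𝓝[>] x) (𝓝 (Function.rightLim f x)) := by
  obtain ⟨e, he, hes⟩ := Metric.isOpen_iff.1 hs x hx
  have hc : x + e / 2 ∈ s := hes (by rw [Metric.mem_ball, Real.dist_eq, abs_lt]; constructor <;> linarith)
  obtain ⟨l, hl⟩ := (hf _ _ hx hc).exists_tendsto_right x
  have hn : 𝓝[s ∩ Icc x (x + e / 2) ∩ Ioi x] x = 𝓝[>] x := by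
    apply le_antisymm (nhdsWithin_mono _ inter_subset_right)
    apply nhdsWithin_le_iff.2
    have h1 : Metric.ball x (e / 2) ∈ 𝓝[>] x :=
      mem_nhdsWithin_of_mem_nhds (Metric.ball_mem_nhds x (by linarith))
    filter_upwards [h1, self_mem_nhdsWithin] with y hy hy'
    rw [Metric.mem_ball, Real.dist_eq, abs_lt] at hy
    have hy'' : x < y := hy'
    refine ⟨⟨hes ?_, hy''.le, by linarith⟩, hy'⟩
    rw [Metric.mem_ball, Real.dist_eq, abs_lt]
    constructor <;> linarith
  rw [hn] at hl
  exact tendsto_rightLim_of_tendsto ⟨l, hl⟩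

theorem isFiniteMeasure_variation (c : ComplexMeasure ℝ) : IsFiniteMeasure c.variation := by
  refine isFiniteMeasure_of_le
    ((ComplexMeasure.re c).totalVariation + (ComplexMeasure.im c).totalVariation) ?_
  refine VectorMeasure.variation_le_of_forall_enorm_le fun s _ ↦ ?_
  have h1 := SignedMeasure.enorm_le_totalVariation (ComplexMeasure.re c) s
  have h2 := SignedMeasure.enorm_le_totalVariation (ComplexMeasure.im c) s
  rw [Measure.add_apply]
  refine le_trans ?_ (add_le_add h1 h2)
  have h3 : ‖c s‖ₑ ≤ ‖(((c s).re : ℝ) : ℂ)‖ₑ + ‖(((c s).im : ℝ) : ℂ) * Complex.I‖ₑ := by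
    conv_lhs => rw [← Complex.re_add_im (c s)]
    exact enorm_add_le _ _
  refine h3.trans (le_of_eq ?_)
  have h4 : ComplexMeasure.re c s = (c s).re := rfl
  have h5 : ComplexMeasure.im c s = (c s).im := rfl
  rw [enorm_mul, h4, h5]
  simp [← ofReal_norm]

/-- A function of bounded variation on a compact interval is integrable over that interval
with respect to every complex measure. -/
theorem integrable_of_bv (c : ComplexMeasure ℝ) {f : ℝ → ℂ} {p r : ℝ}
    (hf : BoundedVariationOn f (Icc p r)) : (c.restrict (Icc p r)).Integrable f := by
  have := isFiniteMeasure_variation c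
  rcases (Icc p r).eq_empty_or_nonempty with he | ⟨x, hx⟩
  · rw [he]
    simp [VectorMeasure.Integrable]
  have hre : BoundedVariationOn (fun y ↦ (f y).re) (Icc p r) :=
    (Complex.reCLM.lipschitz.lipschitzOnWith (s := univ)).comp_boundedVariationOn
      (mapsTo_univ _ _) hf
  have him : BoundedVariationOn (fun y ↦ (f y).im) (Icc p r) :=
    (Complex.imCLM.lipschitz.lipschitzOnWith (s := univ)).comp_boundedVariationOn
      (mapsTo_univ _ _) hf
  have hm : ∀ g : ℝ → ℝ, BoundedVariationOn g (Icc p r) →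
      AEMeasurable g (c.variation.restrict (Icc p r)) := by
    intro g hg
    obtain ⟨g₁, g₂, h1, h2, h3⟩ := hg.locallyBoundedVariationOn.exists_monotoneOn_sub_monotoneOn
    rw [h3]
    exact (aemeasurable_restrict_of_monotoneOn measurableSet_Icc h1).sub
      (aemeasurable_restrict_of_monotoneOn measurableSet_Icc h2)
  unfold VectorMeasure.Integrable
  rw [VectorMeasure.variation_restrict measurableSet_Icc]
  have hmeas : AEMeasurable f (c.variation.restrict (Icc p r)) := by
    have : f = fun y ↦ (((f y).re : ℝ) : ℂ) + (((f y).im : ℝ) : ℂ) * Complex.I := by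
      funext y
      exact (Complex.re_add_im (f y)).symm
    rw [this]
    exact (Complex.measurable_ofReal.comp_aemeasurable (hm _ hre)).add
      ((Complex.measurable_ofReal.comp_aemeasurable (hm _ him)).mul_const _)
  refine Integrable.of_bound hmeas.aestronglyMeasurable
    (‖f x‖ + (eVariationOn f (Icc p r)).toReal) ?_
  refine (ae_restrict_iff' measurableSet_Icc).2 (Eventually.of_forall fun y hy ↦ ?_)
  have h1 : dist (f y) (f x) ≤ (eVariationOn f (Icc p r)).toReal := hf.dist_le hy hx
  rw [dist_eq_norm] at h1
  have h2 := norm_add_le (f x) (f y - f x)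
  rw [add_sub_cancel] at h2
  linarith

end Auxiliary

/-! ### Systems of differential equations with measure coefficients -/

/-- The open interval `(s, t)` of real numbers, for extended real end points. -/
def ivl (s t : EReal) : Set ℝ := {x | s < (x : EReal) ∧ (x : EReal) < t}

/-- An `n × n` matrix of (finite) complex Borel measures. An order zero distribution for which
both end points of `(a, b)` are regular is a finite measure on `(a, b)`. -/
abbrev MatrixMeasure (n : ℕ) := Matrix (Fin n) (Fin n) (ComplexMeasure ℝ)

/-- The matrix `μ(A)`. -/
noncomputable def MatrixMeasure.mass {n : ℕ} (μ : MatrixMeasure n) (A : Set ℝ) :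
    Matrix (Fin n) (Fin n) ℂ :=
  Matrix.of fun i k ↦ μ i k A

/-- The vector `∫_A dμ u`. -/
noncomputable def MatrixMeasure.integral {n : ℕ} (μ : MatrixMeasure n) (A : Set ℝ)
    (u : ℝ → Fin n → ℂ) : Fin n → ℂ :=
  fun i ↦ ∑ k, ((μ i k).restrict A).integral (fun x ↦ u x k) (ContinuousLinearMap.mul ℝ ℂ)

/-- The data `J`, `q`, `w` of the equation `J u' + q u = z w u`. -/
structure Coeffs (n : ℕ) where
  J : Matrix (Fin n) (Fin n) ℂ
  q : MatrixMeasure n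
  w : MatrixMeasure n

variable {n : ℕ}

/-- The standing hypothesis: `J` is invertible and skew-Hermitian and, on `(a, b)`, `q` is
Hermitian and `w` is non-negative. -/
structure Coeffs.Admissible (S : Coeffs n) (a b : EReal) : Prop where
  isUnit_J : IsUnit S.J
  skew_J : S.Jᴴ = -S.J
  hermitian_q : ∀ A, MeasurableSet A → A ⊆ ivl a b → (S.q.mass A).IsHermitian
  nonneg_w : ∀ A, MeasurableSet A → A ⊆ ivl a b → (S.w.mass A).PosSemidef

/-- `u` is a balanced solution of locally bounded variation of `J u' + q u = z w u` on `(s, t)`.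
The derivative `u'` is the (local) measure which assigns `u⁺(d) - u⁻(c)` to `[c, d]`. -/
structure Coeffs.IsSolution (S : Coeffs n) (z : ℂ) (s t : EReal) (u : ℝ → Fin n → ℂ) : Prop where
  locBV : LocallyBoundedVariationOn u (ivl s t)
  balanced : ∀ x ∈ ivl s t,
    u x = (1 / 2 : ℂ) • (Function.leftLim u x + Function.rightLim u x)
  eqn : ∀ c ∈ ivl s t, ∀ d ∈ ivl s t, c ≤ d →
    S.J *ᵥ (Function.rightLim u d - Function.leftLim u c) + S.q.integral (Icc c d) u
      = z • S.w.integral (Icc c d) u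

theorem isOpen_ivl (s t : EReal) : IsOpen (ivl s t) :=
  (isOpen_lt continuous_const continuous_coe_real_ereal).inter
    (isOpen_lt continuous_coe_real_ereal continuous_const)

theorem Icc_subset_ivl {s t : EReal} {c d : ℝ} (hc : c ∈ ivl s t) (hd : d ∈ ivl s t) :
    Icc c d ⊆ ivl s t := fun _ hx ↦
  ⟨hc.1.trans_le (EReal.coe_le_coe_iff.2 hx.1), (EReal.coe_le_coe_iff.2 hx.2).trans_lt hd.2⟩

theorem integrable_component (c : ComplexMeasure ℝ) {s t : EReal} {u : ℝ → Fin n → ℂ}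
    (hu : LocallyBoundedVariationOn u (ivl s t)) {p r : ℝ} (hp : p ∈ ivl s t) (hr : r ∈ ivl s t)
    (k : Fin n) : (c.restrict (Icc p r)).Integrable (fun x ↦ u x k) := by
  apply integrable_of_bv
  have h : BoundedVariationOn u (Icc p r) :=
    (hu p r hp hr).mono (subset_inter (Icc_subset_ivl hp hr) subset_rfl)
  exact ((LipschitzWith.eval k).lipschitzOnWith (s := univ)).comp_boundedVariationOn
    (mapsTo_univ _ _) h

theorem MatrixMeasure.integral_add (μ : MatrixMeasure n) {s t : EReal} {u v : ℝ → Fin n → ℂ}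
    (hu : LocallyBoundedVariationOn u (ivl s t)) (hv : LocallyBoundedVariationOn v (ivl s t))
    {p r : ℝ} (hp : p ∈ ivl s t) (hr : r ∈ ivl s t) :
    μ.integral (Icc p r) (u + v) = μ.integral (Icc p r) u + μ.integral (Icc p r) v := by
  funext i
  simp only [MatrixMeasure.integral, Pi.add_apply, ← Finset.sum_add_distrib]
  refine Finset.sum_congr rfl fun k _ ↦ ?_
  exact VectorMeasure.integral_fun_add (integrable_component _ hu hp hr k)
    (integrable_component _ hv hp hr k)

theorem MatrixMeasure.integral_smul (μ : MatrixMeasure n) (c : ℂ) (A : Set ℝ)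
    (u : ℝ → Fin n → ℂ) : μ.integral A (c • u) = c • μ.integral A u := by
  funext i
  simp only [MatrixMeasure.integral, Pi.smul_apply, Finset.smul_sum]
  refine Finset.sum_congr rfl fun k _ ↦ ?_
  simp only [VectorMeasure.integral_eq_setToFun]
  refine setToFun_smul _ (fun c s x ↦ ?_) c (fun x ↦ u x k)
  rw [transpose_eq_cbmApplyMeasure, cbmApplyMeasure_apply, cbmApplyMeasure_apply]
  exact mul_assoc c x _

theorem Coeffs.IsSolution.zero (S : Coeffs n) (z : ℂ) (s t : EReal) : S.IsSolution z s t 0 := by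
  have hl : ∀ x : ℝ, Function.leftLim (0 : ℝ → Fin n → ℂ) x = 0 := fun x ↦
    leftLim_eq_of_tendsto tendsto_const_nhds
  have hr : ∀ x : ℝ, Function.rightLim (0 : ℝ → Fin n → ℂ) x = 0 := fun x ↦
    rightLim_eq_of_tendsto tendsto_const_nhds
  have hi : ∀ (μ : MatrixMeasure n) (A : Set ℝ), μ.integral A 0 = 0 := by
    intro μ A
    simpa using μ.integral_smul 0 A 0
  refine ⟨fun p r _ _ ↦ ?_, fun x _ ↦ ?_, fun c _ d _ _ ↦ ?_⟩
  · have : eVariationOn (0 : ℝ → Fin n → ℂ) (ivl s t ∩ Icc p r) = 0 :=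
      eVariationOn.constant_on (by
        rintro _ ⟨_, _, rfl⟩ _ ⟨_, _, rfl⟩
        rfl)
    simp [BoundedVariationOn, this]
  · simp [hl, hr]
  · simp [hl, hr, hi]

theorem Coeffs.IsSolution.add {S : Coeffs n} {z : ℂ} {s t : EReal} {u v : ℝ → Fin n → ℂ}
    (hu : S.IsSolution z s t u) (hv : S.IsSolution z s t v) : S.IsSolution z s t (u + v) := by
  have hl : ∀ x ∈ ivl s t, Function.leftLim (u + v) x =
      Function.leftLim u x + Function.leftLim v x := fun x hx ↦
    leftLim_eq_of_tendsto ((tendsto_leftLim_of_locBV (isOpen_ivl s t) hu.locBV hx).add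
      (tendsto_leftLim_of_locBV (isOpen_ivl s t) hv.locBV hx))
  have hr : ∀ x ∈ ivl s t, Function.rightLim (u + v) x =
      Function.rightLim u x + Function.rightLim v x := fun x hx ↦
    rightLim_eq_of_tendsto ((tendsto_rightLim_of_locBV (isOpen_ivl s t) hu.locBV hx).add
      (tendsto_rightLim_of_locBV (isOpen_ivl s t) hv.locBV hx))
  refine ⟨fun p r hp hr ↦ boundedVariationOn_add (hu.locBV p r hp hr) (hv.locBV p r hp hr),
    fun x hx ↦ ?_, fun c hc d hd hcd ↦ ?_⟩
  · rw [Pi.add_apply, hl x hx, hr x hx, add_add_add_comm, smul_add, ← hu.balanced x hx,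
      ← hv.balanced x hx]
  · rw [hl c hc, hr d hd, MatrixMeasure.integral_add _ hu.locBV hv.locBV hc hd,
      MatrixMeasure.integral_add _ hu.locBV hv.locBV hc hd, smul_add,
      ← hu.eqn c hc d hd hcd, ← hv.eqn c hc d hd hcd, add_sub_add_comm, Matrix.mulVec_add]
    abel

theorem Coeffs.IsSolution.smul {S : Coeffs n} {z : ℂ} {s t : EReal} {u : ℝ → Fin n → ℂ}
    (c : ℂ) (hu : S.IsSolution z s t u) : S.IsSolution z s t (c • u) := by
  have hl : ∀ x ∈ ivl s t, Function.leftLim (c • u) x = c • Function.leftLim u x := fun x hx ↦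
    leftLim_eq_of_tendsto
      ((tendsto_leftLim_of_locBV (isOpen_ivl s t) hu.locBV hx).const_smul c)
  have hr : ∀ x ∈ ivl s t, Function.rightLim (c • u) x = c • Function.rightLim u x := fun x hx ↦
    rightLim_eq_of_tendsto
      ((tendsto_rightLim_of_locBV (isOpen_ivl s t) hu.locBV hx).const_smul c)
  refine ⟨fun p r hp hr ↦ boundedVariationOn_smul c (hu.locBV p r hp hr),
    fun x hx ↦ ?_, fun p hp r hr' hpr ↦ ?_⟩
  · rw [Pi.smul_apply, hl x hx, hr x hx, ← smul_add, smul_comm, ← hu.balanced x hx]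
  · rw [hl p hp, hr r hr', MatrixMeasure.integral_smul, MatrixMeasure.integral_smul, smul_comm z,
      ← hu.eqn p hp r hr' hpr, ← smul_sub, Matrix.mulVec_smul, smul_add]

/-- The space of all balanced solutions of `J u' + q u = z w u` on `(s, t)`; functions on `(s, t)`
are extended by `0` to the real line. -/
def Coeffs.solutions (S : Coeffs n) (z : ℂ) (s t : EReal) : Submodule ℂ (ℝ → Fin n → ℂ) where
  carrier := {u | S.IsSolution z s t u ∧ ∀ x ∉ ivl s t, u x = 0}
  zero_mem' := ⟨Coeffs.IsSolution.zero S z s t, fun _ _ ↦ rfl⟩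
  add_mem' := fun hu hv ↦ ⟨hu.1.add hv.1, fun x hx ↦ by simp [hu.2 x hx, hv.2 x hx]⟩
  smul_mem' := fun c _ hu ↦ ⟨hu.1.smul c, fun x hx ↦ by simp [hu.2 x hx]⟩

/-- The space of those solutions on `(s, t)` whose support is a compact subset of `(s, t)`. -/
def Coeffs.compactSolutions (S : Coeffs n) (z : ℂ) (s t : EReal) :
    Submodule ℂ (ℝ → Fin n → ℂ) where
  carrier := {u | u ∈ S.solutions z s t ∧ ∃ K, IsCompact K ∧ K ⊆ ivl s t ∧ ∀ x ∉ K, u x = 0}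
  zero_mem' := ⟨Submodule.zero_mem _, ∅, isCompact_empty, empty_subset _, fun _ _ ↦ rfl⟩
  add_mem' := by
    rintro u v ⟨hu, K, hK, hKi, huK⟩ ⟨hv, L, hL, hLi, hvL⟩
    refine ⟨Submodule.add_mem _ hu hv, K ∪ L, hK.union hL, union_subset hKi hLi, fun x hx ↦ ?_⟩
    rw [mem_union, not_or] at hx
    simp [huK x hx.1, hvL x hx.2]
  smul_mem' := by
    rintro c u ⟨hu, K, hK, hKi, huK⟩
    exact ⟨Submodule.smul_mem _ c hu, K, hK, hKi, fun x hx ↦ by simp [huK x hx]⟩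

/-! ### The matrices `B₊`, `B₋`, the fundamental matrices, and the matrix `B` -/

/-- `B₊(x, z) = J + ½ (Δ_q(x) - z Δ_w(x))`. -/
noncomputable def Coeffs.Bplus (S : Coeffs n) (x : ℝ) (z : ℂ) : Matrix (Fin n) (Fin n) ℂ :=
  S.J + (1 / 2 : ℂ) • (S.q.mass {x} - z • S.w.mass {x})

/-- `B₋(x, z) = J - ½ (Δ_q(x) - z Δ_w(x))`. -/
noncomputable def Coeffs.Bminus (S : Coeffs n) (x : ℝ) (z : ℂ) : Matrix (Fin n) (Fin n) ℂ :=
  S.J - (1 / 2 : ℂ) • (S.q.mass {x} - z • S.w.mass {x})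

/-- The set `Ξ_z` of points of `(a, b)` where `B₊(x, z)` or `B₋(x, z)` fails to be invertible. -/
def Coeffs.Xi (S : Coeffs n) (a b : EReal) (z : ℂ) : Set ℝ :=
  {x ∈ ivl a b | (S.Bplus x z).det * (S.Bminus x z).det = 0}

/-- `U` is the fundamental matrix of balanced solutions of `J u' + q u = z w u` on `(s, t)` with
`U(x) → 1` as `x ↓ s`. -/
structure Coeffs.IsFundamental (S : Coeffs n) (z : ℂ) (s t : EReal)
    (U : ℝ → Matrix (Fin n) (Fin n) ℂ) : Prop where
  isSolution : ∀ k, S.IsSolution z s t (fun x i ↦ U x i k)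
  tendsto_one : Tendsto U (comap (fun x : ℝ ↦ (x : EReal)) (𝓝[>] s)) (𝓝 1)

/-- The fundamental matrix on `(s, t)` which is normalized at `s`. -/
noncomputable def Coeffs.fund (S : Coeffs n) (z : ℂ) (s t : EReal) :
    ℝ → Matrix (Fin n) (Fin n) ℂ :=
  Classical.epsilon (S.IsFundamental z s t)

variable {m : ℕ}

/-- With interior partition points `x 0 < ⋯ < x m` of `(a, b)`, this is the left end point of the
subinterval whose right end point is `x j`. -/
def leftEnd (a : EReal) (x : Fin (m + 1) → ℝ) (j : Fin (m + 1)) : EReal :=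
  (Fin.cons a (fun i ↦ (x i : EReal)) : Fin (m + 2) → EReal) j.castSucc

/-- The left limit at `x j` of the fundamental matrix on the subinterval ending at `x j`. -/
noncomputable def Coeffs.transfer (S : Coeffs n) (a : EReal) (x : Fin (m + 1) → ℝ) (z : ℂ)
    (j : Fin (m + 1)) : Matrix (Fin n) (Fin n) ℂ :=
  Function.leftLim (S.fund z (leftEnd a x j) (x j)) (x j)

/-- The two-diagonal block matrix `B(z)`, with `N = m + 1` block rows and `N + 1` block columns:
the block row which belongs to the partition point `x j` is
`(0, …, 0, -B₋(x j, z) U(x j, z), B₊(x j, z), 0, …, 0)`. -/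
noncomputable def Coeffs.B (S : Coeffs n) (a : EReal) (x : Fin (m + 1) → ℝ) (z : ℂ) :
    Matrix (Fin (m + 1) × Fin n) (Fin (m + 2) × Fin n) ℂ :=
  Matrix.of fun r c ↦
    if c.1 = r.1.castSucc then -(S.Bminus (x r.1) z * S.transfer a x z r.1) r.2 c.2
    else if c.1 = r.1.succ then S.Bplus (x r.1) z r.2 c.2
    else 0

/-- `B_m(z)` is `B(z)` without its first and last block columns. -/
noncomputable def Coeffs.Bm (S : Coeffs n) (a : EReal) (x : Fin (m + 1) → ℝ) (z : ℂ) :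
    Matrix (Fin (m + 1) × Fin n) (Fin m × Fin n) ℂ :=
  (S.B a x z).submatrix id (fun c ↦ (c.1.castSucc.succ, c.2))

/-- `ñ(z) = dim (ker B_m(z̄)* / ker B(z̄)*)`. -/
noncomputable def Coeffs.ntilde (S : Coeffs n) (a : EReal) (x : Fin (m + 1) → ℝ) (z : ℂ) : ℕ :=
  Module.finrank ℂ
    (LinearMap.ker (S.Bm a x (conj z))ᴴ.mulVecLin ⧸
      (LinearMap.ker (S.B a x (conj z))ᴴ.mulVecLin).submoduleOf
        (LinearMap.ker (S.Bm a x (conj z))ᴴ.mulVecLin))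

/-! ### The set of permissible parameters -/

/-- The set `Ω₀`: those `z` for which `B₊(x, z)` and `B₋(x, z)` are invertible at all points of
`(a, b)` which are not among the partition points. -/
def Coeffs.Omega₀ (S : Coeffs n) (a b : EReal) (x : Fin (m + 1) → ℝ) : Set ℂ :=
  {z | S.Xi a b z ⊆ range x}

/-- `Bt` is a row-echelon form of the matrix-valued function `B` over the field of meromorphic
functions on `ℂ`: its entries are meromorphic functions (each given by its representative in
normal form), it is in row-echelon form, and for meromorphic vectors `v` the equations `B v = 0`
and `Bt v = 0` (identities between meromorphic functions) have the same solutions. Rows and columns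
are numbered block by block. -/
structure IsEchelonForm {M N : ℕ} (B : ℂ → Matrix (Fin M × Fin n) (Fin N × Fin n) ℂ)
    (Bt : Matrix (Fin (M * n)) (Fin (N * n)) (ℂ → ℂ)) : Prop where
  meromorphic : ∀ i k, MeromorphicNFOn (Bt i k) univ
  isRowEchelon : Bt.IsRowEchelon
  same_solutions : ∀ v : Fin (N * n) → ℂ → ℂ, (∀ k, Meromorphic (v k)) →
    ((∀ᶠ z in codiscrete ℂ,
        Matrix.reindex finProdFinEquiv finProdFinEquiv (B z) *ᵥ (fun k ↦ v k z) = 0) ↔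
      ∀ᶠ z in codiscrete ℂ, (Bt.map fun f ↦ f z) *ᵥ (fun k ↦ v k z) = 0)

/-- The set `Ω`: those `z ∈ Ω₀` such that neither `z` nor `z̄` is a pole of an entry of the
row-echelon form `Bt`, or a zero of one of its pivots. -/
def Coeffs.Omega (S : Coeffs n) (a b : EReal) (x : Fin (m + 1) → ℝ)
    {M N : ℕ} (Bt : Matrix (Fin M) (Fin N) (ℂ → ℂ)) : Set ℂ :=
  {z ∈ S.Omega₀ a b x | ∀ y ∈ ({z, conj z} : Set ℂ),
    (∀ i k, ¬ meromorphicOrderAt (Bt i k) y < 0) ∧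
    (∀ i k, Bt.IsLeadingEntry i k → ¬ 0 < meromorphicOrderAt (Bt i k) y)}

end FirstOrderSystem

/-! Write `q` and `w` with densities Q and W with respect to one finite measure ν. The equation
becomes the Volterra equation u = c + P(Au) with A = -J⁻¹(Q - zW), where P forms balanced
primitives. At a point p it contains the jump conditions B₊(p,z)u(p) = J u⁻(p) and B₋(p,z)u(p) = J
u⁺(p). Hence initial value problems are uniquely solvable on intervals without points of Ξ_z
(`exists_isVolterra`, `Coeffs.IsPropagator.exists_eq`), and a solution on (a,b) is determined by its
values at the partition points.

Lagrange's identity makes the Wronskian v*Ju of a solution v for z̄ and a solution u for z constant,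
so the transfer matrices satisfy U(z̄)*JU(z) = J. Together with B₊(z)* = -B₋(z̄) this identifies ker
B_m(z̄)* with the vectors (u(x_j)) of values of solutions for z, and ker B(z̄)* with those of the
solutions with compact support. The one-sided limits of the same solutions form ker B(z), so dim ker
B_m(z̄)* = dim ker B(z) (`Coeffs.finrank_ker_B`), while rank-nullity gives dim ker B(z)* = dim ker
B(z) - n.

The link between z and z̄ is positivity of `w`: for non-real z and a solution u with compact
support, Lagrange's identity for u with itself gives ∫u*Wu = 0, so wu = 0 and u is a solution for
every parameter (`Coeffs.compactSolutions_le`). The compactly supported solutions for z and z̄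
coincide, so dim ker B(z) = dim ker B(z̄), and ñ(z) = dim ker B(z) - (dim ker B(z̄) - n) = n. This
argument works for every z in Ω₀.

For discreteness, note that for bounded z only finitely many atoms are large enough to make B₊ or B₋
singular, and outside the partition the determinants at an atom are polynomials in z which do not
vanish at 0. Poles and zeros of nonzero meromorphic functions are isolated, and conjugation
preserves discreteness. -/

namespace FirstOrderSystem

/-! ### Volterra equations with respect to a measure with atoms -/

section Volterra

variable {E : Type*} [NormedAddCommGroup E] [NormedSpace ℝ E]

/-- The balanced primitive `x ↦ ½ (∫_{(-∞, x)} f + ∫_{(-∞, x]} f)` of the vector measure `f ν`. -/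
noncomputable def balPrim (ν : Measure ℝ) (f : ℝ → E) (x : ℝ) : E :=
  (1 / 2 : ℝ) • ((∫ y in Iio x, f y ∂ν) + ∫ y in Iic x, f y ∂ν)

variable {ν : Measure ℝ}

theorem balPrim_congr_ae {f g : ℝ → E} (h : f =ᵐ[ν] g) : balPrim ν f = balPrim ν g := by
  funext x
  simp only [balPrim, integral_congr_ae (ae_restrict_of_ae h)]

theorem norm_balPrim_le {f : ℝ → E} (hf : Integrable f ν) (x : ℝ) :
    ‖balPrim ν f x‖ ≤ ∫ y, ‖f y‖ ∂ν := by
  have h (s : Set ℝ) : ‖∫ y in s, f y ∂ν‖ ≤ ∫ y, ‖f y‖ ∂ν :=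
    (norm_integral_le_integral_norm _).trans
      (setIntegral_le_integral hf.norm (Eventually.of_forall fun _ ↦ norm_nonneg _))
  rw [balPrim, norm_smul]
  have := norm_add_le (∫ y in Iio x, f y ∂ν) (∫ y in Iic x, f y ∂ν)
  have h1 := h (Iio x)
  have h2 := h (Iic x)
  norm_num
  linarith

theorem balPrim_sub {f g : ℝ → E} (hf : Integrable f ν) (hg : Integrable g ν) (x : ℝ) :
    balPrim ν (fun y ↦ f y - g y) x = balPrim ν f x - balPrim ν g x := by
  simp only [balPrim, integral_sub hf.integrableOn hg.integrableOn, ← smul_sub]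
  congr 1
  abel

theorem stronglyMeasurable_balPrim [SFinite ν] {f : ℝ → E} (hf : StronglyMeasurable f) :
    StronglyMeasurable (balPrim ν f) := by
  have h (r : Set (ℝ × ℝ)) (hr : MeasurableSet r) :
      StronglyMeasurable fun x ↦ ∫ y, (r.indicator fun p : ℝ × ℝ ↦ f p.2) (x, y) ∂ν :=
    StronglyMeasurable.integral_prod_right
      (f := fun x y ↦ (r.indicator fun p : ℝ × ℝ ↦ f p.2) (x, y))
      ((hf.comp_measurable measurable_snd).indicator hr)
  have h1 := h {p | p.2 < p.1} (measurableSet_lt measurable_snd measurable_fst)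
  have h2 := h {p | p.2 ≤ p.1} (measurableSet_le measurable_snd measurable_fst)
  convert (h1.add h2).const_smul (1 / 2 : ℝ) using 1
  funext x
  simp only [balPrim, ← integral_indicator measurableSet_Iio, ← integral_indicator measurableSet_Iic]
  rfl

theorem setIntegral_Iic_eq [CompleteSpace E] {f : ℝ → E} (hf : Integrable f ν) (x : ℝ) :
    ∫ y in Iic x, f y ∂ν = (∫ y in Iio x, f y ∂ν) + ν.real {x} • f x := by
  rw [← integral_singleton, ← setIntegral_union (by simp) (measurableSet_singleton x)
    hf.integrableOn hf.integrableOn]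
  congr 2
  exact Iio_union_right.symm

/-- The balanced primitive sees half of an atom. This half is the source of the factor ½ in B₊ and
B₋. -/
theorem balPrim_eq_add_singleton [CompleteSpace E] {f : ℝ → E} (hf : Integrable f ν) (x : ℝ) :
    balPrim ν f x = (∫ y in Iio x, f y ∂ν) + (1 / 2 : ℝ) • ν.real {x} • f x := by
  rw [balPrim, setIntegral_Iic_eq hf, ← add_assoc, ← two_smul ℝ, smul_add, smul_smul]
  norm_num

/-- Dominated convergence for integrals over a family of sets. -/
theorem tendsto_setIntegral_of_eventually {ι : Type*} {l : Filter ι} [l.IsCountablyGenerated]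
    {f : ℝ → E} (hf : Integrable f ν) {s : ι → Set ℝ} {s' : Set ℝ}
    (hs : ∀ i, MeasurableSet (s i)) (hs' : MeasurableSet s')
    (h : ∀ y, f y ≠ 0 → ∀ᶠ i in l, (y ∈ s i ↔ y ∈ s')) :
    Tendsto (fun i ↦ ∫ y in s i, f y ∂ν) l (𝓝 (∫ y in s', f y ∂ν)) := by
  simp only [← integral_indicator (hs _), ← integral_indicator hs']
  refine tendsto_integral_filter_of_dominated_convergence (fun y ↦ ‖f y‖)
    (Eventually.of_forall fun i ↦ hf.aestronglyMeasurable.indicator (hs i))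
    (Eventually.of_forall fun i ↦ Eventually.of_forall fun y ↦ norm_indicator_le_norm_self _ _)
    hf.norm (Eventually.of_forall fun y ↦ ?_)
  by_cases hy : f y = 0
  · simpa [indicator, hy] using tendsto_const_nhds
  · refine tendsto_const_nhds.congr' ?_
    filter_upwards [h y hy] with i hi
    by_cases hy' : y ∈ s' <;> simp [indicator, hi, hy']

/-- Dominated convergence for the open and the closed half-line at once. Only points where `f` does
not vanish matter, which later allows limits at the ends of an interval supporting `f`. -/
theorem tendsto_balPrim_of_eventually {l : Filter ℝ} [l.IsCountablyGenerated] {f : ℝ → E}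
    (hf : Integrable f ν) {s' : Set ℝ} (hs' : MeasurableSet s')
    (h1 : ∀ y, f y ≠ 0 → ∀ᶠ x in l, (y < x ↔ y ∈ s'))
    (h2 : ∀ y, f y ≠ 0 → ∀ᶠ x in l, (y ≤ x ↔ y ∈ s')) :
    Tendsto (balPrim ν f) l (𝓝 (∫ y in s', f y ∂ν)) := by
  have := ((tendsto_setIntegral_of_eventually (s := fun x ↦ Iio x) hf (fun _ ↦ measurableSet_Iio)
    hs' h1).add (tendsto_setIntegral_of_eventually (s := fun x ↦ Iic x) hf
    (fun _ ↦ measurableSet_Iic) hs' h2)).const_smul (1 / 2 : ℝ)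
  rw [← two_smul ℝ, smul_smul] at this
  norm_num at this
  convert this using 1
  funext x
  simp [balPrim]

theorem tendsto_balPrim_left {f : ℝ → E} (hf : Integrable f ν) (x : ℝ) :
    Tendsto (balPrim ν f) (𝓝[<] x) (𝓝 (∫ y in Iio x, f y ∂ν)) := by
  refine tendsto_balPrim_of_eventually hf measurableSet_Iio (fun y _ ↦ ?_) (fun y _ ↦ ?_)
  all_goals
    rcases lt_or_ge y x with h | h
    · filter_upwards [mem_nhdsWithin_of_mem_nhds (Ioi_mem_nhds h)] with z (hz : y < z)
      simp [h, hz, hz.le]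
    · filter_upwards [self_mem_nhdsWithin] with z (hz : z < x)
      simp [h.not_gt, (hz.trans_le h).not_ge, (hz.trans_le h).not_gt]

theorem tendsto_balPrim_right {f : ℝ → E} (hf : Integrable f ν) (x : ℝ) :
    Tendsto (balPrim ν f) (𝓝[>] x) (𝓝 (∫ y in Iic x, f y ∂ν)) := by
  refine tendsto_balPrim_of_eventually hf measurableSet_Iic (fun y _ ↦ ?_) (fun y _ ↦ ?_)
  all_goals
    rcases lt_or_ge x y with h | h
    · filter_upwards [mem_nhdsWithin_of_mem_nhds (Iio_mem_nhds h)] with z (hz : z < y)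
      simp [h.not_ge, hz.not_ge, hz.not_gt]
    · filter_upwards [self_mem_nhdsWithin] with z (hz : x < z)
      simp [h, (h.trans_lt hz), (h.trans_lt hz).le]

/-- An increment of the primitive is an average of integrals over differences of nested half-lines.
It is therefore dominated by the increment of the monotone primitive of ‖f‖. -/
theorem edist_balPrim_le {f : ℝ → E} (hf : Integrable f ν) {x y : ℝ} (hxy : x ≤ y) :
    ‖balPrim ν f y - balPrim ν f x‖ ≤
      balPrim ν (fun y ↦ ‖f y‖) y - balPrim ν (fun y ↦ ‖f y‖) x := by
  have key {s t : Set ℝ} (hst : s ⊆ t) (hs : MeasurableSet s) :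
      ‖(∫ y in t, f y ∂ν) - ∫ y in s, f y ∂ν‖ ≤ (∫ y in t, ‖f y‖ ∂ν) - ∫ y in s, ‖f y‖ ∂ν := by
    rw [← setIntegral_sdiff hs hf.integrableOn hst, ← setIntegral_sdiff hs hf.norm.integrableOn hst]
    exact norm_integral_le_integral_norm _
  have h1 := key (Iio_subset_Iio hxy) measurableSet_Iio
  have h2 := key (Iic_subset_Iic.2 hxy) measurableSet_Iic
  have h3 : balPrim ν f y - balPrim ν f x = (1 / 2 : ℝ) •
      (((∫ y in Iio y, f y ∂ν) - ∫ y in Iio x, f y ∂ν) +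
        ((∫ y in Iic y, f y ∂ν) - ∫ y in Iic x, f y ∂ν)) := by
    rw [balPrim, balPrim, ← smul_sub]
    congr 1
    abel
  rw [h3, norm_smul]
  refine (mul_le_mul_of_nonneg_left (norm_add_le _ _) (norm_nonneg _)).trans ?_
  simp only [balPrim, smul_eq_mul]
  norm_num
  linarith

theorem boundedVariationOn_balPrim {f : ℝ → E} (hf : Integrable f ν) (s : Set ℝ) :
    BoundedVariationOn (balPrim ν f) s := by
  set g := balPrim ν (fun y ↦ ‖f y‖) with hg
  have hmono : Monotone g := fun x y hxy ↦ by
    have := (norm_nonneg _).trans (edist_balPrim_le hf hxy)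
    linarith
  have hle : eVariationOn (balPrim ν f) s ≤ eVariationOn g s := by
    refine iSup_le fun p ↦ le_trans (Finset.sum_le_sum fun i _ ↦ ?_)
      (le_iSup (fun p : ℕ × { u : ℕ → ℝ // Monotone u ∧ ∀ i, u i ∈ s } ↦
        ∑ i ∈ Finset.range p.1, edist (g (p.2.1 (i + 1))) (g (p.2.1 i))) p)
    have h := edist_balPrim_le hf (p.2.2.1 i.le_succ)
    rw [edist_dist, edist_dist, dist_eq_norm, dist_eq_norm]
    exact ENNReal.ofReal_le_ofReal (h.trans (le_abs_self _))
  refine ne_top_of_le_ne_top ?_ hle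
  -- For the monotone `g` the sum telescopes, and |g| ≤ ∫‖f‖ at both ends gives the factor 2.
  refine ne_top_of_le_ne_top (b := ENNReal.ofReal (2 * ∫ y, ‖f y‖ ∂ν)) ENNReal.ofReal_ne_top ?_
  refine iSup_le fun p ↦ ?_
  have h1 : ∀ i, edist (g (p.2.1 (i + 1))) (g (p.2.1 i)) =
      ENNReal.ofReal (g (p.2.1 (i + 1)) - g (p.2.1 i)) := fun i ↦ by
    rw [edist_dist, Real.dist_eq, abs_of_nonneg (sub_nonneg.2 (hmono (p.2.2.1 i.le_succ)))]
  simp only [h1]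
  rw [← ENNReal.ofReal_sum_of_nonneg fun i _ ↦ sub_nonneg.2 (hmono (p.2.2.1 i.le_succ)),
    Finset.sum_range_sub (fun i ↦ g (p.2.1 i))]
  refine ENNReal.ofReal_le_ofReal ?_
  have h2 (x : ℝ) : |g x| ≤ ∫ y, ‖f y‖ ∂ν := by
    simpa using norm_balPrim_le hf.norm x
  have h3 := abs_le.1 (h2 (p.2.1 p.1))
  have h4 := abs_le.1 (h2 (p.2.1 0))
  linarith

/-- `u` solves the Volterra equation `u = c + P (A u)` on the real line, where `P` forms balanced
primitives with respect to `ν`. -/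
structure IsVolterra (ν : Measure ℝ) (A : ℝ → E →L[ℝ] E) (c : E) (u : ℝ → E) : Prop where
  integrable : Integrable (fun x ↦ A x (u x)) ν
  eq : ∀ x, u x = c + balPrim ν (fun y ↦ A y (u y)) x

/-- The value at `∞` of a solution of the Volterra equation. -/
noncomputable def volterraEnd (ν : Measure ℝ) (A : ℝ → E →L[ℝ] E) (c : E) (u : ℝ → E) : E :=
  c + ∫ y, A y (u y) ∂ν

/-- Gluing solutions of the Volterra equation at a point. -/
theorem IsVolterra.glue [CompleteSpace E] [IsFiniteMeasure ν] {A : ℝ → E →L[ℝ] E} {c : E} {u₁ u₂ : ℝ → E} {τ : ℝ} {v : E}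
    (h₁ : IsVolterra ν ((Iio τ).indicator A) c u₁)
    (hv : v = volterraEnd ν ((Iio τ).indicator A) c u₁ + (1 / 2 : ℝ) • ν.real {τ} • A τ v)
    (h₂ : IsVolterra ν ((Ioi τ).indicator A)
      (volterraEnd ν ((Iio τ).indicator A) c u₁ + ν.real {τ} • A τ v) u₂) :
    ∃ u, IsVolterra ν A c u ∧ (∀ x < τ, u x = u₁ x) ∧ u τ = v ∧ (∀ x > τ, u x = u₂ x) ∧
      volterraEnd ν A c u = volterraEnd ν ((Ioi τ).indicator A)
        (volterraEnd ν ((Iio τ).indicator A) c u₁ + ν.real {τ} • A τ v) u₂ := by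
  set L := volterraEnd ν ((Iio τ).indicator A) c u₁ with hL
  let u : ℝ → E := fun x ↦ if x < τ then u₁ x else if x = τ then v else u₂ x
  have u1 : ∀ x < τ, u x = u₁ x := fun x hx ↦ by simp [u, hx]
  have u2 : u τ = v := by simp [u]
  have u3 : ∀ x > τ, u x = u₂ x := fun x hx ↦ by simp [u, hx.not_gt, hx.ne']
  have e1 : (fun x ↦ (Iio τ).indicator A x (u₁ x)) = (Iio τ).indicator fun x ↦ A x (u x) := by
    funext x
    by_cases hx : x < τ
    · simp [indicator, hx, u1 x hx]
    · simp [indicator, hx]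
  have e3 : (fun x ↦ (Ioi τ).indicator A x (u₂ x)) = (Ioi τ).indicator fun x ↦ A x (u x) := by
    funext x
    by_cases hx : τ < x
    · simp [indicator, hx, u3 x hx]
    · simp [indicator, hx]
  have i1 : IntegrableOn (fun x ↦ A x (u x)) (Iio τ) ν := by
    rw [← integrable_indicator_iff measurableSet_Iio, ← e1]
    exact h₁.integrable
  have i3 : IntegrableOn (fun x ↦ A x (u x)) (Ioi τ) ν := by
    rw [← integrable_indicator_iff measurableSet_Ioi, ← e3]
    exact h₂.integrable
  have i2 : IntegrableOn (fun x ↦ A x (u x)) {τ} ν := by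
    rw [integrableOn_singleton_iff]
    simp
  have hint : Integrable (fun x ↦ A x (u x)) ν := by
    rw [← integrableOn_univ, ← Iio_union_Ici (a := τ), ← Ioi_insert, insert_eq]
    exact i1.union (i2.union i3)
  have hLe : L = c + ∫ y in Iio τ, A y (u y) ∂ν := by
    rw [hL, volterraEnd, e1, integral_indicator measurableSet_Iio]
  have hIic : ∫ y in Iic τ, A y (u y) ∂ν = (∫ y in Iio τ, A y (u y) ∂ν) + ν.real {τ} • A τ v := by
    rw [setIntegral_Iic_eq hint, u2]
  refine ⟨u, ⟨hint, fun x ↦ ?_⟩, u1, u2, u3, ?_⟩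
  · rcases lt_trichotomy x τ with hx | rfl | hx
    · rw [u1 x hx, h₁.eq x, e1, balPrim, balPrim, setIntegral_indicator measurableSet_Iio,
        setIntegral_indicator measurableSet_Iio, inter_eq_left.2 (Iio_subset_Iio hx.le),
        inter_eq_left.2 (Iic_subset_Iio.2 hx)]
    · rw [u2, balPrim_eq_add_singleton hint, ← add_assoc, ← hLe, u2]
      exact hv
    · rw [u3 x hx, h₂.eq x, hLe, e3, balPrim, balPrim, setIntegral_indicator measurableSet_Ioi,
        setIntegral_indicator measurableSet_Ioi]
      have a1 : ∫ y in Iio x, A y (u y) ∂ν = (∫ y in Iic τ, A y (u y) ∂ν) +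
          ∫ y in Iio x ∩ Ioi τ, A y (u y) ∂ν := by
        rw [← setIntegral_union _ (measurableSet_Iio.inter measurableSet_Ioi) hint.integrableOn
          hint.integrableOn]
        · congr 2
          ext y
          simp only [mem_Iio, mem_union, mem_Iic, mem_inter_iff, mem_Ioi]
          grind
        · exact disjoint_left.2 fun y hy hy' ↦ not_lt.2 (mem_Iic.1 hy) (mem_Ioi.1 hy'.2)
      have a2 : ∫ y in Iic x, A y (u y) ∂ν = (∫ y in Iic τ, A y (u y) ∂ν) +
          ∫ y in Iic x ∩ Ioi τ, A y (u y) ∂ν := by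
        rw [← setIntegral_union _ (measurableSet_Iic.inter measurableSet_Ioi) hint.integrableOn
          hint.integrableOn]
        · congr 2
          ext y
          simp only [mem_union, mem_Iic, mem_inter_iff, mem_Ioi]
          grind
        · exact disjoint_left.2 fun y hy hy' ↦ not_lt.2 (mem_Iic.1 hy) (mem_Ioi.1 hy'.2)
      rw [a1, a2, hIic]
      module
  · rw [volterraEnd, volterraEnd, e3, integral_indicator measurableSet_Ioi, hLe, add_assoc c,
      ← hIic, ← compl_Iic, add_assoc, integral_add_compl measurableSet_Iic hint]

/-- The Volterra equation can be solved when `A ν` has total mass less than one. -/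
theorem exists_isVolterra_of_small [CompleteSpace E] [IsFiniteMeasure ν] {A : ℝ → E →L[ℝ] E}
    (hA : Integrable A ν) (hsmall : ∫ x, ‖A x‖ ∂ν < 1) (c : E) : ∃ u, IsVolterra ν A c u := by
  have hmeas (f : ℝ →₁[ν] E) : AEStronglyMeasurable (fun x ↦ A x (c + balPrim ν f x)) ν := by
    have h1 : StronglyMeasurable fun x ↦ c + balPrim ν f x :=
      stronglyMeasurable_const.add (stronglyMeasurable_balPrim (Lp.stronglyMeasurable f))
    exact (ContinuousLinearMap.id ℝ (E →L[ℝ] E)).aestronglyMeasurable_comp₂ hA.1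
      h1.aestronglyMeasurable
  have hint (f : ℝ →₁[ν] E) : Integrable (fun x ↦ A x (c + balPrim ν f x)) ν := by
    refine Integrable.mono' (hA.norm.mul_const (‖c‖ + ∫ y, ‖f y‖ ∂ν)) (hmeas f)
      (Eventually.of_forall fun x ↦ ?_)
    refine (ContinuousLinearMap.le_opNorm _ _).trans ?_
    gcongr
    exact (norm_add_le _ _).trans
      (add_le_add_right (norm_balPrim_le (L1.integrable_coeFn f) x) _)
  -- The unknown is f = Au in L¹(ν) rather than u. Since |Pf| ≤ ∫‖f‖ everywhere, f ↦ A(c + Pf) has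
  -- Lipschitz constant ∫‖A‖ < 1.
  let T : (ℝ →₁[ν] E) → (ℝ →₁[ν] E) := fun f ↦ (hint f).toL1 _
  have hK0 : 0 ≤ ∫ x, ‖A x‖ ∂ν := integral_nonneg fun _ ↦ norm_nonneg _
  have hT : ContractingWith ⟨∫ x, ‖A x‖ ∂ν, hK0⟩ T := by
    refine ⟨hsmall, LipschitzWith.of_dist_le_mul fun f g ↦ ?_⟩
    rw [L1.dist_eq_integral_dist, L1.dist_eq_integral_dist]
    have h1 : ∫ a, dist (T f a) (T g a) ∂ν =
        ∫ a, ‖A a (balPrim ν (fun y ↦ f y - g y) a)‖ ∂ν := by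
      refine integral_congr_ae ?_
      filter_upwards [(hint f).coeFn_toL1, (hint g).coeFn_toL1] with a ha hb
      rw [ha, hb, dist_eq_norm, ← map_sub, add_sub_add_left_eq_sub,
        balPrim_sub (L1.integrable_coeFn f) (L1.integrable_coeFn g)]
    have hfg : Integrable (fun y ↦ f y - g y) ν :=
      (L1.integrable_coeFn f).sub (L1.integrable_coeFn g)
    have h2 : ∫ a, dist (f a) (g a) ∂ν = ∫ y, ‖f y - g y‖ ∂ν := by simp only [dist_eq_norm]
    rw [h1, h2]
    change _ ≤ (∫ x, ‖A x‖ ∂ν) * _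
    rw [← integral_mul_const]
    refine integral_mono_of_nonneg (Eventually.of_forall fun _ ↦ norm_nonneg _)
      (hA.norm.mul_const _) (Eventually.of_forall fun a ↦ ?_)
    refine (ContinuousLinearMap.le_opNorm _ _).trans ?_
    exact mul_le_mul_of_nonneg_left (norm_balPrim_le hfg a) (norm_nonneg _)
  have hfix : T hT.fixedPoint = hT.fixedPoint := hT.fixedPoint_isFixedPt
  set f := hT.fixedPoint
  have hae : (fun x ↦ A x (c + balPrim ν f x)) =ᵐ[ν] f := by
    conv_rhs => rw [← hfix]
    exact (hint f).coeFn_toL1.symm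
  -- The fixed point equation holds only almost everywhere, but the primitive does not change on
  -- null sets. So c + Pf solves the Volterra equation at every point.
  exact ⟨fun x ↦ c + balPrim ν f x, hint f, fun x ↦ by rw [balPrim_congr_ae hae]⟩

theorem integrable_indicator {A : ℝ → E →L[ℝ] E} (hA : Integrable A ν) {s : Set ℝ}
    (hs : MeasurableSet s) : Integrable (s.indicator A) ν := by
  refine hA.norm.mono' (hA.1.indicator hs) (Eventually.of_forall fun x ↦ ?_)
  by_cases hx : x ∈ s <;> simp [indicator, hx]

/-- A finite measure on the line which exceeds `r` has an `r`-quantile. -/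
theorem exists_quantile (ρ : Measure ℝ) [IsFiniteMeasure ρ] {r : ENNReal} (hr : 0 < r)
    (h : r < ρ univ) : ∃ τ, ρ (Iio τ) ≤ r ∧ r ≤ ρ (Iic τ) := by
  have htop : Tendsto (fun x ↦ ρ (Iic x)) atTop (𝓝 (ρ univ)) := tendsto_measure_Iic_atTop ρ
  have hbot : Tendsto (fun x ↦ ρ (Iic x)) atBot (𝓝 0) := by
    have := tendsto_measure_iInter_atBot (μ := ρ) (s := fun x : ℝ ↦ Iic x)
      (fun _ ↦ measurableSet_Iic.nullMeasurableSet) (fun i j hij ↦ Iic_subset_Iic.2 hij)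
      ⟨0, measure_ne_top _ _⟩
    rwa [show ⋂ x : ℝ, Iic x = ∅ from eq_empty_of_forall_notMem fun y hy ↦ by
      have := mem_iInter.1 hy (y - 1)
      rw [mem_Iic] at this
      linarith, measure_empty] at this
  set s := {x | r ≤ ρ (Iic x)}
  obtain ⟨x₁, hx₁⟩ := (htop.eventually_const_lt h).exists
  have hne : s.Nonempty := ⟨x₁, hx₁.le⟩
  obtain ⟨x₀, hx₀⟩ := (hbot.eventually_lt_const hr).exists
  have hbdd : BddBelow s := ⟨x₀, fun y hy ↦ by
    by_contra hlt
    exact absurd (hy.trans (measure_mono (Iic_subset_Iic.2 (not_le.1 hlt).le))) (not_le.2 hx₀)⟩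
  -- The infimum τ of all x with ρ(-∞,x] ≥ r works: (-∞,τ) is exhausted by half-lines of mass below
  -- r, and (-∞,τ] is the intersection of half-lines of mass at least r.
  refine ⟨sInf s, ?_, ?_⟩
  · obtain ⟨v, hvm, hv, hlim⟩ := exists_seq_strictMono_tendsto (sInf s)
    have hU : Iio (sInf s) = ⋃ k, Iic (v k) := by
      ext y
      simp only [mem_Iio, mem_iUnion, mem_Iic]
      exact ⟨fun hy ↦ ((hlim.eventually_const_lt hy).exists).imp fun _ h ↦ h.le,
        fun ⟨k, hk⟩ ↦ hk.trans_lt (hv k)⟩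
    have hmono : Monotone fun k ↦ Iic (v k) := fun i j hij ↦ Iic_subset_Iic.2 (hvm.monotone hij)
    rw [hU, hmono.measure_iUnion]
    exact iSup_le fun k ↦ (not_le.1 fun hk ↦ absurd (csInf_le hbdd hk) (not_le.2 (hv k))).le
  · obtain ⟨v, hv, hlim, hmem⟩ := exists_seq_tendsto_sInf hne hbdd
    have hI : Iic (sInf s) = ⋂ k, Iic (v k) := by
      ext y
      simp only [mem_iInter, mem_Iic]
      exact ⟨fun hy k ↦ hy.trans (csInf_le hbdd (hmem k)), fun hy ↦ ge_of_tendsto' hlim hy⟩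
    have := tendsto_measure_iInter_atTop (μ := ρ) (s := fun k ↦ Iic (v k))
      (fun k ↦ measurableSet_Iic.nullMeasurableSet)
      (fun i j hij ↦ Iic_subset_Iic.2 (hv hij)) ⟨0, measure_ne_top _ _⟩
    rw [← hI] at this
    exact ge_of_tendsto' this hmem

/-- The Volterra equation can be solved if no point mass of `A ν` prevents this. -/
theorem exists_isVolterra [CompleteSpace E] [IsFiniteMeasure ν] {A : ℝ → E →L[ℝ] E}
    (hA : Integrable A ν)
    (hinv : ∀ x (v : E), ∃ w, w = v + (1 / 2 : ℝ) • ν.real {x} • A x w) (c : E) :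
    ∃ u, IsVolterra ν A c u := by
  -- Induction on the mass of ‖A‖ν in units of ½. At a ½-quantile τ the part left of τ has mass at
  -- most ½ and is solved by contraction, the atom at τ is handled by `hinv`, and the part right of
  -- τ has lost at least ½.
  have key (k : ℕ) : ∀ A : ℝ → E →L[ℝ] E, Integrable A ν →
      (∀ x (v : E), ∃ w, w = v + (1 / 2 : ℝ) • ν.real {x} • A x w) →
      ν.withDensity (fun x ↦ ‖A x‖ₑ) univ ≤ (k + 1) * 2⁻¹ → ∀ c : E, ∃ u, IsVolterra ν A c u := by
    have small (A : ℝ → E →L[ℝ] E) (hA : Integrable A ν)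
        (h : ν.withDensity (fun x ↦ ‖A x‖ₑ) univ ≤ 2⁻¹) (c : E) : ∃ u, IsVolterra ν A c u := by
      refine exists_isVolterra_of_small hA ?_ c
      rw [withDensity_apply _ MeasurableSet.univ, Measure.restrict_univ] at h
      rw [integral_norm_eq_lintegral_enorm hA.1]
      have := ENNReal.toReal_mono (by simp) h
      norm_num at this
      linarith
    induction k with
    | zero => exact fun A hA _ h c ↦ small A hA (by simpa using h) c
    | succ k ih =>
      intro A hA hinv h c
      set ρ := ν.withDensity (fun x ↦ ‖A x‖ₑ) with hρ
      have hfin : IsFiniteMeasure ρ := ⟨by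
        rw [hρ, withDensity_apply _ MeasurableSet.univ, Measure.restrict_univ]
        exact hA.2⟩
      rcases le_or_gt (ρ univ) 2⁻¹ with hle | hlt
      · exact small A hA hle c
      obtain ⟨τ, h1, h2⟩ := exists_quantile ρ (by simp) hlt
      have hind (s : Set ℝ) (hs : MeasurableSet s) :
          ν.withDensity (fun x ↦ ‖s.indicator A x‖ₑ) univ = ρ s := by
        rw [hρ, withDensity_apply _ MeasurableSet.univ, withDensity_apply _ hs,
          Measure.restrict_univ, ← lintegral_indicator hs]
        congr 1
        funext x
        by_cases hx : x ∈ s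
        · simp [indicator, hx]
        · simp only [indicator, hx, if_false]
          rw [← ofReal_norm, norm_zero, ENNReal.ofReal_zero]
      obtain ⟨u₁, hu₁⟩ := small _ (integrable_indicator hA measurableSet_Iio)
        ((hind _ measurableSet_Iio).trans_le h1) c
      obtain ⟨v, hv⟩ := hinv τ (volterraEnd ν ((Iio τ).indicator A) c u₁)
      have h3 : ρ (Ioi τ) ≤ (k + 1) * 2⁻¹ := by
        have : ρ univ = ρ (Iic τ) + ρ (Ioi τ) := by
          rw [← measure_union (disjoint_left.2 fun y hy hy' ↦
            not_lt.2 (mem_Iic.1 hy) (mem_Ioi.1 hy')) measurableSet_Ioi, Iic_union_Ioi]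
        rw [this] at h
        push_cast at h
        have h4 : 2⁻¹ + ρ (Ioi τ) ≤ 2⁻¹ + (k + 1) * 2⁻¹ := by
          refine (add_le_add_left h2 _).trans (h.trans (le_of_eq ?_))
          ring
        exact (ENNReal.add_le_add_iff_left (by simp)).1 h4
      obtain ⟨u₂, hu₂⟩ := ih _ (integrable_indicator hA measurableSet_Ioi) (fun x v ↦ by
        by_cases hx : x ∈ Ioi τ
        · simpa [indicator, hx] using hinv x v
        · exact ⟨v, by simp [indicator, hx]⟩) ((hind _ measurableSet_Ioi).trans_le h3)
        (volterraEnd ν ((Iio τ).indicator A) c u₁ + ν.real {τ} • A τ v)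
      obtain ⟨u, hu, -⟩ := hu₁.glue hv hu₂
      exact ⟨u, hu⟩
  have hfin : ν.withDensity (fun x ↦ ‖A x‖ₑ) univ ≠ ⊤ := by
    rw [withDensity_apply _ MeasurableSet.univ, Measure.restrict_univ]
    exact hA.2.ne
  obtain ⟨k, hk⟩ := ENNReal.exists_nat_gt
    (ENNReal.mul_ne_top hfin (ENNReal.ofNat_ne_top (n := 2)))
  refine key k A hA hinv ?_ c
  rw [← div_eq_mul_inv, ENNReal.le_div_iff_mul_le (by simp) (by simp)]
  exact hk.le.trans le_self_add

/-- Integration by parts for balanced primitives. -/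
theorem integral_balPrim_mul [SFinite ν] {f g : ℝ → ℂ} (hf : Integrable f ν) (hg : Integrable g ν) :
    ∫ x, (f x * balPrim ν g x + balPrim ν f x * g x) ∂ν = (∫ x, f x ∂ν) * ∫ x, g x ∂ν := by
  have hfg : Integrable (fun p : ℝ × ℝ ↦ f p.1 * g p.2) (ν.prod ν) := hf.mul_prod hg
  have hfg' : Integrable (fun p : ℝ × ℝ ↦ f p.2 * g p.1) (ν.prod ν) := hfg.swap
  have hlt : MeasurableSet {p : ℝ × ℝ | p.2 < p.1} := measurableSet_lt measurable_snd measurable_fst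
  have hle : MeasurableSet {p : ℝ × ℝ | p.2 ≤ p.1} := measurableSet_le measurable_snd measurable_fst
  have e1 (h : ℝ → ℂ) (x : ℝ) : balPrim ν h x = (1 / 2 : ℂ) * ((∫ y, (Iio x).indicator h y ∂ν) +
      ∫ y, (Iic x).indicator h y ∂ν) := by
    rw [balPrim, integral_indicator measurableSet_Iio, integral_indicator measurableSet_Iic,
      Complex.real_smul]
    norm_num
  have a1 (r : Set (ℝ × ℝ)) (hr : MeasurableSet r) :
      Integrable (fun x ↦ ∫ y, r.indicator (fun p : ℝ × ℝ ↦ f p.1 * g p.2) (x, y) ∂ν) ν :=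
    (hfg.indicator hr).integral_prod_left
  have a2 (r : Set (ℝ × ℝ)) (hr : MeasurableSet r) :
      Integrable (fun x ↦ ∫ y, r.indicator (fun p : ℝ × ℝ ↦ f p.2 * g p.1) (x, y) ∂ν) ν :=
    (hfg'.indicator hr).integral_prod_left
  have b1 (r : Set (ℝ × ℝ)) (hr : MeasurableSet r) :
      ∫ x, ∫ y, r.indicator (fun p : ℝ × ℝ ↦ f p.1 * g p.2) (x, y) ∂ν ∂ν =
        ∫ p in r, f p.1 * g p.2 ∂(ν.prod ν) := by
    rw [← integral_indicator hr, integral_prod _ (hfg.indicator hr)]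
  have b2 (r : Set (ℝ × ℝ)) (hr : MeasurableSet r) :
      ∫ x, ∫ y, r.indicator (fun p : ℝ × ℝ ↦ f p.2 * g p.1) (x, y) ∂ν ∂ν =
        ∫ p in Prod.swap ⁻¹' r, f p.1 * g p.2 ∂(ν.prod ν) := by
    rw [← integral_indicator (measurable_swap hr)]
    refine Eq.trans ?_ (integral_prod_swap _)
    exact (integral_prod _ (hfg.indicator (measurable_swap hr)).swap).symm
  have hpt (x : ℝ) : f x * balPrim ν g x + balPrim ν f x * g x = (1 / 2 : ℂ) *
      (((∫ y, {p : ℝ × ℝ | p.2 < p.1}.indicator (fun p : ℝ × ℝ ↦ f p.1 * g p.2) (x, y) ∂ν) +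
        ∫ y, {p : ℝ × ℝ | p.2 ≤ p.1}.indicator (fun p : ℝ × ℝ ↦ f p.1 * g p.2) (x, y) ∂ν) +
      ((∫ y, {p : ℝ × ℝ | p.2 < p.1}.indicator (fun p : ℝ × ℝ ↦ f p.2 * g p.1) (x, y) ∂ν) +
        ∫ y, {p : ℝ × ℝ | p.2 ≤ p.1}.indicator (fun p : ℝ × ℝ ↦ f p.2 * g p.1) (x, y) ∂ν)) := by
    have c1 (r : Set (ℝ × ℝ)) : ∫ y, r.indicator (fun p : ℝ × ℝ ↦ f p.1 * g p.2) (x, y) ∂ν =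
        f x * ∫ y, (Prod.mk x ⁻¹' r).indicator g y ∂ν := by
      rw [← integral_const_mul]
      congr 1
      funext y
      by_cases hy : (x, y) ∈ r <;> simp [indicator, hy]
    have c2 (r : Set (ℝ × ℝ)) : ∫ y, r.indicator (fun p : ℝ × ℝ ↦ f p.2 * g p.1) (x, y) ∂ν =
        (∫ y, (Prod.mk x ⁻¹' r).indicator f y ∂ν) * g x := by
      rw [← integral_mul_const]
      congr 1
      funext y
      by_cases hy : (x, y) ∈ r <;> simp [indicator, hy]
    rw [c1, c1, c2, c2, e1, e1]
    change f x * ((1 / 2 : ℂ) * ((∫ y, (Iio x).indicator g y ∂ν) + ∫ y, (Iic x).indicator g y ∂ν)) +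
      ((1 / 2 : ℂ) * ((∫ y, (Iio x).indicator f y ∂ν) + ∫ y, (Iic x).indicator f y ∂ν)) * g x =
      (1 / 2 : ℂ) * ((f x * (∫ y, (Iio x).indicator g y ∂ν) + f x * ∫ y, (Iic x).indicator g y ∂ν) +
      ((∫ y, (Iio x).indicator f y ∂ν) * g x + (∫ y, (Iic x).indicator f y ∂ν) * g x))
    ring
  simp only [hpt]
  rw [integral_const_mul, integral_add (by exact (a1 _ hlt).add (a1 _ hle)) (by exact (a2 _ hlt).add (a2 _ hle)),
    integral_add (a1 _ hlt) (a1 _ hle), integral_add (a2 _ hlt) (a2 _ hle), b1 _ hlt, b1 _ hle,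
    b2 _ hlt, b2 _ hle, ← integral_prod_mul]
  -- The half-plane y < x and the reflection of y ≤ x are complementary. The diagonal is thus
  -- counted exactly once in `d1` and once in `d2`, and balancing averages the two, so no extra term
  -- from common atoms appears.
  have d1 : (∫ p in {p : ℝ × ℝ | p.2 < p.1}, f p.1 * g p.2 ∂(ν.prod ν)) +
      ∫ p in Prod.swap ⁻¹' {p : ℝ × ℝ | p.2 ≤ p.1}, f p.1 * g p.2 ∂(ν.prod ν) =
      ∫ p, f p.1 * g p.2 ∂(ν.prod ν) := by
    rw [← integral_add_compl hlt hfg]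
    congr 3
    ext p
    simp
  have d2 : (∫ p in {p : ℝ × ℝ | p.2 ≤ p.1}, f p.1 * g p.2 ∂(ν.prod ν)) +
      ∫ p in Prod.swap ⁻¹' {p : ℝ × ℝ | p.2 < p.1}, f p.1 * g p.2 ∂(ν.prod ν) =
      ∫ p, f p.1 * g p.2 ∂(ν.prod ν) := by
    rw [← integral_add_compl hle hfg]
    congr 3
    ext p
    simp
  linear_combination (1 / 2 : ℂ) * d1 + (1 / 2 : ℂ) * d2

end Volterra

/-! ### Densities of complex and matrix measures -/

section Density

/-- Domination by ν implies absolute continuity, so the Radon-Nikodym theorem applies to the real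
and the imaginary part. -/
theorem withDensityᵥ_rnDeriv_of_variation_le {c : ComplexMeasure ℝ} {ν : Measure ℝ}
    [IsFiniteMeasure ν] (h : c.variation ≤ ν) : ν.withDensityᵥ (c.rnDeriv ν) = c := by
  have hc (A : Set ℝ) (hA : ν A = 0) : c A = 0 := by
    have h1 := VectorMeasure.enorm_measure_le_variation (μ := c) (E := A)
    have h2 : c.variation A = 0 := le_antisymm ((h A).trans hA.le) zero_le
    rw [h2] at h1
    simpa using h1
  have hre : ν.withDensityᵥ ((ComplexMeasure.re c).rnDeriv ν) = ComplexMeasure.re c := by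
    refine SignedMeasure.withDensityᵥ_rnDeriv_eq _ _ (VectorMeasure.AbsolutelyContinuous.mk
      fun A hA hA' ↦ ?_)
    rw [Measure.toENNRealVectorMeasure_apply_measurable hA] at hA'
    have : ComplexMeasure.re c A = (c A).re := rfl
    rw [this, hc A hA', Complex.zero_re]
  have him : ν.withDensityᵥ ((ComplexMeasure.im c).rnDeriv ν) = ComplexMeasure.im c := by
    refine SignedMeasure.withDensityᵥ_rnDeriv_eq _ _ (VectorMeasure.AbsolutelyContinuous.mk
      fun A hA hA' ↦ ?_)
    rw [Measure.toENNRealVectorMeasure_apply_measurable hA] at hA'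
    have : ComplexMeasure.im c A = (c A).im := rfl
    rw [this, hc A hA', Complex.zero_im]
  have hi := ComplexMeasure.integrable_rnDeriv c ν
  ext1 A hA
  rw [withDensityᵥ_apply hi hA]
  have h1 : ∫ x in A, (ComplexMeasure.re c).rnDeriv ν x ∂ν = (c A).re := by
    rw [← withDensityᵥ_apply (SignedMeasure.integrable_rnDeriv _ _) hA, hre]
    rfl
  have h2 : ∫ x in A, (ComplexMeasure.im c).rnDeriv ν x ∂ν = (c A).im := by
    rw [← withDensityᵥ_apply (SignedMeasure.integrable_rnDeriv _ _) hA, him]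
    rfl
  apply Complex.ext
  · rw [← h1]
    exact (integral_re hi.integrableOn).symm
  · rw [← h2]
    exact (integral_im hi.integrableOn).symm

/-- Integration with respect to a complex measure with a density. -/
theorem integral_withDensityᵥ_mul {ν : Measure ℝ} {h : ℝ → ℂ} (hh : Integrable h ν) {f : ℝ → ℂ}
    (hf : (ν.withDensityᵥ h).Integrable f) :
    Integrable (fun x ↦ f x * h x) ν ∧
      (ν.withDensityᵥ h).integral f (ContinuousLinearMap.mul ℝ ℂ) = ∫ x, f x * h x ∂ν := by
  have hvar : (ν.withDensityᵥ h).variation = ν.withDensity fun x ↦ ‖h x‖ₑ :=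
    Measure.variation_withDensityᵥ hh
  have hfin : IsFiniteMeasure (ν.withDensityᵥ h).variation := isFiniteMeasure_variation _
  have hae {p : ℝ → ℂ} {r : ℝ → ℂ} (hp : p =ᵐ[(ν.withDensityᵥ h).variation] r) :
      (fun x ↦ p x * h x) =ᵐ[ν] fun x ↦ r x * h x := by
    -- A null set of |h|ν need not be a null set of ν, but on it h vanishes ν-almost everywhere.
    rw [hvar, EventuallyEq, ae_withDensity_iff' hh.1.enorm] at hp
    filter_upwards [hp] with x hx
    by_cases hx0 : h x = 0
    · simp [hx0]
    · rw [hx (by simpa using hx0)]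
  have hmeas {p : ℝ → ℂ} (hp : AEStronglyMeasurable p (ν.withDensityᵥ h).variation) :
      AEStronglyMeasurable (fun x ↦ p x * h x) ν :=
    (hp.stronglyMeasurable_mk.aestronglyMeasurable.mul hh.1).congr (hae hp.ae_eq_mk.symm)
  -- Multiplication by h preserves the L¹ norm from |h|ν to ν. This makes the right-hand side of the
  -- claim continuous in L¹ and justifies the closedness step of the induction below.
  have hlint {p : ℝ → ℂ} (hp : AEStronglyMeasurable p (ν.withDensityᵥ h).variation) :
      ∫⁻ x, ‖p x * h x‖ₑ ∂ν = ∫⁻ x, ‖p x‖ₑ ∂(ν.withDensityᵥ h).variation := by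
    have e1 : ∫⁻ x, ‖p x * h x‖ₑ ∂ν = ∫⁻ x, ‖hp.mk p x * h x‖ₑ ∂ν := by
      refine lintegral_congr_ae ?_
      filter_upwards [hae hp.ae_eq_mk] with x hx
      rw [hx]
    have e2 : ∫⁻ x, ‖p x‖ₑ ∂(ν.withDensityᵥ h).variation =
        ∫⁻ x, ‖hp.mk p x‖ₑ ∂(ν.withDensityᵥ h).variation := by
      refine lintegral_congr_ae ?_
      filter_upwards [hp.ae_eq_mk] with x hx
      rw [hx]
    have hm := hp.stronglyMeasurable_mk.measurable
    rw [e1, e2]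
    generalize hp.mk p = p' at hm
    rw [hvar, lintegral_withDensity_eq_lintegral_mul₀ hh.1.enorm hm.enorm.aemeasurable]
    refine lintegral_congr fun x ↦ ?_
    rw [enorm_mul, Pi.mul_apply, mul_comm]
  have hint {p : ℝ → ℂ} (hp : (ν.withDensityᵥ h).Integrable p) :
      Integrable (fun x ↦ p x * h x) ν :=
    ⟨hmeas hp.1, by
      rw [HasFiniteIntegral, hlint hp.1]
      exact hp.2⟩
  refine ⟨hint hf, ?_⟩
  refine Integrable.induction (fun p ↦ (ν.withDensityᵥ h).integral p
    (ContinuousLinearMap.mul ℝ ℂ) = ∫ x, p x * h x ∂ν) ?_ ?_ ?_ ?_ hf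
  · intro c s hs _
    rw [VectorMeasure.integral_eq_setToFun, setToFun_indicator_const _ hs (measure_ne_top _ _),
      transpose_eq_cbmApplyMeasure, cbmApplyMeasure_apply, withDensityᵥ_apply hh hs,
      ContinuousLinearMap.mul_apply', ← integral_const_mul, ← integral_indicator hs]
    congr 1
    funext x
    by_cases hx : x ∈ s <;> simp [indicator, hx]
  · intro p r _ hp hr e1 e2
    rw [VectorMeasure.integral_add hp hr, e1, e2, ← integral_add (hint hp) (hint hr)]
    simp only [Pi.add_apply, add_mul]
  · refine isClosed_eq VectorMeasure.continuous_integral ?_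
    refine LipschitzWith.continuous (K := 1) (LipschitzWith.of_dist_le_mul fun p r ↦ ?_)
    have hp := L1.integrable_coeFn p
    have hr := L1.integrable_coeFn r
    rw [L1.dist_eq_integral_dist, dist_eq_norm, ← integral_sub (hint hp) (hint hr), NNReal.coe_one,
      one_mul]
    simp only [← sub_mul, dist_eq_norm]
    refine (norm_integral_le_integral_norm _).trans (le_of_eq ?_)
    have hpr := (hp.sub hr).1
    simp only [← Pi.sub_apply]
    rw [integral_norm_eq_lintegral_enorm (hmeas hpr), integral_norm_eq_lintegral_enorm hpr]
    exact congrArg ENNReal.toReal (hlint (hp.sub hr).1)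
  · intro p r hpr _ e
    rw [← VectorMeasure.integral_congr_ae hpr, e, integral_congr_ae (hae hpr)]

theorem restrict_withDensityᵥ {ν : Measure ℝ} {h : ℝ → ℂ} (hh : Integrable h ν) {A : Set ℝ}
    (hA : MeasurableSet A) :
    (ν.withDensityᵥ h).restrict A = (ν.restrict A).withDensityᵥ h := by
  ext1 s hs
  rw [VectorMeasure.restrict_apply _ hA hs, withDensityᵥ_apply hh (hs.inter hA),
    withDensityᵥ_apply hh.integrableOn hs, Measure.restrict_restrict hs]

variable {n : ℕ}

/-- A finite positive measure with respect to which the entries of `q` and `w` have densities. -/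
noncomputable def Coeffs.baseMeasure (S : Coeffs n) : Measure ℝ :=
  ∑ i, ∑ k, ((S.q i k).variation + (S.w i k).variation)

instance (S : Coeffs n) : IsFiniteMeasure S.baseMeasure := by
  have h (c : ComplexMeasure ℝ) : IsFiniteMeasure c.variation := isFiniteMeasure_variation c
  refine ⟨?_⟩
  rw [Coeffs.baseMeasure, Measure.finsetSum_apply]
  refine ENNReal.sum_lt_top.2 fun i _ ↦ ?_
  rw [Measure.finsetSum_apply]
  exact ENNReal.sum_lt_top.2 fun k _ ↦ measure_lt_top _ _

theorem Coeffs.variation_add_le (S : Coeffs n) (i k : Fin n) :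
    (S.q i k).variation + (S.w i k).variation ≤ S.baseMeasure := by
  refine Measure.le_iff.2 fun A hA ↦ ?_
  rw [Coeffs.baseMeasure, Measure.finsetSum_apply]
  refine le_trans ?_ (Finset.single_le_sum (f := fun i ↦
    (∑ k, ((S.q i k).variation + (S.w i k).variation)) A) (fun _ _ ↦ zero_le) (Finset.mem_univ i))
  rw [Measure.finsetSum_apply]
  exact Finset.single_le_sum (f := fun k ↦
    ((S.q i k).variation + (S.w i k).variation) A) (fun _ _ ↦ zero_le) (Finset.mem_univ k)

/-- The density of a matrix measure with respect to a positive measure. -/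
noncomputable def MatrixMeasure.density (μ : MatrixMeasure n) (ν : Measure ℝ) (x : ℝ) :
    Matrix (Fin n) (Fin n) ℂ :=
  Matrix.of fun i k ↦ (μ i k).rnDeriv ν x

/-- The entries of `μ` have densities with respect to `ν`. -/
def MatrixMeasure.IsDominated (μ : MatrixMeasure n) (ν : Measure ℝ) : Prop :=
  ∀ i k, (μ i k).variation ≤ ν

theorem Coeffs.isDominated_q (S : Coeffs n) : S.q.IsDominated S.baseMeasure := fun i k ↦
  le_trans (Measure.le_add_right le_rfl) (S.variation_add_le i k)

theorem Coeffs.isDominated_w (S : Coeffs n) : S.w.IsDominated S.baseMeasure := fun i k ↦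
  le_trans (Measure.le_add_left le_rfl) (S.variation_add_le i k)

variable {μ : MatrixMeasure n} {ν : Measure ℝ}

theorem MatrixMeasure.integrable_density (i k : Fin n) :
    Integrable (fun x ↦ μ.density ν x i k) ν :=
  ComplexMeasure.integrable_rnDeriv _ _

variable [IsFiniteMeasure ν]

theorem MatrixMeasure.IsDominated.mass_apply (h : μ.IsDominated ν) {A : Set ℝ}
    (hA : MeasurableSet A) (i k : Fin n) : μ.mass A i k = ∫ x in A, μ.density ν x i k ∂ν := by
  rw [MatrixMeasure.mass, of_apply, ← withDensityᵥ_rnDeriv_of_variation_le (h i k),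
    withDensityᵥ_apply (ComplexMeasure.integrable_rnDeriv _ _) hA]
  rfl

theorem MatrixMeasure.IsDominated.mass_singleton (h : μ.IsDominated ν) (x : ℝ) :
    μ.mass {x} = ν.real {x} • μ.density ν x := by
  ext i k
  rw [h.mass_apply (measurableSet_singleton x), integral_singleton]
  rfl

theorem MatrixMeasure.IsDominated.integral_Icc (h : μ.IsDominated ν) {c d : ℝ} {u : ℝ → Fin n → ℂ}
    (hu : BoundedVariationOn u (Icc c d)) :
    IntegrableOn (fun x ↦ μ.density ν x *ᵥ u x) (Icc c d) ν ∧
      μ.integral (Icc c d) u = ∫ x in Icc c d, μ.density ν x *ᵥ u x ∂ν := by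
  have hk (i k : Fin n) : IntegrableOn (fun x ↦ u x k * μ.density ν x i k) (Icc c d) ν ∧
      ((μ i k).restrict (Icc c d)).integral (fun x ↦ u x k) (ContinuousLinearMap.mul ℝ ℂ) =
        ∫ x in Icc c d, u x k * μ.density ν x i k ∂ν := by
    have h1 : (μ i k).restrict (Icc c d) =
        (ν.restrict (Icc c d)).withDensityᵥ (fun x ↦ μ.density ν x i k) := by
      conv_lhs => rw [← withDensityᵥ_rnDeriv_of_variation_le (h i k)]
      exact restrict_withDensityᵥ (ComplexMeasure.integrable_rnDeriv _ _) measurableSet_Icc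
    have h2 : ((μ i k).restrict (Icc c d)).Integrable (fun x ↦ u x k) :=
      integrable_of_bv _ (((LipschitzWith.eval k).lipschitzOnWith
        (s := univ)).comp_boundedVariationOn (mapsTo_univ _ _) hu)
    rw [h1] at h2 ⊢
    exact integral_withDensityᵥ_mul (MatrixMeasure.integrable_density i k).integrableOn h2
  have hk' (i k : Fin n) :
      Integrable (fun x ↦ μ.density ν x i k * u x k) (ν.restrict (Icc c d)) := by
    simp only [mul_comm (μ.density ν _ i k)]
    exact (hk i k).1
  have hint : IntegrableOn (fun x ↦ μ.density ν x *ᵥ u x) (Icc c d) ν := by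
    refine Integrable.of_eval fun i ↦ ?_
    simp only [mulVec, dotProduct]
    exact integrable_finsetSum _ fun k _ ↦ (hk' i k)
  refine ⟨hint, ?_⟩
  funext i
  rw [eval_integral fun i ↦ hint.eval i]
  simp only [MatrixMeasure.integral, mulVec, dotProduct]
  rw [integral_finsetSum _ fun k _ ↦ (hk' i k)]
  refine Finset.sum_congr rfl fun k _ ↦ ?_
  rw [(hk i k).2]
  simp only [mul_comm]

/-- The two integrable functions to be compared have equal integrals over all measurable subsets of
`s`. -/
theorem MatrixMeasure.IsDominated.isHermitian_density (h : μ.IsDominated ν) {s : Set ℝ}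
    (hs : MeasurableSet s) (hH : ∀ A, MeasurableSet A → A ⊆ s → (μ.mass A).IsHermitian) :
    ∀ᵐ x ∂ν.restrict s, (μ.density ν x).IsHermitian := by
  have key (i k : Fin n) : ∀ᵐ x ∂ν.restrict s, conj (μ.density ν x k i) = μ.density ν x i k := by
    have hi := (MatrixMeasure.integrable_density (μ := μ) (ν := ν) i k).restrict (s := s)
    have hi' := (MatrixMeasure.integrable_density (μ := μ) (ν := ν) k i).restrict (s := s)
    have hc : Integrable (fun x ↦ conj (μ.density ν x k i)) (ν.restrict s) :=
      Complex.conjCLE.toContinuousLinearMap.integrable_comp hi'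
    refine hc.ae_eq_of_forall_setIntegral_eq _ _ hi fun A hA _ ↦ ?_
    rw [Measure.restrict_restrict hA, integral_conj, ← h.mass_apply (hA.inter hs),
      ← h.mass_apply (hA.inter hs)]
    exact (hH _ (hA.inter hs) inter_subset_right).apply i k
  filter_upwards [ae_all_iff.2 fun i ↦ ae_all_iff.2 fun k ↦ key i k] with x hx
  exact Matrix.IsHermitian.ext hx

theorem MatrixMeasure.IsDominated.posSemidef_density (h : μ.IsDominated ν) {s : Set ℝ}
    (hs : MeasurableSet s) (hH : ∀ A, MeasurableSet A → A ⊆ s → (μ.mass A).PosSemidef) :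
    ∀ᵐ x ∂ν.restrict s, (μ.density ν x).PosSemidef := by
  have hherm := h.isHermitian_density hs fun A hA hAs ↦ (hH A hA hAs).1
  have key (v : Fin n → ℂ) :
      ∀ᵐ x ∂ν.restrict s, 0 ≤ (star v ⬝ᵥ (μ.density ν x *ᵥ v)).re := by
    have hi : Integrable (fun x ↦ star v ⬝ᵥ (μ.density ν x *ᵥ v)) (ν.restrict s) := by
      simp only [mulVec, dotProduct]
      exact integrable_finsetSum _ fun i _ ↦ (integrable_finsetSum _ fun k _ ↦
        (MatrixMeasure.integrable_density i k).restrict.mul_const _).const_mul _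
    refine ae_nonneg_of_forall_setIntegral_nonneg hi.re fun A hA _ ↦ ?_
    have h1 : ∫ x in A, (star v ⬝ᵥ (μ.density ν x *ᵥ v)) ∂ν.restrict s =
        star v ⬝ᵥ (μ.mass (A ∩ s) *ᵥ v) := by
      rw [Measure.restrict_restrict hA]
      simp only [mulVec, dotProduct]
      rw [integral_finsetSum _ fun i _ ↦ (integrable_finsetSum _ fun k _ ↦
        (MatrixMeasure.integrable_density i k).integrableOn.mul_const _).const_mul _]
      refine Finset.sum_congr rfl fun i _ ↦ ?_
      rw [integral_const_mul, integral_finsetSum _ fun k _ ↦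
        (MatrixMeasure.integrable_density i k).integrableOn.mul_const _]
      congr 1
      refine Finset.sum_congr rfl fun k _ ↦ ?_
      rw [integral_mul_const, h.mass_apply (hA.inter hs)]
    have h2 := (hH _ (hA.inter hs) inter_subset_right).dotProduct_mulVec_nonneg v
    have h3 : ∫ x in A, RCLike.re (star v ⬝ᵥ (μ.density ν x *ᵥ v)) ∂ν.restrict s =
        RCLike.re (∫ x in A, (star v ⬝ᵥ (μ.density ν x *ᵥ v)) ∂ν.restrict s) :=
      integral_re hi.integrableOn
    refine le_of_le_of_eq ?_ h3.symm
    rw [h1]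
    exact (Complex.le_def.1 h2).1
  -- The exceptional null set in `key` depends on the vector. A countable dense set of vectors gives
  -- one null set, and continuity of the quadratic form then covers all vectors.
  have hcount : ∀ᵐ x ∂ν.restrict s, ∀ j : ℕ,
      0 ≤ (star (TopologicalSpace.denseSeq (Fin n → ℂ) j) ⬝ᵥ
        (μ.density ν x *ᵥ TopologicalSpace.denseSeq (Fin n → ℂ) j)).re :=
    ae_all_iff.2 fun j ↦ key _
  filter_upwards [hherm, hcount] with x hx hx'
  refine Matrix.PosSemidef.of_dotProduct_mulVec_nonneg hx fun v ↦ ?_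
  have hre (v : Fin n → ℂ) : 0 ≤ (star v ⬝ᵥ (μ.density ν x *ᵥ v)).re := by
    have hcl : IsClosed {v : Fin n → ℂ | 0 ≤ (star v ⬝ᵥ (μ.density ν x *ᵥ v)).re} := by
      refine isClosed_le continuous_const ?_
      simp only [mulVec, dotProduct]
      fun_prop
    have hd := TopologicalSpace.denseRange_denseSeq (Fin n → ℂ)
    have : closure (range (TopologicalSpace.denseSeq (Fin n → ℂ))) ⊆
        {v : Fin n → ℂ | 0 ≤ (star v ⬝ᵥ (μ.density ν x *ᵥ v)).re} :=
      closure_minimal (range_subset_iff.2 hx') hcl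
    exact this (hd v)
  refine Complex.le_def.2 ⟨hre v, ?_⟩
  have := hx.im_star_dotProduct_mulVec_self v
  simpa using this.symm

end Density

/-! ### The differential equation as a Volterra equation -/

section Equation

/-- The density `Q - z W` of `q - z w`. -/
noncomputable def Coeffs.potential (S : Coeffs n) (z : ℂ) (x : ℝ) : Matrix (Fin n) (Fin n) ℂ :=
  S.q.density S.baseMeasure x - z • S.w.density S.baseMeasure x

/-- The coefficient `-J⁻¹ (Q - z W)` of the equation solved for `u'`. -/
noncomputable def Coeffs.coeff (S : Coeffs n) (z : ℂ) (x : ℝ) :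
    (Fin n → ℂ) →L[ℝ] (Fin n → ℂ) :=
  LinearMap.toContinuousLinearMap
    ((Matrix.mulVecLin (-(S.J⁻¹ * S.potential z x))).restrictScalars ℝ)

theorem Coeffs.coeff_apply (S : Coeffs n) (z : ℂ) (x : ℝ) (v : Fin n → ℂ) :
    S.coeff z x v = -(S.J⁻¹ * S.potential z x) *ᵥ v := rfl

theorem Coeffs.J_mulVec_coeff {S : Coeffs n} (hJ : IsUnit S.J) (z : ℂ) (x : ℝ) (v : Fin n → ℂ) :
    S.J *ᵥ S.coeff z x v = -(S.potential z x *ᵥ v) := by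
  have hdet : IsUnit S.J.det := (Matrix.isUnit_iff_isUnit_det _).1 hJ
  rw [Coeffs.coeff_apply, mulVec_mulVec, mul_neg, ← mul_assoc, mul_nonsing_inv _ hdet, one_mul,
    neg_mulVec]

theorem Coeffs.integrable_coeff (S : Coeffs n) (z : ℂ) :
    Integrable (S.coeff z) S.baseMeasure := by
  let Φ : (Fin n → Fin n → ℂ) →ₗ[ℝ] ((Fin n → ℂ) →L[ℝ] (Fin n → ℂ)) :=
    { toFun := fun M ↦ LinearMap.toContinuousLinearMap
        ((Matrix.mulVecLin (Matrix.of M)).restrictScalars ℝ)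
      map_add' := fun M N ↦ by
        ext v : 1
        exact Matrix.add_mulVec (Matrix.of M) (Matrix.of N) v
      map_smul' := fun c M ↦ by
        ext v : 1
        exact Matrix.smul_mulVec c (Matrix.of M) v }
  have hpot (i k : Fin n) : Integrable (fun x ↦ S.potential z x i k) S.baseMeasure :=
    (MatrixMeasure.integrable_density i k).sub ((MatrixMeasure.integrable_density i k).const_mul z)
  have hM : Integrable (fun x i k ↦ (-(S.J⁻¹ * S.potential z x)) i k) S.baseMeasure := by
    refine Integrable.of_eval fun i ↦ Integrable.of_eval fun k ↦ ?_
    simp only [Matrix.neg_apply, Matrix.mul_apply]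
    exact (integrable_finsetSum _ fun l _ ↦ (hpot l k).const_mul _).neg
  exact (LinearMap.toContinuousLinearMap Φ).integrable_comp hM

/-- Densities turn both matrix integrals into Bochner integrals over ν; then the equation is
multiplied by J⁻¹. The integrability claim does not involve `p` and `r`. -/
theorem Coeffs.eqn_iff {S : Coeffs n} (hJ : IsUnit S.J) {z : ℂ} {c d : ℝ} {u : ℝ → Fin n → ℂ}
    (hu : BoundedVariationOn u (Icc c d)) {p r : Fin n → ℂ} :
    IntegrableOn (fun x ↦ S.coeff z x (u x)) (Icc c d) S.baseMeasure ∧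
    (S.J *ᵥ (p - r) + S.q.integral (Icc c d) u = z • S.w.integral (Icc c d) u ↔
      p = r + ∫ x in Icc c d, S.coeff z x (u x) ∂S.baseMeasure) := by
  have hdet : IsUnit S.J.det := (Matrix.isUnit_iff_isUnit_det _).1 hJ
  obtain ⟨iq, eq⟩ := S.isDominated_q.integral_Icc hu
  obtain ⟨iw, ew⟩ := S.isDominated_w.integral_Icc hu
  have hpt (x : ℝ) : S.coeff z x (u x) = S.J⁻¹ *ᵥ (z • (S.w.density S.baseMeasure x *ᵥ u x) -
      S.q.density S.baseMeasure x *ᵥ u x) := by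
    rw [Coeffs.coeff_apply, Coeffs.potential, neg_mulVec, ← mulVec_mulVec, sub_mulVec, smul_mulVec,
      ← mulVec_neg, neg_sub]
  let L : (Fin n → ℂ) →L[ℝ] (Fin n → ℂ) :=
    LinearMap.toContinuousLinearMap ((Matrix.mulVecLin S.J⁻¹).restrictScalars ℝ)
  have hi : IntegrableOn (fun x ↦ z • (S.w.density S.baseMeasure x *ᵥ u x) -
      S.q.density S.baseMeasure x *ᵥ u x) (Icc c d) S.baseMeasure :=
    Integrable.sub (Integrable.smul z iw) iq
  have hint : IntegrableOn (fun x ↦ S.coeff z x (u x)) (Icc c d) S.baseMeasure := by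
    simp only [hpt]
    exact L.integrable_comp hi
  have hval : ∫ x in Icc c d, S.coeff z x (u x) ∂S.baseMeasure =
      S.J⁻¹ *ᵥ (z • S.w.integral (Icc c d) u - S.q.integral (Icc c d) u) := by
    simp only [hpt]
    rw [eq, ew, ← integral_smul, ← integral_sub (by exact Integrable.smul z iw) iq]
    exact L.integral_comp_comm hi
  refine ⟨hint, ?_⟩
  rw [hval, ← sub_eq_iff_eq_add', ← eq_sub_iff_add_eq]
  constructor
  · intro h
    rw [← h, mulVec_mulVec, nonsing_inv_mul _ hdet, one_mulVec]
  · intro h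
    rw [h, mulVec_mulVec, mul_nonsing_inv _ hdet, one_mulVec]

variable {S : Coeffs n} {z : ℂ} {s t : EReal} {u : ℝ → Fin n → ℂ}

theorem Coeffs.IsSolution.boundedVariationOn_Icc (hu : S.IsSolution z s t u) {c d : ℝ}
    (hc : c ∈ ivl s t) (hd : d ∈ ivl s t) : BoundedVariationOn u (Icc c d) :=
  (hu.locBV c d hc hd).mono (subset_inter (Icc_subset_ivl hc hd) subset_rfl)

theorem Coeffs.IsSolution.mono {s' t' : EReal} (hu : S.IsSolution z s t u)
    (h : ivl s' t' ⊆ ivl s t) : S.IsSolution z s' t' u :=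
  ⟨fun p r hp hr ↦ (hu.locBV p r (h hp) (h hr)).mono (inter_subset_inter_left _ h), fun x hx ↦ hu.balanced x (h hx),
    fun c hc d hd hcd ↦ hu.eqn c (h hc) d (h hd) hcd⟩

theorem Coeffs.IsSolution.rightLim_eq (hJ : IsUnit S.J) (hu : S.IsSolution z s t u) {c d : ℝ}
    (hc : c ∈ ivl s t) (hd : d ∈ ivl s t) (hcd : c ≤ d) :
    Function.rightLim u d =
      Function.leftLim u c + ∫ x in Icc c d, S.coeff z x (u x) ∂S.baseMeasure :=
  (Coeffs.eqn_iff hJ (hu.boundedVariationOn_Icc hc hd)).2.1 (hu.eqn c hc d hd hcd)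

theorem Coeffs.IsSolution.balanced' (hu : S.IsSolution z s t u) {x : ℝ} (hx : x ∈ ivl s t) :
    u x = (1 / 2 : ℝ) • (Function.leftLim u x + Function.rightLim u x) := by
  rw [hu.balanced x hx]
  ext i
  simp [Complex.real_smul]
  ring

/-- On compact intervals solutions are balanced primitives. -/
theorem Coeffs.IsSolution.eq_balPrim (hJ : IsUnit S.J) (hu : S.IsSolution z s t u) {c d : ℝ}
    (hc : c ∈ ivl s t) (hd : d ∈ ivl s t) :
    Integrable ((Icc c d).indicator fun x ↦ S.coeff z x (u x)) S.baseMeasure ∧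
    ∀ x ∈ Icc c d, u x = Function.leftLim u c +
      balPrim S.baseMeasure ((Icc c d).indicator fun x ↦ S.coeff z x (u x)) x := by
  have hint : Integrable ((Icc c d).indicator fun x ↦ S.coeff z x (u x)) S.baseMeasure :=
    (integrable_indicator_iff measurableSet_Icc).2
      (Coeffs.eqn_iff (p := 0) (r := 0) hJ (hu.boundedVariationOn_Icc hc hd)).1
  refine ⟨hint, fun x hx ↦ ?_⟩
  have hx' : x ∈ ivl s t := Icc_subset_ivl hc hd hx
  have h1 := hu.rightLim_eq hJ hc hx' hx.1
  have h2 := hu.rightLim_eq hJ hx' hx' le_rfl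
  rw [Icc_self, integral_singleton] at h2
  have h3 : ∫ y in Icc c x, S.coeff z y (u y) ∂S.baseMeasure =
      ∫ y in Iic x, (Icc c d).indicator (fun x ↦ S.coeff z x (u x)) y ∂S.baseMeasure := by
    rw [setIntegral_indicator measurableSet_Icc]
    congr 2
    ext y
    simp only [mem_Icc, mem_inter_iff, mem_Iic]
    exact ⟨fun h ↦ ⟨h.2, h.1, h.2.trans hx.2⟩, fun h ↦ ⟨h.2.1, h.1⟩⟩
  have h4 := setIntegral_Iic_eq hint x
  rw [indicator_of_mem hx] at h4
  -- Removing the atom at x from the formula for u⁺(x) leaves the left limit; the average of the two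
  -- is the balanced primitive.
  have h5 : Function.leftLim u x = Function.leftLim u c +
      ∫ y in Iio x, (Icc c d).indicator (fun x ↦ S.coeff z x (u x)) y ∂S.baseMeasure := by
    rw [h3, h4, h2, ← add_assoc] at h1
    exact add_right_cancel h1
  rw [hu.balanced' hx', h5, h1, h3, balPrim]
  module

section Volterra

variable {A : ℝ → (Fin n → ℂ) →L[ℝ] (Fin n → ℂ)} {ν : Measure ℝ} {c : Fin n → ℂ}

theorem IsVolterra.tendsto_left (hu : IsVolterra ν A c u) (x : ℝ) :
    Tendsto u (𝓝[<] x) (𝓝 (c + ∫ y in Iio x, A y (u y) ∂ν)) :=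
  ((tendsto_balPrim_left hu.integrable x).const_add c).congr fun y ↦ (hu.eq y).symm

theorem IsVolterra.tendsto_right (hu : IsVolterra ν A c u) (x : ℝ) :
    Tendsto u (𝓝[>] x) (𝓝 (c + ∫ y in Iic x, A y (u y) ∂ν)) :=
  ((tendsto_balPrim_right hu.integrable x).const_add c).congr fun y ↦ (hu.eq y).symm

theorem IsVolterra.leftLim_eq (hu : IsVolterra ν A c u) (x : ℝ) :
    Function.leftLim u x = c + ∫ y in Iio x, A y (u y) ∂ν :=
  leftLim_eq_of_tendsto (hu.tendsto_left x)

theorem IsVolterra.rightLim_eq (hu : IsVolterra ν A c u) (x : ℝ) :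
    Function.rightLim u x = c + ∫ y in Iic x, A y (u y) ∂ν :=
  rightLim_eq_of_tendsto (hu.tendsto_right x)

theorem measurableSet_ivl (s t : EReal) : MeasurableSet (ivl s t) :=
  (isOpen_ivl s t).measurableSet

/-- Solutions of the Volterra equation are solutions of the differential equation. -/
theorem IsVolterra.isSolution (hJ : IsUnit S.J)
    (hu : IsVolterra S.baseMeasure ((ivl s t).indicator (S.coeff z)) c u) :
    S.IsSolution z s t u := by
  have hBV (A : Set ℝ) : BoundedVariationOn u A := by
    have h1 := boundedVariationOn_balPrim hu.integrable A
    have h2 : u = (fun y ↦ c + y) ∘ balPrim S.baseMeasure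
        (fun y ↦ (ivl s t).indicator (S.coeff z) y (u y)) := funext hu.eq
    rw [h2]
    exact LipschitzOnWith.comp_boundedVariationOn (C := 1)
      (LipschitzWith.lipschitzOnWith (s := univ) (LipschitzWith.of_dist_le_mul fun x y ↦ by simp))
      (mapsTo_univ _ _) h1
  refine ⟨fun p r _ _ ↦ hBV _, fun x hx ↦ ?_, fun p hp r hr hpr ↦ ?_⟩
  · conv_lhs => rw [hu.eq x, balPrim]
    rw [hu.leftLim_eq, hu.rightLim_eq]
    ext i
    simp [Complex.real_smul]
    ring
  · refine (Coeffs.eqn_iff hJ (hBV _)).2.2 ?_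
    rw [hu.leftLim_eq, hu.rightLim_eq, add_assoc]
    congr 1
    have h1 : ∫ x in Icc p r, S.coeff z x (u x) ∂S.baseMeasure =
        ∫ y in Icc p r, (ivl s t).indicator (S.coeff z) y (u y) ∂S.baseMeasure := by
      refine setIntegral_congr_fun measurableSet_Icc fun x hx ↦ ?_
      simp only [indicator_of_mem (Icc_subset_ivl hp hr hx)]
    rw [h1, ← setIntegral_union _ measurableSet_Icc hu.integrable.integrableOn
      hu.integrable.integrableOn]
    · congr 2
      ext y
      simp only [mem_Iic, mem_union, mem_Iio, mem_Icc]
      grind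
    · exact disjoint_left.2 fun y hy hy' ↦ not_lt.2 hy'.1 hy

end Volterra

/-! ### Integration by parts and Lagrange's identity -/

section Lagrange

theorem balPrim_apply {ν : Measure ℝ} {f : ℝ → Fin n → ℂ} (hf : Integrable f ν) (x : ℝ)
    (i : Fin n) : balPrim ν f x i = balPrim ν (fun y ↦ f y i) x := by
  simp only [balPrim, Pi.smul_apply, Pi.add_apply]
  rw [eval_integral fun i ↦ hf.integrableOn.eval i, eval_integral fun i ↦ hf.integrableOn.eval i]

theorem star_balPrim {ν : Measure ℝ} (f : ℝ → ℂ) (x : ℝ) :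
    conj (balPrim ν f x) = balPrim ν (fun y ↦ conj (f y)) x := by
  simp only [balPrim, integral_conj, Complex.real_smul, map_mul, map_add, Complex.conj_ofReal]

theorem integrable_balPrim_mul {ν : Measure ℝ} [SFinite ν] {f g : ℝ → ℂ} (hf : Integrable f ν)
    (hg : Integrable g ν) : Integrable (fun x ↦ balPrim ν f x * g x) ν := by
  have h1 : balPrim ν f = balPrim ν (hf.1.mk f) := balPrim_congr_ae hf.1.ae_eq_mk
  refine (hg.norm.const_mul (∫ y, ‖f y‖ ∂ν)).mono' ?_ (Eventually.of_forall fun x ↦ ?_)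
  · rw [h1]
    exact (stronglyMeasurable_balPrim hf.1.stronglyMeasurable_mk).aestronglyMeasurable.mul hg.1
  · rw [norm_mul]
    exact mul_le_mul_of_nonneg_right (norm_balPrim_le hf x) (norm_nonneg _)

/-- Integration by parts for a sesquilinear form. -/
theorem integral_sesquilinear {ν : Measure ℝ} [IsFiniteMeasure ν] (J : Matrix (Fin n) (Fin n) ℂ)
    {f g : ℝ → Fin n → ℂ} (hf : Integrable f ν) (hg : Integrable g ν) (α β : Fin n → ℂ) :
    star (β + ∫ x, g x ∂ν) ⬝ᵥ (J *ᵥ (α + ∫ x, f x ∂ν)) - star β ⬝ᵥ (J *ᵥ α) =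
      ∫ x, (star (g x) ⬝ᵥ (J *ᵥ (α + balPrim ν f x)) +
        star (β + balPrim ν g x) ⬝ᵥ (J *ᵥ f x)) ∂ν := by
  have hfk (k : Fin n) : Integrable (fun x ↦ f x k) ν := hf.eval k
  have hgc (i : Fin n) : Integrable (fun x ↦ conj (g x i)) ν :=
    Complex.conjCLE.toContinuousLinearMap.integrable_comp (hg.eval i)
  have hI (i k : Fin n) : Integrable (fun x ↦ J i k * (conj (g x i) *
      (α k + balPrim ν (fun y ↦ f y k) x) +
      (conj (β i) + balPrim ν (fun y ↦ conj (g y i)) x) * f x k)) ν := by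
    refine Integrable.const_mul ?_ _
    refine Integrable.add ?_ ?_
    · simp only [mul_add]
      refine ((hgc i).mul_const _).add ?_
      simp only [mul_comm (conj (g _ i))]
      exact integrable_balPrim_mul (hfk k) (hgc i)
    · simp only [add_mul]
      exact ((hfk k).const_mul _).add (integrable_balPrim_mul (hgc i) (hfk k))
  -- Entry by entry this is `integral_balPrim_mul`; the constants α and β only add terms whose
  -- integrals are explicit.
  have key (i k : Fin n) : ∫ x, J i k * (conj (g x i) * (α k + balPrim ν (fun y ↦ f y k) x) +
      (conj (β i) + balPrim ν (fun y ↦ conj (g y i)) x) * f x k) ∂ν =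
      J i k * ((conj (β i) + ∫ x, conj (g x i) ∂ν) * (α k + ∫ x, f x k ∂ν) - conj (β i) * α k) := by
    rw [integral_const_mul]
    congr 1
    have h1 := integral_balPrim_mul (hgc i) (hfk k)
    have h2 : ∀ x, conj (g x i) * (α k + balPrim ν (fun y ↦ f y k) x) +
        (conj (β i) + balPrim ν (fun y ↦ conj (g y i)) x) * f x k =
        (conj (g x i) * α k + conj (β i) * f x k) +
        (conj (g x i) * balPrim ν (fun y ↦ f y k) x +
          balPrim ν (fun y ↦ conj (g y i)) x * f x k) := fun x ↦ by ring
    have i3 : Integrable (fun x ↦ conj (g x i) * balPrim ν (fun y ↦ f y k) x +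
          balPrim ν (fun y ↦ conj (g y i)) x * f x k) ν := by
      refine Integrable.add ?_ (integrable_balPrim_mul (hgc i) (hfk k))
      simp only [mul_comm (conj (g _ i))]
      exact integrable_balPrim_mul (hfk k) (hgc i)
    simp only [h2]
    rw [integral_add (by exact ((hgc i).mul_const _).add ((hfk k).const_mul _)) i3, h1,
      integral_add ((hgc i).mul_const _) ((hfk k).const_mul _), integral_mul_const,
      integral_const_mul]
    ring
  have hpt (x : ℝ) : star (g x) ⬝ᵥ (J *ᵥ (α + balPrim ν f x)) +
      star (β + balPrim ν g x) ⬝ᵥ (J *ᵥ f x) =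
      ∑ i, ∑ k, J i k * (conj (g x i) * (α k + balPrim ν (fun y ↦ f y k) x) +
      (conj (β i) + balPrim ν (fun y ↦ conj (g y i)) x) * f x k) := by
    simp only [dotProduct, mulVec, ← Finset.sum_add_distrib, Finset.mul_sum, Pi.star_apply,
      Pi.add_apply, RCLike.star_def, map_add, balPrim_apply hf, balPrim_apply hg, star_balPrim]
    refine Finset.sum_congr rfl fun i _ ↦ Finset.sum_congr rfl fun k _ ↦ ?_
    ring
  simp only [hpt]
  rw [integral_finsetSum _ fun i _ ↦ integrable_finsetSum _ fun k _ ↦ hI i k]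
  simp only [dotProduct, mulVec, Finset.mul_sum, ← Finset.sum_sub_distrib]
  refine Finset.sum_congr rfl fun i _ ↦ ?_
  rw [integral_finsetSum _ fun k _ ↦ hI i k]
  refine Finset.sum_congr rfl fun k _ ↦ ?_
  rw [key, Pi.star_apply, Pi.star_apply, Pi.add_apply, Pi.add_apply, eval_integral fun i ↦ hf.eval i,
    eval_integral fun i ↦ hg.eval i, RCLike.star_def, map_add, integral_conj]
  ring

/-- Lagrange's identity. -/
theorem Coeffs.Admissible.lagrange {a b : EReal} (hS : S.Admissible a b) (hst : ivl s t ⊆ ivl a b)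
    {ζ : ℂ} {v : ℝ → Fin n → ℂ} (hu : S.IsSolution z s t u) (hv : S.IsSolution ζ s t v) {c d : ℝ}
    (hc : c ∈ ivl s t) (hd : d ∈ ivl s t) (hcd : c ≤ d) :
    star (Function.rightLim v d) ⬝ᵥ (S.J *ᵥ Function.rightLim u d) -
      star (Function.leftLim v c) ⬝ᵥ (S.J *ᵥ Function.leftLim u c) =
      (z - conj ζ) * ∫ x in Icc c d,
        star (v x) ⬝ᵥ (S.w.density S.baseMeasure x *ᵥ u x) ∂S.baseMeasure := by
  have hJ := hS.isUnit_J
  obtain ⟨hui, hue⟩ := hu.eq_balPrim hJ hc hd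
  obtain ⟨hvi, hve⟩ := hv.eq_balPrim hJ hc hd
  have hu' := hu.rightLim_eq hJ hc hd hcd
  have hv' := hv.rightLim_eq hJ hc hd hcd
  rw [← integral_indicator measurableSet_Icc] at hu' hv'
  rw [hu', hv', integral_sesquilinear S.J hui hvi, ← integral_const_mul,
    ← integral_indicator measurableSet_Icc]
  have hQ := S.isDominated_q.isHermitian_density (measurableSet_ivl a b) hS.hermitian_q
  have hW := S.isDominated_w.posSemidef_density (measurableSet_ivl a b) hS.nonneg_w
  rw [ae_restrict_iff' (measurableSet_ivl a b)] at hQ hW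
  refine integral_congr_ae ?_
  filter_upwards [hQ, hW] with x hxQ hxW
  by_cases hx : x ∈ Icc c d
  · rw [← hue x hx, ← hve x hx]
    simp only [indicator_of_mem hx]
    have hxab := hst (Icc_subset_ivl hc hd hx)
    have hQx := hxQ hxab
    have hWx := (hxW hxab).1
    -- Skew-symmetry lets J act on the derivative of v. Since J·A = -(Q - zW), the Hermitian Q then
    -- cancels and only the multiple z - ζ̄ of v*Wu remains.
    have h1 : star (S.coeff ζ x (v x)) ⬝ᵥ (S.J *ᵥ u x) =
        -(star (S.J *ᵥ S.coeff ζ x (v x)) ⬝ᵥ u x) := by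
      rw [star_mulVec, hS.skew_J, ← dotProduct_mulVec, neg_mulVec, dotProduct_neg, neg_neg]
    rw [h1, Coeffs.J_mulVec_coeff hJ, Coeffs.J_mulVec_coeff hJ, star_neg, neg_dotProduct, neg_neg,
      star_mulVec, Coeffs.potential, Coeffs.potential, conjTranspose_sub, conjTranspose_smul,
      hQx.eq, hWx.eq, dotProduct_neg, ← dotProduct_mulVec]
    simp only [sub_mulVec, smul_mulVec, dotProduct_sub, dotProduct_smul, smul_eq_mul,
      RCLike.star_def]
    ring
  · simp [indicator_of_notMem hx]

end Lagrange

end Equation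

/-! ### Jump conditions, Wronskians and fundamental matrices -/

section Fundamental

variable {S : Coeffs n} {z : ℂ} {a b s t : EReal} {u : ℝ → Fin n → ℂ}

theorem Coeffs.J_mulVec_smul_coeff (hJ : IsUnit S.J) (z : ℂ) (x : ℝ) (v : Fin n → ℂ) :
    S.J *ᵥ (S.baseMeasure.real {x} • S.coeff z x v) =
      -((S.q.mass {x} - z • S.w.mass {x}) *ᵥ v) := by
  rw [mulVec_smul, Coeffs.J_mulVec_coeff hJ, S.isDominated_q.mass_singleton,
    S.isDominated_w.mass_singleton, smul_comm z, ← smul_sub, smul_mulVec, smul_neg]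
  rfl

/-- Multiplying the right-hand equation by J gives the left-hand one, because J ν{x}A(x) = -(Δ_q(x)
- zΔ_w(x)). Invertibility of B₊ is thus exactly what the Volterra equation needs at an atom. -/
theorem Coeffs.Bplus_mulVec_eq_iff (hJ : IsUnit S.J) {x : ℝ} {v w : Fin n → ℂ} :
    S.Bplus x z *ᵥ w = S.J *ᵥ v ↔
      w = v + (1 / 2 : ℝ) • S.baseMeasure.real {x} • S.coeff z x w := by
  have hinj : Function.Injective S.J.mulVec := Matrix.mulVec_injective_of_isUnit hJ
  rw [← hinj.eq_iff (a := w), mulVec_add, mulVec_smul, Coeffs.J_mulVec_smul_coeff hJ, Coeffs.Bplus,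
    add_mulVec, smul_mulVec]
  have h : (1 / 2 : ℝ) • -((S.q.mass {x} - z • S.w.mass {x}) *ᵥ w) =
      -((1 / 2 : ℂ) • ((S.q.mass {x} - z • S.w.mass {x}) *ᵥ w)) := by
    ext i
    simp [Complex.real_smul]
  rw [h, eq_add_neg_iff_add_eq]

theorem Coeffs.Bplus_conjTranspose (hS : S.Admissible a b) {x : ℝ} (hx : x ∈ ivl a b) (z : ℂ) :
    (S.Bplus x z)ᴴ = -S.Bminus x (conj z) := by
  have h1 := (hS.hermitian_q {x} (measurableSet_singleton x) (singleton_subset_iff.2 hx)).eq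
  have h2 := (hS.nonneg_w {x} (measurableSet_singleton x) (singleton_subset_iff.2 hx)).1.eq
  rw [Coeffs.Bplus, Coeffs.Bminus, conjTranspose_add, conjTranspose_smul, conjTranspose_sub,
    conjTranspose_smul, h1, h2, hS.skew_J, neg_sub]
  simp only [star_div₀, star_one, RCLike.star_def, map_ofNat]
  abel

theorem Coeffs.Bminus_conjTranspose (hS : S.Admissible a b) {x : ℝ} (hx : x ∈ ivl a b) (z : ℂ) :
    (S.Bminus x z)ᴴ = -S.Bplus x (conj z) := by
  have h := congrArg conjTranspose (Coeffs.Bplus_conjTranspose hS hx (conj z))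
  rw [conjTranspose_conjTranspose, conjTranspose_neg, Complex.conj_conj] at h
  rw [h, neg_neg]

/-- By the adjoint relations, conjugating z exchanges the two determinants up to sign and complex
conjugation. -/
theorem Coeffs.Xi_conj (hS : S.Admissible a b) (z : ℂ) : S.Xi a b (conj z) = S.Xi a b z := by
  have key (z : ℂ) : S.Xi a b (conj z) ⊆ S.Xi a b z := by
    rintro x ⟨hx, h⟩
    refine ⟨hx, ?_⟩
    have h1 : S.Bplus x (conj z) = -(S.Bminus x z)ᴴ := by
      rw [Coeffs.Bminus_conjTranspose hS hx, neg_neg]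
    have h2 : S.Bminus x (conj z) = -(S.Bplus x z)ᴴ := by
      rw [Coeffs.Bplus_conjTranspose hS hx, neg_neg]
    rw [h1, h2, det_neg, det_neg, det_conjTranspose, det_conjTranspose] at h
    simpa [or_comm] using h
  exact (key z).antisymm (by simpa using key (conj z))

theorem Coeffs.isUnit_Bplus {x : ℝ} (hx : x ∈ ivl a b) (h : x ∉ S.Xi a b z) :
    IsUnit (S.Bplus x z) := by
  rw [Matrix.isUnit_iff_isUnit_det, isUnit_iff_ne_zero]
  exact fun h0 ↦ h ⟨hx, by rw [h0, zero_mul]⟩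

/-- The jump condition. -/
theorem Coeffs.IsSolution.Bplus_mulVec (hJ : IsUnit S.J) (hu : S.IsSolution z s t u) {x : ℝ}
    (hx : x ∈ ivl s t) : S.Bplus x z *ᵥ u x = S.J *ᵥ Function.leftLim u x := by
  have h := hu.rightLim_eq hJ hx hx le_rfl
  rw [Icc_self, integral_singleton] at h
  rw [Coeffs.Bplus_mulVec_eq_iff hJ]
  conv_lhs => rw [hu.balanced' hx, h]
  module

theorem Coeffs.Bplus_add_Bminus (S : Coeffs n) (x : ℝ) (z : ℂ) :
    S.Bplus x z + S.Bminus x z = (2 : ℂ) • S.J := by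
  rw [Coeffs.Bplus, Coeffs.Bminus]
  module

/-- Subtract the jump condition for B₊ from (B₊ + B₋)u = 2Ju = J(u⁻ + u⁺). No invertibility of B₊ or
B₋ is involved, so this is available at singular points too. -/
theorem Coeffs.IsSolution.Bminus_mulVec (hJ : IsUnit S.J) (hu : S.IsSolution z s t u) {x : ℝ}
    (hx : x ∈ ivl s t) : S.Bminus x z *ᵥ u x = S.J *ᵥ Function.rightLim u x := by
  have h1 := hu.Bplus_mulVec hJ hx
  have h2 := congrArg (· *ᵥ u x) (S.Bplus_add_Bminus x z)
  simp only [add_mulVec, smul_mulVec] at h2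
  rw [h1] at h2
  conv_rhs at h2 => rw [hu.balanced x hx]
  rw [mulVec_smul, smul_smul, mulVec_add] at h2
  norm_num at h2
  exact h2

/-- The columns of `U` solve the Volterra equation on `(s, t)` with the unit vectors as initial
values. -/
def Coeffs.IsPropagator (S : Coeffs n) (z : ℂ) (s t : EReal) (U : ℝ → Matrix (Fin n) (Fin n) ℂ) :
    Prop :=
  ∀ c, IsVolterra S.baseMeasure ((ivl s t).indicator (S.coeff z)) c (fun x ↦ U x *ᵥ c)

theorem Coeffs.indicator_coeff_smul (S : Coeffs n) (z : ℂ) (A : Set ℝ) (x : ℝ) (r : ℂ)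
    (v : Fin n → ℂ) : A.indicator (S.coeff z) x (r • v) = r • A.indicator (S.coeff z) x v := by
  by_cases hx : x ∈ A
  · simp only [indicator_of_mem hx, Coeffs.coeff_apply, mulVec_smul]
  · simp [indicator_of_notMem hx]

/-- Solutions chosen for each initial value separately need not depend linearly on it. So only those
for the unit vectors are kept, as columns, and complex linearity of the coefficient gives all other
initial values. -/
theorem Coeffs.exists_isPropagator (hS : S.Admissible a b) (hst : ivl s t ⊆ ivl a b)
    (hreg : ∀ x ∈ ivl s t, x ∉ S.Xi a b z) : ∃ U, S.IsPropagator z s t U := by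
  have hinv : ∀ (x : ℝ) (v : Fin n → ℂ), ∃ w, w = v + (1 / 2 : ℝ) • S.baseMeasure.real {x} •
      (ivl s t).indicator (S.coeff z) x w := by
    intro x v
    by_cases hx : x ∈ ivl s t
    · have hu := Coeffs.isUnit_Bplus (hst hx) (hreg x hx)
      obtain ⟨w, hw⟩ := Matrix.mulVec_surjective_iff_isUnit.2 hu (S.J *ᵥ v)
      refine ⟨w, ?_⟩
      rw [indicator_of_mem hx]
      exact (Coeffs.Bplus_mulVec_eq_iff hS.isUnit_J).1 hw
    · exact ⟨v, by simp [indicator_of_notMem hx]⟩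
  have hex := exists_isVolterra
    (integrable_indicator (S.integrable_coeff z) (measurableSet_ivl s t)) hinv
  choose U hU using hex
  set A := (ivl s t).indicator (S.coeff z) with hA
  refine ⟨fun x ↦ Matrix.of fun i k ↦ U (Pi.single k 1) x i, fun c ↦ ?_⟩
  rw [← hA]
  have hsum (x : ℝ) : (Matrix.of fun i k ↦ U (Pi.single k 1) x i) *ᵥ c =
      ∑ k, c k • U (Pi.single k 1) x := by
    ext i
    simp [mulVec, dotProduct, mul_comm]
  have hAs (x : ℝ) : A x (∑ k, c k • U (Pi.single k 1) x) =
      ∑ k, c k • A x (U (Pi.single k 1) x) := by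
    rw [map_sum]
    exact Finset.sum_congr rfl fun k _ ↦ S.indicator_coeff_smul z _ x _ _
  have hI (k : Fin n) : Integrable (fun x ↦ c k • A x (U (Pi.single k 1) x)) S.baseMeasure :=
    (hU (Pi.single k 1)).integrable.smul (c k)
  refine ⟨?_, fun x ↦ ?_⟩
  · simp only [hsum, hAs]
    exact integrable_finsetSum _ fun k _ ↦ hI k
  · simp only [hsum, hAs]
    have h1 : c = ∑ k, c k • (Pi.single k 1 : Fin n → ℂ) := by
      ext i
      simp [Finset.sum_apply, Pi.single_apply]
    refine Eq.trans ?_ (congrArg (· + _) h1.symm)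
    rw [balPrim, integral_finsetSum _ fun k _ ↦ (hI k).integrableOn,
      integral_finsetSum _ fun k _ ↦ (hI k).integrableOn, ← Finset.sum_add_distrib,
      Finset.smul_sum, ← Finset.sum_add_distrib]
    refine Finset.sum_congr rfl fun k _ ↦ ?_
    rw [(hU (Pi.single k 1)).eq x, balPrim, integral_smul, integral_smul, ← smul_add (c k),
      smul_comm (1 / 2 : ℝ), smul_add]

/-- A family of matrices converges if its products with vectors do. -/
theorem exists_tendsto_matrix {ι : Type*} {l : Filter ι} [l.NeBot]
    {U : ι → Matrix (Fin n) (Fin n) ℂ} {r : (Fin n → ℂ) → Fin n → ℂ}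
    (h : ∀ c, Tendsto (fun y ↦ U y *ᵥ c) l (𝓝 (r c))) :
    ∃ R : Matrix (Fin n) (Fin n) ℂ, Tendsto U l (𝓝 R) ∧ ∀ c, R *ᵥ c = r c := by
  have hR : Tendsto U l (𝓝 (Matrix.of fun i k ↦ r (Pi.single k 1) i)) := by
    refine tendsto_pi_nhds.2 fun i ↦ tendsto_pi_nhds.2 fun k ↦ ?_
    have := (tendsto_pi_nhds.1 (h (Pi.single k 1))) i
    simpa using this
  refine ⟨_, hR, fun c ↦ tendsto_nhds_unique ?_ (h c)⟩
  exact ((continuous_id.matrix_mulVec continuous_const).tendsto _).comp hR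

theorem comap_coe_nhdsGT_neBot (h : s < t) :
    (comap (fun x : ℝ ↦ (x : EReal)) (𝓝[>] s)).NeBot := by
  refine comap_neBot_iff.2 fun A hA ↦ ?_
  obtain ⟨r, hr, hrA⟩ := (mem_nhdsGT_iff_exists_Ioo_subset' h).1 hA
  obtain ⟨x, hx1, hx2⟩ := EReal.lt_iff_exists_real_btwn.1 (mem_Ioi.1 hr)
  exact ⟨x, hrA ⟨hx1, hx2⟩⟩

theorem comap_coe_nhdsLT_neBot (h : s < t) :
    (comap (fun x : ℝ ↦ (x : EReal)) (𝓝[<] t)).NeBot := by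
  refine comap_neBot_iff.2 fun A hA ↦ ?_
  obtain ⟨r, hr, hrA⟩ := (mem_nhdsLT_iff_exists_Ioo_subset' h).1 hA
  obtain ⟨x, hx1, hx2⟩ := EReal.lt_iff_exists_real_btwn.1 (mem_Iio.1 hr)
  exact ⟨x, hrA ⟨hx1, hx2⟩⟩

theorem eventually_lt_nhdsGT {x : EReal} (h : s < x) :
    ∀ᶠ y : ℝ in comap (fun x : ℝ ↦ (x : EReal)) (𝓝[>] s), s < (y : EReal) ∧ (y : EReal) < x :=
  preimage_mem_comap (Ioo_mem_nhdsGT h)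

theorem eventually_lt_nhdsLT {x : EReal} (h : x < t) :
    ∀ᶠ y : ℝ in comap (fun x : ℝ ↦ (x : EReal)) (𝓝[<] t), x < (y : EReal) ∧ (y : EReal) < t :=
  preimage_mem_comap (Ioo_mem_nhdsLT h)

section Limits

variable {A : ℝ → (Fin n → ℂ) →L[ℝ] (Fin n → ℂ)} {ν : Measure ℝ} {c : Fin n → ℂ}

theorem mem_ivl_of_indicator_ne_zero {x : ℝ} {v : Fin n → ℂ}
    (h : (ivl s t).indicator A x v ≠ 0) : x ∈ ivl s t := by
  by_contra hx
  simp [indicator_of_notMem hx] at h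

/-- Every point of (s,t) is eventually to the right of x as x ↓ s, so the primitive tends to 0. The
filter is pulled back from the extended line in order to include s = -∞. -/
theorem IsVolterra.tendsto_start (hu : IsVolterra ν ((ivl s t).indicator A) c u) :
    Tendsto u (comap (fun x : ℝ ↦ (x : EReal)) (𝓝[>] s)) (𝓝 c) ∧
    Tendsto (Function.rightLim u) (comap (fun x : ℝ ↦ (x : EReal)) (𝓝[>] s)) (𝓝 c) := by
  have key (y : ℝ) (hy : (ivl s t).indicator A y (u y) ≠ 0) :
      ∀ᶠ x : ℝ in comap (fun x : ℝ ↦ (x : EReal)) (𝓝[>] s), x < y := by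
    filter_upwards [eventually_lt_nhdsGT (mem_ivl_of_indicator_ne_zero hy).1] with x hx
    exact EReal.coe_lt_coe_iff.1 hx.2
  constructor
  · have h := (tendsto_balPrim_of_eventually hu.integrable (MeasurableSet.empty (α := ℝ))
      (fun y hy ↦ by
        filter_upwards [key y hy] with x hx
        simp [hx.not_gt])
      (fun y hy ↦ by
        filter_upwards [key y hy] with x hx
        simp [hx.not_ge])).const_add c
    rw [setIntegral_empty, add_zero] at h
    exact h.congr fun y ↦ (hu.eq y).symm
  · have h := (tendsto_setIntegral_of_eventually (s := fun x ↦ Iic x) hu.integrable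
      (fun _ ↦ measurableSet_Iic) (MeasurableSet.empty (α := ℝ)) (fun y hy ↦ by
        filter_upwards [key y hy] with x hx
        simp [hx.not_ge])).const_add c
    rw [setIntegral_empty, add_zero] at h
    exact h.congr fun y ↦ (hu.rightLim_eq y).symm

theorem IsVolterra.tendsto_end (hu : IsVolterra ν ((ivl s t).indicator A) c u) :
    Tendsto (Function.rightLim u) (comap (fun x : ℝ ↦ (x : EReal)) (𝓝[<] t))
      (𝓝 (volterraEnd ν ((ivl s t).indicator A) c u)) := by
  have h := (tendsto_setIntegral_of_eventually
    (l := comap (fun x : ℝ ↦ (x : EReal)) (𝓝[<] t)) (s := fun x ↦ Iic x) hu.integrable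
      (fun _ ↦ measurableSet_Iic) (MeasurableSet.univ (α := ℝ)) (fun y hy ↦ by
        filter_upwards [eventually_lt_nhdsLT (mem_ivl_of_indicator_ne_zero hy).2] with x hx
        simpa using (EReal.coe_lt_coe_iff.1 hx.1).le)).const_add c
  rw [setIntegral_univ] at h
  exact h.congr fun y ↦ (hu.rightLim_eq y).symm

theorem IsVolterra.tendsto_left_end {τ : ℝ} (hu : IsVolterra ν ((ivl s τ).indicator A) c u) :
    Tendsto u (𝓝[<] τ) (𝓝 (volterraEnd ν ((ivl s τ).indicator A) c u)) := by
  have h := hu.tendsto_left τ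
  rwa [setIntegral_eq_integral_of_forall_compl_eq_zero] at h
  intro x hx
  by_contra hne
  exact hx (EReal.coe_lt_coe_iff.1 (mem_ivl_of_indicator_ne_zero hne).2)

end Limits

theorem ivl_nonempty_of_lt (h : s < t) : (ivl s t).Nonempty :=
  EReal.lt_iff_exists_real_btwn.1 h

theorem lt_of_mem_ivl {x : ℝ} (h : x ∈ ivl s t) : s < t := h.1.trans h.2

/-- The Wronskian of a solution for `z` and a solution for `z̄` is constant. -/
theorem Coeffs.Admissible.exists_wronskian_eq (hS : S.Admissible a b) (hst : ivl s t ⊆ ivl a b)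
    {v : ℝ → Fin n → ℂ} (hu : S.IsSolution z s t u) (hv : S.IsSolution (conj z) s t v) :
    ∃ K, ∀ x ∈ ivl s t,
      star (Function.rightLim v x) ⬝ᵥ (S.J *ᵥ Function.rightLim u x) = K ∧
      star (Function.leftLim v x) ⬝ᵥ (S.J *ᵥ Function.leftLim u x) = K := by
  have h {c d : ℝ} (hc : c ∈ ivl s t) (hd : d ∈ ivl s t) (hcd : c ≤ d) :
      star (Function.rightLim v d) ⬝ᵥ (S.J *ᵥ Function.rightLim u d) =
      star (Function.leftLim v c) ⬝ᵥ (S.J *ᵥ Function.leftLim u c) := by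
    have := hS.lagrange hst hu hv hc hd hcd
    rwa [Complex.conj_conj, sub_self, zero_mul, sub_eq_zero] at this
  rcases (ivl s t).eq_empty_or_nonempty with he | ⟨p, hp⟩
  · exact ⟨0, fun x hx ↦ by simp [he] at hx⟩
  refine ⟨star (Function.rightLim v p) ⬝ᵥ (S.J *ᵥ Function.rightLim u p), fun x hx ↦ ?_⟩
  rcases le_total x p with hxp | hpx
  · exact ⟨(h hx hx le_rfl).trans (h hx hp hxp).symm, (h hx hp hxp).symm⟩
  · have e : star (Function.rightLim v x) ⬝ᵥ (S.J *ᵥ Function.rightLim u x) =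
        star (Function.rightLim v p) ⬝ᵥ (S.J *ᵥ Function.rightLim u p) :=
      (h hp hx hpx).trans (h hp hp le_rfl).symm
    exact ⟨e, (h hx hx le_rfl).symm.trans e⟩

theorem tendsto_wronskian {ι : Type*} {l : Filter ι} {J : Matrix (Fin n) (Fin n) ℂ}
    {f g : ι → Fin n → ℂ} {α β : Fin n → ℂ} (hf : Tendsto f l (𝓝 α)) (hg : Tendsto g l (𝓝 β)) :
    Tendsto (fun x ↦ star (g x) ⬝ᵥ (J *ᵥ f x)) l (𝓝 (star β ⬝ᵥ (J *ᵥ α))) := by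
  have hf' (k : Fin n) : Tendsto (fun x ↦ f x k) l (𝓝 (α k)) := tendsto_pi_nhds.1 hf k
  have hg' (i : Fin n) : Tendsto (fun x ↦ star (g x i)) l (𝓝 (star (β i))) :=
    (continuous_star.tendsto _).comp (tendsto_pi_nhds.1 hg i)
  simp only [mulVec, dotProduct, Pi.star_apply]
  exact tendsto_finsetSum _ fun i _ ↦ (hg' i).mul
    (tendsto_finsetSum _ fun k _ ↦ (hf' k).const_mul (J i k))

/-- The Wronskian of two solutions of Volterra equations in terms of their initial values. -/
theorem Coeffs.Admissible.wronskian_eq (hS : S.Admissible a b) (hst : ivl s t ⊆ ivl a b)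
    {v : ℝ → Fin n → ℂ} {α β : Fin n → ℂ}
    (hu : IsVolterra S.baseMeasure ((ivl s t).indicator (S.coeff z)) α u)
    (hv : IsVolterra S.baseMeasure ((ivl s t).indicator (S.coeff (conj z))) β v) :
    (∀ x ∈ ivl s t,
      star (Function.rightLim v x) ⬝ᵥ (S.J *ᵥ Function.rightLim u x) = star β ⬝ᵥ (S.J *ᵥ α)) ∧
    (s < t → star (volterraEnd S.baseMeasure ((ivl s t).indicator (S.coeff (conj z))) β v) ⬝ᵥ
      (S.J *ᵥ volterraEnd S.baseMeasure ((ivl s t).indicator (S.coeff z)) α u) =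
        star β ⬝ᵥ (S.J *ᵥ α)) := by
  obtain ⟨K, hK⟩ := hS.exists_wronskian_eq hst (hu.isSolution hS.isUnit_J)
    (hv.isSolution hS.isUnit_J)
  have hstart (h : s < t) : K = star β ⬝ᵥ (S.J *ᵥ α) := by
    have := comap_coe_nhdsGT_neBot h
    -- The constant Wronskian is evaluated by letting x ↓ s, where u and v tend to their initial
    -- values.
    refine tendsto_nhds_unique (tendsto_const_nhds.congr' ?_)
      (tendsto_wronskian hu.tendsto_start.2 hv.tendsto_start.2)
    filter_upwards [eventually_lt_nhdsGT h] with x hx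
    exact (hK x hx).1.symm
  refine ⟨fun x hx ↦ (hK x hx).1.trans (hstart (lt_of_mem_ivl hx)), fun h ↦ ?_⟩
  rw [← hstart h]
  have := comap_coe_nhdsLT_neBot h
  refine tendsto_nhds_unique (tendsto_wronskian hu.tendsto_end hv.tendsto_end)
    (tendsto_const_nhds.congr' ?_)
  filter_upwards [eventually_lt_nhdsLT h] with x hx
  exact (hK x hx).1.symm

theorem eq_zero_of_forall_star_dotProduct {v : Fin n → ℂ} (h : ∀ c, star c ⬝ᵥ v = 0) : v = 0 :=
  dotProduct_star_self_eq_zero.1 (h v)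

theorem Coeffs.J_mulVec_injective (hJ : IsUnit S.J) : Function.Injective S.J.mulVec :=
  Matrix.mulVec_injective_of_isUnit hJ

theorem Coeffs.IsSolution.sub {v : ℝ → Fin n → ℂ} (hu : S.IsSolution z s t u)
    (hv : S.IsSolution z s t v) : S.IsSolution z s t (u - v) := by
  have := hu.add (hv.smul (-1))
  rwa [neg_one_smul, ← sub_eq_add_neg] at this

theorem Coeffs.IsPropagator.exists_rightLim {U : ℝ → Matrix (Fin n) (Fin n) ℂ}
    (hU : S.IsPropagator z s t U) (x : ℝ) :
    ∃ R : Matrix (Fin n) (Fin n) ℂ, ∀ c, R *ᵥ c = Function.rightLim (fun y ↦ U y *ᵥ c) x := by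
  obtain ⟨R, -, hR⟩ := exists_tendsto_matrix fun c ↦ (hU c).tendsto_right x
  exact ⟨R, fun c ↦ (hR c).trans ((hU c).rightLim_eq x).symm⟩

/-- If the right limit of Uc vanishes, so does its Wronskian with each solution for z̄ on the
interval, that is, c'*Jc = 0 for all c'. Hence c = 0, and injectivity implies surjectivity in finite
dimension. -/
theorem Coeffs.IsPropagator.bijective_rightLim (hS : S.Admissible a b) (hst : ivl s t ⊆ ivl a b)
    (hreg : ∀ x ∈ ivl s t, x ∉ S.Xi a b z) {U : ℝ → Matrix (Fin n) (Fin n) ℂ}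
    (hU : S.IsPropagator z s t U) {x : ℝ} (hx : x ∈ ivl s t) :
    Function.Bijective fun c ↦ Function.rightLim (fun y ↦ U y *ᵥ c) x := by
  obtain ⟨V, hV⟩ := Coeffs.exists_isPropagator (z := conj z) hS hst
    (fun x hx ↦ by rw [Coeffs.Xi_conj hS]; exact hreg x hx)
  obtain ⟨R, hR⟩ := hU.exists_rightLim x
  have hinj : Function.Injective (Matrix.mulVecLin R) := by
    rw [← LinearMap.ker_eq_bot, LinearMap.ker_eq_bot']
    intro c hc
    rw [mulVecLin_apply, hR] at hc
    apply Coeffs.J_mulVec_injective hS.isUnit_J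
    rw [mulVec_zero]
    refine eq_zero_of_forall_star_dotProduct fun c' ↦ ?_
    rw [← (hS.wronskian_eq hst (hU c) (hV c')).1 x hx, hc, mulVec_zero, dotProduct_zero]
  have hfun : (fun c ↦ Function.rightLim (fun y ↦ U y *ᵥ c) x) = Matrix.mulVecLin R :=
    funext fun c ↦ (hR c).symm
  rw [hfun]
  exact ⟨hinj, LinearMap.injective_iff_surjective.1 hinj⟩

/-- A solution vanishes if one of its right limits does. -/
theorem Coeffs.IsSolution.eq_zero_of_rightLim (hS : S.Admissible a b) (hst : ivl s t ⊆ ivl a b)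
    (hreg : ∀ x ∈ ivl s t, x ∉ S.Xi a b z) (hu : S.IsSolution z s t u) {x : ℝ}
    (hx : x ∈ ivl s t) (h : Function.rightLim u x = 0) {y : ℝ} (hy : y ∈ ivl s t) : u y = 0 := by
  have hreg' : ∀ x ∈ ivl s t, x ∉ S.Xi a b (conj z) := fun x hx ↦ by
    rw [Coeffs.Xi_conj hS]; exact hreg x hx
  obtain ⟨V, hV⟩ := Coeffs.exists_isPropagator (z := conj z) hS hst hreg'
  have hr : Function.rightLim u y = 0 := by
    apply Coeffs.J_mulVec_injective hS.isUnit_J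
    rw [mulVec_zero]
    refine eq_zero_of_forall_star_dotProduct fun c ↦ ?_
    -- The right limits at y of solutions for z̄ fill the whole space, so testing the Wronskian
    -- against them forces u⁺(y) = 0. The jump condition with the invertible B₋ then gives u(y) = 0.
    obtain ⟨c', rfl⟩ := (hV.bijective_rightLim hS hst hreg' hy).2 c
    obtain ⟨K, hK⟩ := hS.exists_wronskian_eq hst hu ((hV c').isSolution hS.isUnit_J)
    rw [(hK y hy).1, ← (hK x hx).1, h, mulVec_zero, dotProduct_zero]
  have h1 := hu.Bminus_mulVec hS.isUnit_J hy
  rw [hr, mulVec_zero] at h1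
  have hunit : IsUnit (S.Bminus y z) := by
    rw [Matrix.isUnit_iff_isUnit_det, isUnit_iff_ne_zero]
    exact fun h0 ↦ hreg y hy ⟨hst hy, by rw [h0, mul_zero]⟩
  exact Matrix.mulVec_injective_of_isUnit hunit (h1.trans (mulVec_zero _).symm)

/-- Every solution is a linear combination of the columns of a propagator. -/
theorem Coeffs.IsPropagator.exists_eq (hS : S.Admissible a b) (hst : ivl s t ⊆ ivl a b)
    (hreg : ∀ x ∈ ivl s t, x ∉ S.Xi a b z) {U : ℝ → Matrix (Fin n) (Fin n) ℂ}
    (hU : S.IsPropagator z s t U) (hu : S.IsSolution z s t u) :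
    ∃ c, ∀ x ∈ ivl s t, u x = U x *ᵥ c := by
  rcases (ivl s t).eq_empty_or_nonempty with he | ⟨p, hp⟩
  · exact ⟨0, fun x hx ↦ by simp [he] at hx⟩
  obtain ⟨c, hc⟩ := (hU.bijective_rightLim hS hst hreg hp).2 (Function.rightLim u p)
  refine ⟨c, fun x hx ↦ ?_⟩
  have hsol := (hU c).isSolution hS.isUnit_J
  have h0 : Function.rightLim (u - fun x ↦ U x *ᵥ c) p = 0 := by
    have := rightLim_eq_of_tendsto ((tendsto_rightLim_of_locBV (isOpen_ivl s t) hu.locBV hp).sub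
      (tendsto_rightLim_of_locBV (isOpen_ivl s t) hsol.locBV hp))
    refine this.trans ?_
    rw [← hc, sub_self]
  exact sub_eq_zero.1 ((hu.sub hsol).eq_zero_of_rightLim hS hst hreg hp h0 hx)

/-- The Wronskian argument of `bijective_rightLim`, carried to the right end of the interval. It
yields invertibility of the transfer matrices. -/
theorem Coeffs.IsPropagator.injective_volterraEnd (hS : S.Admissible a b) (hst : ivl s t ⊆ ivl a b)
    (hreg : ∀ x ∈ ivl s t, x ∉ S.Xi a b z) {U : ℝ → Matrix (Fin n) (Fin n) ℂ}
    (hU : S.IsPropagator z s t U) (h : s < t) {c : Fin n → ℂ}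
    (hc : volterraEnd S.baseMeasure ((ivl s t).indicator (S.coeff z)) c (fun x ↦ U x *ᵥ c) = 0) :
    c = 0 := by
  obtain ⟨V, hV⟩ := Coeffs.exists_isPropagator (z := conj z) hS hst
    (fun x hx ↦ by rw [Coeffs.Xi_conj hS]; exact hreg x hx)
  apply Coeffs.J_mulVec_injective hS.isUnit_J
  rw [mulVec_zero]
  refine eq_zero_of_forall_star_dotProduct fun c' ↦ ?_
  rw [← (hS.wronskian_eq hst (hU c) (hV c')).2 h, hc, mulVec_zero, dotProduct_zero]

/-- The fundamental matrix agrees with every propagator. -/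
theorem Coeffs.fund_eq (hS : S.Admissible a b) (hst : ivl s t ⊆ ivl a b)
    (hreg : ∀ x ∈ ivl s t, x ∉ S.Xi a b z) {U : ℝ → Matrix (Fin n) (Fin n) ℂ} (hU : S.IsPropagator z s t U)
    (h : s < t) {x : ℝ} (hx : x ∈ ivl s t) : S.fund z s t x = U x := by
  have hne := comap_coe_nhdsGT_neBot h
  have hF : S.IsFundamental z s t U := by
    refine ⟨fun k ↦ ?_, ?_⟩
    · have := (hU (Pi.single k 1)).isSolution hS.isUnit_J
      simp only [mulVec_single_one] at this
      exact this
    · obtain ⟨R, hR, hR'⟩ := exists_tendsto_matrix (r := id) fun c ↦ (hU c).tendsto_start.1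
      have : R = 1 := by
        refine Matrix.ext_of_mulVec_single fun k ↦ ?_
        rw [hR', one_mulVec, id]
      rwa [this] at hR
  -- The propagator shows that a fundamental matrix exists, so the chosen one has the defining
  -- properties. Each of its columns is Uc for some c, and the limit at s identifies c as the unit
  -- vector.
  have hfund : S.IsFundamental z s t (S.fund z s t) := Classical.epsilon_spec ⟨U, hF⟩
  ext i k
  obtain ⟨c, hc⟩ := hU.exists_eq hS hst hreg (hfund.isSolution k)
  have hlim : Tendsto (fun x i ↦ S.fund z s t x i k)
      (comap (fun x : ℝ ↦ (x : EReal)) (𝓝[>] s)) (𝓝 (Pi.single k 1)) := by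
    refine tendsto_pi_nhds.2 fun i ↦ ?_
    have := tendsto_pi_nhds.1 (tendsto_pi_nhds.1 hfund.tendsto_one i) k
    convert this using 2
    rw [Matrix.one_apply, Pi.single_apply]
  have hck : c = Pi.single k 1 := by
    refine tendsto_nhds_unique (hU c).tendsto_start.1 (hlim.congr' ?_)
    filter_upwards [eventually_lt_nhdsGT h] with x hx
    exact hc x hx
  have := congrFun (hc x hx) i
  rw [hck] at this
  simpa using this

theorem Coeffs.leftLim_fund_mulVec (hS : S.Admissible a b) (hst : ivl s t ⊆ ivl a b)
    (hreg : ∀ x ∈ ivl s t, x ∉ S.Xi a b z) {τ : ℝ} (ht : t = τ) {U : ℝ → Matrix (Fin n) (Fin n) ℂ}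
    (hU : S.IsPropagator z s t U) (h : s < t) (c : Fin n → ℂ) :
    Function.leftLim (S.fund z s t) τ *ᵥ c =
      volterraEnd S.baseMeasure ((ivl s t).indicator (S.coeff z)) c (fun x ↦ U x *ᵥ c) := by
  subst ht
  obtain ⟨R, hR, hR'⟩ := exists_tendsto_matrix fun c ↦ (hU c).tendsto_left_end
  have hev : ∀ᶠ x in 𝓝[<] τ, x ∈ ivl s τ := by
    obtain ⟨p, hp⟩ := ivl_nonempty_of_lt h
    filter_upwards [Ioo_mem_nhdsLT (EReal.coe_lt_coe_iff.1 hp.2)] with x hx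
    exact ⟨hp.1.trans (EReal.coe_lt_coe_iff.2 hx.1), EReal.coe_lt_coe_iff.2 hx.2⟩
  rw [← hR', leftLim_eq_of_tendsto (hR.congr' ?_)]
  filter_upwards [hev] with x hx
  exact (Coeffs.fund_eq hS hst hreg hU h hx).symm

end Fundamental

variable {m : ℕ}

/-! ### Block structure of B, B_m and their adjoints -/

section BlockMatrices

/-- The `j`-th block of a block vector. -/
def block {N : ℕ} (v : Fin N × Fin n → ℂ) (j : Fin N) : Fin n → ℂ := fun i ↦ v (j, i)

theorem block_ext {N : ℕ} {v w : Fin N × Fin n → ℂ} (h : ∀ j, block v j = block w j) : v = w :=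
  funext fun p ↦ congrFun (h p.1) p.2

variable (S : Coeffs n) (a : EReal) (x : Fin (m + 1) → ℝ) (z : ℂ)

theorem Coeffs.block_B_mulVec (w : Fin (m + 2) × Fin n → ℂ) (r : Fin (m + 1)) :
    block (S.B a x z *ᵥ w) r = S.Bplus (x r) z *ᵥ block w r.succ -
      S.Bminus (x r) z *ᵥ (S.transfer a x z r *ᵥ block w r.castSucc) := by
  ext k
  have hne : r.succ ≠ r.castSucc := Fin.castSucc_lt_succ.ne'
  have h (c : Fin (m + 2)) : ∑ i, S.B a x z (r, k) (c, i) * w (c, i) =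
      (if c = r.castSucc then
        -((S.Bminus (x r) z * S.transfer a x z r) *ᵥ block w c) k else 0) +
      (if c = r.succ then (S.Bplus (x r) z *ᵥ block w c) k else 0) := by
    simp only [Coeffs.B, of_apply]
    by_cases h1 : c = r.castSucc
    · subst h1
      simp [hne.symm, mulVec, dotProduct, block]
    · by_cases h2 : c = r.succ
      · subst h2
        simp [h1, mulVec, dotProduct, block]
      · simp [h1, h2]
  rw [block, mulVec, dotProduct, Fintype.sum_prod_type]
  simp only [h, Finset.sum_add_distrib, Finset.sum_ite_eq', Finset.mem_univ, if_true,
    mulVec_mulVec, Pi.sub_apply]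
  ring

theorem Coeffs.block_B_conjTranspose_mulVec (v : Fin (m + 1) × Fin n → ℂ) (c : Fin (m + 2)) :
    block ((S.B a x z)ᴴ *ᵥ v) c = ∑ r, ((if c = r.castSucc then
      -((S.Bminus (x r) z * S.transfer a x z r)ᴴ *ᵥ block v r) else 0) +
      (if c = r.succ then (S.Bplus (x r) z)ᴴ *ᵥ block v r else 0)) := by
  ext i
  rw [block, mulVec, dotProduct, Fintype.sum_prod_type, Finset.sum_apply]
  refine Finset.sum_congr rfl fun r _ ↦ ?_
  have hne : r.succ ≠ r.castSucc := Fin.castSucc_lt_succ.ne'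
  simp only [Coeffs.B, of_apply, conjTranspose_apply]
  by_cases h1 : c = r.castSucc
  · subst h1
    simp [hne.symm, mulVec, dotProduct, block, conjTranspose_apply, -conjTranspose_mul]
  · by_cases h2 : c = r.succ
    · subst h2
      simp [h1, mulVec, dotProduct, block, conjTranspose_apply]
    · simp [h1, h2]

theorem Coeffs.block_B_conjTranspose_zero (v : Fin (m + 1) × Fin n → ℂ) :
    block ((S.B a x z)ᴴ *ᵥ v) 0 =
      -((S.Bminus (x 0) z * S.transfer a x z 0)ᴴ *ᵥ block v 0) := by
  rw [Coeffs.block_B_conjTranspose_mulVec, Fin.sum_univ_succ, Finset.sum_eq_zero]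
  · simp
  · intro r _
    have h1 : (0 : Fin (m + 2)) ≠ r.castSucc.succ := (Fin.succ_ne_zero _).symm
    have h2 : (0 : Fin (m + 2)) ≠ r.succ.succ := (Fin.succ_ne_zero _).symm
    simp [h1, h2]

theorem Coeffs.block_B_conjTranspose_last (v : Fin (m + 1) × Fin n → ℂ) :
    block ((S.B a x z)ᴴ *ᵥ v) (Fin.last (m + 1)) =
      (S.Bplus (x (Fin.last m)) z)ᴴ *ᵥ block v (Fin.last m) := by
  rw [Coeffs.block_B_conjTranspose_mulVec, Finset.sum_eq_single (Fin.last m)]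
  · have : Fin.last (m + 1) ≠ (Fin.last m).castSucc := (Fin.castSucc_lt_last _).ne'
    simp [this]
  · intro r _ hr
    have h1 : Fin.last (m + 1) ≠ r.castSucc := (Fin.castSucc_lt_last _).ne'
    have h2 : Fin.last (m + 1) ≠ r.succ := fun h ↦ hr (by
      rw [← Fin.succ_last] at h
      exact (Fin.succ_injective _ h).symm)
    simp [h1, h2]
  · simp

theorem Coeffs.block_B_conjTranspose_succ (v : Fin (m + 1) × Fin n → ℂ) (j : Fin m) :
    block ((S.B a x z)ᴴ *ᵥ v) j.castSucc.succ =
      (S.Bplus (x j.castSucc) z)ᴴ *ᵥ block v j.castSucc -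
        (S.Bminus (x j.succ) z * S.transfer a x z j.succ)ᴴ *ᵥ block v j.succ := by
  rw [Coeffs.block_B_conjTranspose_mulVec, Finset.sum_add_distrib]
  have h1 (r : Fin (m + 1)) : (j.castSucc.succ = r.castSucc) ↔ j.succ = r := by
    rw [← Fin.castSucc_succ, (Fin.castSucc_injective _).eq_iff]
  have h2 (r : Fin (m + 1)) : (j.castSucc.succ = r.succ) ↔ j.castSucc = r :=
    (Fin.succ_injective _).eq_iff
  simp only [h1, h2, Finset.sum_ite_eq, Finset.mem_univ, if_true]
  abel

theorem Coeffs.block_Bm_conjTranspose (v : Fin (m + 1) × Fin n → ℂ) (j : Fin m) :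
    block ((S.Bm a x z)ᴴ *ᵥ v) j = block ((S.B a x z)ᴴ *ᵥ v) j.castSucc.succ := rfl

theorem Coeffs.mem_ker_Bm_iff {v : Fin (m + 1) × Fin n → ℂ} :
    v ∈ LinearMap.ker (S.Bm a x z)ᴴ.mulVecLin ↔
      ∀ j : Fin m, block ((S.B a x z)ᴴ *ᵥ v) j.castSucc.succ = 0 := by
  rw [LinearMap.mem_ker, mulVecLin_apply]
  exact ⟨fun h j ↦ by rw [← Coeffs.block_Bm_conjTranspose, h]; rfl,
    fun h ↦ block_ext fun j ↦ (S.block_Bm_conjTranspose a x z v j).trans (h j)⟩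

theorem Coeffs.mem_ker_B_conjTranspose_iff {v : Fin (m + 1) × Fin n → ℂ} :
    v ∈ LinearMap.ker (S.B a x z)ᴴ.mulVecLin ↔
      v ∈ LinearMap.ker (S.Bm a x z)ᴴ.mulVecLin ∧ block ((S.B a x z)ᴴ *ᵥ v) 0 = 0 ∧
        block ((S.B a x z)ᴴ *ᵥ v) (Fin.last (m + 1)) = 0 := by
  rw [Coeffs.mem_ker_Bm_iff, LinearMap.mem_ker, mulVecLin_apply]
  constructor
  · intro h
    simp only [h]
    exact ⟨fun _ ↦ rfl, rfl, rfl⟩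
  · rintro ⟨h1, h2, h3⟩
    refine block_ext fun c ↦ ?_
    refine Fin.cases h2 (fun r ↦ ?_) c
    exact Fin.lastCases (by rw [Fin.succ_last]; exact h3) h1 r

/-- Rank-nullity for B and its adjoint: the ranks agree and there are n more columns than rows. -/
theorem Coeffs.finrank_ker_B_conjTranspose :
    Module.finrank ℂ (LinearMap.ker (S.B a x z)ᴴ.mulVecLin) + n =
      Module.finrank ℂ (LinearMap.ker (S.B a x z).mulVecLin) := by
  have h1 := LinearMap.finrank_range_add_finrank_ker (S.B a x z).mulVecLin
  have h2 := LinearMap.finrank_range_add_finrank_ker (S.B a x z)ᴴ.mulVecLin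
  have h3 : Module.finrank ℂ (LinearMap.range (S.B a x z)ᴴ.mulVecLin) =
      Module.finrank ℂ (LinearMap.range (S.B a x z).mulVecLin) :=
    Matrix.rank_conjTranspose _
  rw [Module.finrank_fintype_fun_eq_card, Fintype.card_prod, Fintype.card_fin, Fintype.card_fin]
    at h1 h2
  rw [h3] at h2
  have : (m + 2) * n = (m + 1) * n + n := by ring
  omega

end BlockMatrices

/-! ### The subintervals of the partition -/

section Partition

variable {a b : EReal} {x : Fin (m + 1) → ℝ}

theorem leftEnd_succ (j : Fin m) : leftEnd a x j.succ = x j.castSucc := rfl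

theorem leftEnd_lt (hx : StrictMono x) (hxab : ∀ j, x j ∈ ivl a b) (j : Fin (m + 1)) :
    leftEnd a x j < x j := by
  refine Fin.cases (hxab 0).1 (fun i ↦ ?_) j
  rw [leftEnd_succ]
  exact EReal.coe_lt_coe_iff.2 (hx Fin.castSucc_lt_succ)

theorem le_leftEnd (hxab : ∀ j, x j ∈ ivl a b) (j : Fin (m + 1)) : a ≤ leftEnd a x j :=
  Fin.cases le_rfl (fun i ↦ by rw [leftEnd_succ]; exact (hxab _).1.le) j

theorem ivl_leftEnd_subset (hxab : ∀ j, x j ∈ ivl a b) (j : Fin (m + 1)) :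
    ivl (leftEnd a x j) (x j) ⊆ ivl a b := fun _ hp ↦
  ⟨(le_leftEnd hxab j).trans_lt hp.1, hp.2.trans (hxab j).2⟩

theorem notMem_ivl_leftEnd (hx : StrictMono x) (i j : Fin (m + 1)) :
    x i ∉ ivl (leftEnd a x j) (x j) := by
  rintro ⟨h1, h2⟩
  have hij : i < j := hx.lt_iff_lt.1 (EReal.coe_lt_coe_iff.1 h2)
  obtain ⟨k, rfl⟩ := Fin.exists_succ_eq.2 (Fin.ne_zero_of_lt hij)
  rw [leftEnd_succ] at h1
  have := hx.lt_iff_lt.1 (EReal.coe_lt_coe_iff.1 h1)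
  exact absurd (Fin.le_castSucc_iff.2 hij) (not_le.2 this)

theorem ivl_last_subset (hxab : ∀ j, x j ∈ ivl a b) : ivl (x (Fin.last m)) b ⊆ ivl a b :=
  fun _ hp ↦ ⟨(hxab _).1.trans hp.1, hp.2⟩

theorem notMem_ivl_last (hx : StrictMono x) (i : Fin (m + 1)) : x i ∉ ivl (x (Fin.last m)) b :=
  fun h ↦ absurd (EReal.coe_lt_coe_iff.1 h.1) (not_lt.2 (hx.monotone (Fin.le_last i)))

theorem exists_mem_ivl_of_mem {p : ℝ} (hp : p ∈ ivl a b) :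
    (∃ j, p = x j) ∨ (∃ j, p ∈ ivl (leftEnd a x j) (x j)) ∨ p ∈ ivl (x (Fin.last m)) b := by
  rcases le_or_gt p (x (Fin.last m)) with hle | hlt
  · have key : ∀ j : Fin (m + 1), p ≤ x j →
        (∃ j, p = x j) ∨ (∃ j, p ∈ ivl (leftEnd a x j) (x j)) := by
      intro j
      induction j using Fin.induction with
      | zero =>
        intro h
        rcases h.eq_or_lt with h | h
        · exact Or.inl ⟨_, h⟩
        · exact Or.inr ⟨0, hp.1, EReal.coe_lt_coe_iff.2 h⟩
      | succ i ih =>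
        intro h
        rcases le_or_gt p (x i.castSucc) with h' | h'
        · exact ih h'
        · rcases h.eq_or_lt with h | h
          · exact Or.inl ⟨_, h⟩
          · exact Or.inr ⟨i.succ, by rw [leftEnd_succ]; exact EReal.coe_lt_coe_iff.2 h',
              EReal.coe_lt_coe_iff.2 h⟩
    rcases key _ hle with h | h
    · exact Or.inl h
    · exact Or.inr (Or.inl h)
  · exact Or.inr (Or.inr ⟨EReal.coe_lt_coe_iff.2 hlt, hp.2⟩)

theorem notMem_Xi_of_mem {S : Coeffs n} {z : ℂ} {s t : EReal} (hz : S.Xi a b z ⊆ range x)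
    (h : ∀ i, x i ∉ ivl s t) : ∀ p ∈ ivl s t, p ∉ S.Xi a b z := by
  rintro p hp hp'
  obtain ⟨i, rfl⟩ := hz hp'
  exact h i hp

end Partition

/-! ### Transfer matrices and the kernels of B and B_m -/

section Transfer

variable {S : Coeffs n} {a b : EReal} {x : Fin (m + 1) → ℝ} {z : ℂ}

theorem Coeffs.exists_isPropagator_leftEnd (hS : S.Admissible a b) (hx : StrictMono x)
    (hxab : ∀ j, x j ∈ ivl a b) (hz : S.Xi a b z ⊆ range x) (j : Fin (m + 1)) :
    ∃ U, S.IsPropagator z (leftEnd a x j) (x j) U :=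
  Coeffs.exists_isPropagator hS (ivl_leftEnd_subset hxab j)
    (notMem_Xi_of_mem hz (fun i ↦ notMem_ivl_leftEnd hx i j))

theorem Coeffs.transfer_mulVec (hS : S.Admissible a b) (hx : StrictMono x)
    (hxab : ∀ j, x j ∈ ivl a b) (hz : S.Xi a b z ⊆ range x) {j : Fin (m + 1)}
    {U : ℝ → Matrix (Fin n) (Fin n) ℂ} (hU : S.IsPropagator z (leftEnd a x j) (x j) U)
    (c : Fin n → ℂ) : S.transfer a x z j *ᵥ c =
      volterraEnd S.baseMeasure ((ivl (leftEnd a x j) (x j)).indicator (S.coeff z)) c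
        (fun x ↦ U x *ᵥ c) :=
  Coeffs.leftLim_fund_mulVec hS (ivl_leftEnd_subset hxab j)
    (notMem_Xi_of_mem hz (fun i ↦ notMem_ivl_leftEnd hx i j)) rfl hU (leftEnd_lt hx hxab j) c

theorem Coeffs.isUnit_transfer (hS : S.Admissible a b) (hx : StrictMono x)
    (hxab : ∀ j, x j ∈ ivl a b) (hz : S.Xi a b z ⊆ range x) (j : Fin (m + 1)) :
    IsUnit (S.transfer a x z j) := by
  obtain ⟨U, hU⟩ := Coeffs.exists_isPropagator_leftEnd hS hx hxab hz j
  rw [← Matrix.mulVec_injective_iff_isUnit]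
  refine (injective_iff_map_eq_zero (Matrix.mulVecLin (S.transfer a x z j))).2 fun c hc ↦ ?_
  rw [mulVecLin_apply, Coeffs.transfer_mulVec hS hx hxab hz hU] at hc
  exact hU.injective_volterraEnd hS (ivl_leftEnd_subset hxab j)
    (notMem_Xi_of_mem hz (fun i ↦ notMem_ivl_leftEnd hx i j)) (leftEnd_lt hx hxab j) hc

/-- The adjoint of the transfer matrix for `z̄` is, up to `J`, the inverse of that for `z`. -/
theorem Coeffs.transfer_conjTranspose_mulVec_eq_iff (hS : S.Admissible a b) (hx : StrictMono x)
    (hxab : ∀ j, x j ∈ ivl a b) (hz : S.Xi a b z ⊆ range x) (j : Fin (m + 1)) {p q : Fin n → ℂ} :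
    (S.transfer a x (conj z) j)ᴴ *ᵥ (S.J *ᵥ p) = S.J *ᵥ q ↔ p = S.transfer a x z j *ᵥ q := by
  have hz' : S.Xi a b (conj z) ⊆ range x := by rwa [Coeffs.Xi_conj hS]
  obtain ⟨U, hU⟩ := Coeffs.exists_isPropagator_leftEnd hS hx hxab hz j
  obtain ⟨V, hV⟩ := Coeffs.exists_isPropagator_leftEnd hS hx hxab hz' j
  -- This is T(z̄)*JT(z) = J, the constancy of the Wronskian between the two ends of the
  -- subinterval.
  have key (q : Fin n → ℂ) :
      (S.transfer a x (conj z) j)ᴴ *ᵥ (S.J *ᵥ (S.transfer a x z j *ᵥ q)) = S.J *ᵥ q := by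
    rw [← sub_eq_zero]
    refine eq_zero_of_forall_star_dotProduct fun c ↦ ?_
    have h := (hS.wronskian_eq (ivl_leftEnd_subset hxab j) (hU q) (hV c)).2 (leftEnd_lt hx hxab j)
    rw [← Coeffs.transfer_mulVec hS hx hxab hz hU, ← Coeffs.transfer_mulVec hS hx hxab hz' hV,
      star_mulVec, ← dotProduct_mulVec] at h
    rw [dotProduct_sub, h, sub_self]
  constructor
  · intro h
    obtain ⟨q', rfl⟩ := Matrix.mulVec_surjective_iff_isUnit.2
      (Coeffs.isUnit_transfer hS hx hxab hz j) p
    rw [key] at h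
    rw [Coeffs.J_mulVec_injective hS.isUnit_J h]
  · rintro rfl
    exact key q

/-- The matching conditions which describe the kernel of `B_m(z̄)ᴴ`. -/
theorem Coeffs.mem_ker_Bm_conj_iff (hS : S.Admissible a b) (hxab : ∀ j, x j ∈ ivl a b)
    {v : Fin (m + 1) × Fin n → ℂ} :
    v ∈ LinearMap.ker (S.Bm a x (conj z))ᴴ.mulVecLin ↔ ∀ j : Fin m,
      (S.transfer a x (conj z) j.succ)ᴴ *ᵥ (S.Bplus (x j.succ) z *ᵥ block v j.succ) =
        S.Bminus (x j.castSucc) z *ᵥ block v j.castSucc := by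
  rw [Coeffs.mem_ker_Bm_iff]
  refine forall_congr' fun j ↦ ?_
  rw [Coeffs.block_B_conjTranspose_succ, conjTranspose_mul,
    Coeffs.Bplus_conjTranspose hS (hxab _), Coeffs.Bminus_conjTranspose hS (hxab _),
    Complex.conj_conj, mul_neg, neg_mulVec, neg_mulVec, sub_neg_eq_add, neg_add_eq_zero,
    ← mulVec_mulVec, eq_comm]

/-- The additional conditions which describe the kernel of `B(z̄)ᴴ`. -/
theorem Coeffs.mem_ker_B_conj_iff (hS : S.Admissible a b) (hx : StrictMono x)
    (hxab : ∀ j, x j ∈ ivl a b) (hz : S.Xi a b z ⊆ range x) {v : Fin (m + 1) × Fin n → ℂ} :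
    v ∈ LinearMap.ker (S.B a x (conj z))ᴴ.mulVecLin ↔
      v ∈ LinearMap.ker (S.Bm a x (conj z))ᴴ.mulVecLin ∧ S.Bplus (x 0) z *ᵥ block v 0 = 0 ∧
        S.Bminus (x (Fin.last m)) z *ᵥ block v (Fin.last m) = 0 := by
  rw [Coeffs.mem_ker_B_conjTranspose_iff, Coeffs.block_B_conjTranspose_zero,
    Coeffs.block_B_conjTranspose_last, conjTranspose_mul,
    Coeffs.Bplus_conjTranspose hS (hxab _), Coeffs.Bminus_conjTranspose hS (hxab _),
    Complex.conj_conj, mul_neg, neg_mulVec, neg_mulVec, neg_neg, neg_eq_zero, ← mulVec_mulVec]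
  -- The adjoint transfer matrix is injective and may be cancelled.
  have h : (S.transfer a x (conj z) 0)ᴴ *ᵥ (S.Bplus (x 0) z *ᵥ block v 0) = 0 ↔
      S.Bplus (x 0) z *ᵥ block v 0 = 0 := by
    obtain ⟨p, hp⟩ := Matrix.mulVec_surjective_iff_isUnit.2 hS.isUnit_J
      (S.Bplus (x 0) z *ᵥ block v 0)
    rw [← hp]
    have := Coeffs.transfer_conjTranspose_mulVec_eq_iff hS hx hxab hz 0 (p := p) (q := 0)
    rw [mulVec_zero, mulVec_zero] at this
    rw [this]
    exact ⟨fun h ↦ by rw [h, mulVec_zero],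
      fun h ↦ Coeffs.J_mulVec_injective hS.isUnit_J (h.trans (mulVec_zero _).symm)⟩
  rw [h]

/-- `ker B(z)` and `ker B_m(z̄)ᴴ` have the same dimension. -/
theorem Coeffs.finrank_ker_B (hS : S.Admissible a b) (hx : StrictMono x)
    (hxab : ∀ j, x j ∈ ivl a b) (hz : S.Xi a b z ⊆ range x) :
    Module.finrank ℂ (LinearMap.ker (S.B a x z).mulVecLin) =
      Module.finrank ℂ (LinearMap.ker (S.Bm a x (conj z))ᴴ.mulVecLin) := by
  have hJ := hS.isUnit_J
  have hBpm (j : Fin (m + 1)) (p : Fin n → ℂ) :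
      S.Bplus (x j) z *ᵥ p + S.Bminus (x j) z *ᵥ p = (2 : ℂ) • (S.J *ᵥ p) := by
    rw [← add_mulVec, Coeffs.Bplus_add_Bminus, smul_mulVec]
  -- A vector w in ker B(z) lists initial values on the successive subintervals. At x_j the left
  -- limit is U w_{j-1} and the right limit is w_j; ψ takes their mean, the balanced value of the
  -- solution at x_j.
  let ψ : (Fin (m + 2) × Fin n → ℂ) →ₗ[ℂ] (Fin (m + 1) × Fin n → ℂ) :=
    { toFun := fun w p ↦ (1 / 2 : ℂ) *
        (block w p.1.succ p.2 + (S.transfer a x z p.1 *ᵥ block w p.1.castSucc) p.2)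
      map_add' := fun w w' ↦ by
        funext p
        have h : block (w + w') p.1.castSucc = block w p.1.castSucc + block w' p.1.castSucc := rfl
        rw [h, mulVec_add]
        simp only [block, Pi.add_apply]
        ring
      map_smul' := fun c w ↦ by
        funext p
        have h : block (c • w) p.1.castSucc = c • block w p.1.castSucc := rfl
        rw [h, mulVec_smul]
        simp only [block, Pi.smul_apply, smul_eq_mul, RingHom.id_apply]
        ring }
  have hψ (w : Fin (m + 2) × Fin n → ℂ) (j : Fin (m + 1)) : block (ψ w) j =
      (1 / 2 : ℂ) • (block w j.succ + S.transfer a x z j *ᵥ block w j.castSucc) := rfl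
  have hker (w : Fin (m + 2) × Fin n → ℂ) : w ∈ LinearMap.ker (S.B a x z).mulVecLin ↔
      ∀ j, S.Bplus (x j) z *ᵥ block w j.succ =
        S.Bminus (x j) z *ᵥ (S.transfer a x z j *ᵥ block w j.castSucc) := by
    rw [LinearMap.mem_ker, mulVecLin_apply]
    constructor
    · intro h j
      have := S.block_B_mulVec a x z w j
      rw [h] at this
      exact sub_eq_zero.1 this.symm
    · intro h
      exact block_ext fun j ↦ (S.block_B_mulVec a x z w j).trans (sub_eq_zero.2 (h j))
  -- On the kernel, B₊w_j = B₋Uw_{j-1}. With B₊ + B₋ = 2J this recovers both one-sided limits from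
  -- the mean, which makes ψ injective there.
  have hplus {w} (hw : w ∈ LinearMap.ker (S.B a x z).mulVecLin) (j : Fin (m + 1)) :
      S.Bplus (x j) z *ᵥ block (ψ w) j = S.J *ᵥ (S.transfer a x z j *ᵥ block w j.castSucc) := by
    rw [hψ, mulVec_smul, mulVec_add, (hker w).1 hw j, add_comm, hBpm, smul_smul]
    norm_num
  have hminus {w} (hw : w ∈ LinearMap.ker (S.B a x z).mulVecLin) (j : Fin (m + 1)) :
      S.Bminus (x j) z *ᵥ block (ψ w) j = S.J *ᵥ block w j.succ := by
    rw [hψ, mulVec_smul, mulVec_add, ← (hker w).1 hw j, add_comm, hBpm, smul_smul]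
    norm_num
  have hinj : Function.Injective (ψ.domRestrict (LinearMap.ker (S.B a x z).mulVecLin)) := by
    rw [injective_iff_map_eq_zero]
    rintro ⟨w, hw⟩ h0
    have h0' : ψ w = 0 := h0
    have hs (j : Fin (m + 1)) : block w j.succ = 0 := by
      have := hminus hw j
      rw [h0'] at this
      exact Coeffs.J_mulVec_injective hJ (this.symm.trans ((mulVec_zero _).trans
        (mulVec_zero _).symm))
    have hz0 : block w 0 = 0 := by
      have := hplus hw 0
      rw [h0'] at this
      have h2 := Coeffs.J_mulVec_injective hJ (this.symm.trans ((mulVec_zero _).trans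
        (mulVec_zero _).symm))
      exact Matrix.mulVec_injective_iff_isUnit.2 (Coeffs.isUnit_transfer hS hx hxab hz 0)
        (h2.trans (mulVec_zero _).symm)
    exact Subtype.ext (block_ext fun j ↦ Fin.cases hz0 hs j)
  have hmap : LinearMap.range (ψ.domRestrict (LinearMap.ker (S.B a x z).mulVecLin)) =
      LinearMap.ker (S.Bm a x (conj z))ᴴ.mulVecLin := by
    apply le_antisymm
    · rintro _ ⟨⟨w, hw⟩, rfl⟩
      rw [Coeffs.mem_ker_Bm_conj_iff hS hxab]
      intro j
      rw [LinearMap.domRestrict_apply, hplus hw, hminus hw,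
        Coeffs.transfer_conjTranspose_mulVec_eq_iff hS hx hxab hz, Fin.castSucc_succ]
    · intro v hv
      rw [Coeffs.mem_ker_Bm_conj_iff hS hxab] at hv
      have hsurj := Matrix.mulVec_surjective_iff_isUnit.2 hJ
      -- Conversely the one-sided limits p_j and q_j are read off from Jp = B₊v and Jq = B₋v. The
      -- matching conditions say that the transfer matrices carry q_j to p_{j+1}; the initial value
      -- on the first subinterval comes from inverting the first transfer matrix.
      choose p hp using fun j ↦ hsurj (S.Bplus (x j) z *ᵥ block v j)
      choose q hq using fun j ↦ hsurj (S.Bminus (x j) z *ᵥ block v j)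
      obtain ⟨w₀, hw₀⟩ := Matrix.mulVec_surjective_iff_isUnit.2
        (Coeffs.isUnit_transfer hS hx hxab hz 0) (p 0)
      let w : Fin (m + 2) × Fin n → ℂ :=
        fun r ↦ (Fin.cons w₀ q : Fin (m + 2) → Fin n → ℂ) r.1 r.2
      have hws (j : Fin (m + 1)) : block w j.succ = q j := rfl
      have hwc (j : Fin (m + 1)) : S.transfer a x z j *ᵥ block w j.castSucc = p j := by
        refine Fin.cases hw₀ (fun i ↦ ?_) j
        have h := hv i
        rw [← hp, ← hq, Coeffs.transfer_conjTranspose_mulVec_eq_iff hS hx hxab hz] at h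
        rw [h]
        rfl
      have hpq (j : Fin (m + 1)) : block v j = (1 / 2 : ℂ) • (q j + p j) := by
        apply Coeffs.J_mulVec_injective hJ
        rw [mulVec_smul, mulVec_add, hp, hq, add_comm (S.Bminus (x j) z *ᵥ block v j), hBpm, smul_smul]
        norm_num
      refine ⟨⟨w, (hker w).2 fun j ↦ ?_⟩, block_ext fun j ↦ ?_⟩
      · rw [hws, hwc]
        have h1 := hp j
        have h2 := hq j
        have h3 := hBpm j (q j)
        have h4 := hBpm j (p j)
        rw [h2] at h3
        rw [h1] at h4
        -- Since v = ½(q + p) and (B₊ + B₋)p = 2Jp = 2B₊v, expanding 2B₊v leaves B₊q = B₋p, the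
        -- kernel condition.
        have h5 : S.Bplus (x j) z *ᵥ block v j =
            (1 / 2 : ℂ) • (S.Bplus (x j) z *ᵥ q j + S.Bplus (x j) z *ᵥ p j) := by
          rw [hpq, mulVec_smul, mulVec_add]
        have h6 : S.Bplus (x j) z *ᵥ p j = (2 : ℂ) • (S.Bplus (x j) z *ᵥ block v j) -
            S.Bminus (x j) z *ᵥ p j := eq_sub_of_add_eq h4
        rw [h6] at h5
        have h7 : (2 : ℂ) • (S.Bplus (x j) z *ᵥ block v j) = S.Bplus (x j) z *ᵥ q j +
            ((2 : ℂ) • (S.Bplus (x j) z *ᵥ block v j) - S.Bminus (x j) z *ᵥ p j) := by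
          conv_lhs => rw [h5, smul_smul]
          norm_num
        have h8 : S.Bplus (x j) z *ᵥ q j - S.Bminus (x j) z *ᵥ p j = 0 := by
          have := sub_eq_zero.2 h7.symm
          rw [← this]
          abel
        exact sub_eq_zero.1 h8
      · rw [LinearMap.domRestrict_apply, hψ, hws, hwc, hpq]
  rw [← hmap]
  exact (LinearMap.finrank_range_of_inj hinj).symm

end Transfer

/-! ### Uniqueness from end points and continuation across a partition point -/

section Local

variable {S : Coeffs n} {a b s t : EReal} {z : ℂ} {u : ℝ → Fin n → ℂ}

theorem leftLim_congr_of_eqOn {v : ℝ → Fin n → ℂ} {x : ℝ} {A : Set ℝ} (hA : A ∈ 𝓝[<] x)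
    (h : EqOn u v A) {l : Fin n → ℂ} (hu : Tendsto u (𝓝[<] x) (𝓝 l)) :
    Function.leftLim v x = l :=
  leftLim_eq_of_tendsto (hu.congr' (by filter_upwards [hA] with y hy using h hy))

theorem rightLim_congr_of_eqOn {v : ℝ → Fin n → ℂ} {x : ℝ} {A : Set ℝ} (hA : A ∈ 𝓝[>] x)
    (h : EqOn u v A) {l : Fin n → ℂ} (hu : Tendsto u (𝓝[>] x) (𝓝 l)) :
    Function.rightLim v x = l :=
  rightLim_eq_of_tendsto (hu.congr' (by filter_upwards [hA] with y hy using h hy))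

theorem Coeffs.IsSolution.tendsto_leftLim (hu : S.IsSolution z s t u) {x : ℝ}
    (hx : x ∈ ivl s t) : Tendsto u (𝓝[<] x) (𝓝 (Function.leftLim u x)) :=
  tendsto_leftLim_of_locBV (isOpen_ivl s t) hu.locBV hx

theorem Coeffs.IsSolution.tendsto_rightLim (hu : S.IsSolution z s t u) {x : ℝ}
    (hx : x ∈ ivl s t) : Tendsto u (𝓝[>] x) (𝓝 (Function.rightLim u x)) :=
  tendsto_rightLim_of_locBV (isOpen_ivl s t) hu.locBV hx

/-- Because (s,t) is open, one-sided limits inside it depend only on values in it. This permits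
extending solutions by 0. -/
theorem Coeffs.IsSolution.congr {v : ℝ → Fin n → ℂ} (hu : S.IsSolution z s t u)
    (h : EqOn u v (ivl s t)) : S.IsSolution z s t v := by
  have hnhds {x : ℝ} (hx : x ∈ ivl s t) : ivl s t ∈ 𝓝 x := (isOpen_ivl s t).mem_nhds hx
  have hl {x : ℝ} (hx : x ∈ ivl s t) : Function.leftLim v x = Function.leftLim u x :=
    leftLim_congr_of_eqOn (mem_nhdsWithin_of_mem_nhds (hnhds hx)) h (hu.tendsto_leftLim hx)
  have hr {x : ℝ} (hx : x ∈ ivl s t) : Function.rightLim v x = Function.rightLim u x :=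
    rightLim_congr_of_eqOn (mem_nhdsWithin_of_mem_nhds (hnhds hx)) h (hu.tendsto_rightLim hx)
  have hBV {A : Set ℝ} (hA : A ⊆ ivl s t) (h' : BoundedVariationOn u A) :
      BoundedVariationOn v A := by
    rwa [BoundedVariationOn, ← eVariationOn.eq_of_eqOn (h.mono hA)]
  refine ⟨fun p r hp hr ↦ hBV inter_subset_left (hu.locBV p r hp hr), fun x hx ↦ ?_,
    fun c hc d hd hcd ↦ ?_⟩
  · rw [← h hx, hl hx, hr hx, ← hu.balanced x hx]
  · have hsub := Icc_subset_ivl hc hd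
    have hbu := hu.boundedVariationOn_Icc hc hd
    have e (μ : MatrixMeasure n) (hμ : μ.IsDominated S.baseMeasure) :
        μ.integral (Icc c d) v = μ.integral (Icc c d) u := by
      rw [(hμ.integral_Icc hbu).2, (hμ.integral_Icc (hBV hsub hbu)).2]
      exact setIntegral_congr_fun measurableSet_Icc fun x hx ↦ by
        simp only [h (hsub hx)]
    rw [hl hc, hr hd, e _ S.isDominated_q, e _ S.isDominated_w]
    exact hu.eqn c hc d hd hcd

theorem tendsto_coe_nhdsGT (σ : ℝ) :
    Tendsto (fun x : ℝ ↦ (x : EReal)) (𝓝[>] σ) (𝓝[>] (σ : EReal)) := by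
  refine tendsto_nhdsWithin_iff.2 ⟨(continuous_coe_real_ereal.tendsto σ).mono_left
    nhdsWithin_le_nhds, ?_⟩
  filter_upwards [self_mem_nhdsWithin] with y hy using EReal.coe_lt_coe_iff.2 hy

theorem ivl_mem_nhdsGT {σ : ℝ} (h : (σ : EReal) < t) : ivl σ t ∈ 𝓝[>] σ := by
  obtain ⟨p, hp⟩ := ivl_nonempty_of_lt h
  filter_upwards [Ioo_mem_nhdsGT (EReal.coe_lt_coe_iff.1 hp.1)] with y hy
  exact ⟨EReal.coe_lt_coe_iff.2 hy.1, (EReal.coe_lt_coe_iff.2 hy.2).trans hp.2⟩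

theorem ivl_mem_nhdsLT {τ : ℝ} (h : s < (τ : EReal)) : ivl s τ ∈ 𝓝[<] τ := by
  obtain ⟨p, hp⟩ := ivl_nonempty_of_lt h
  filter_upwards [Ioo_mem_nhdsLT (EReal.coe_lt_coe_iff.1 hp.2)] with y hy
  exact ⟨hp.1.trans (EReal.coe_lt_coe_iff.2 hy.1), EReal.coe_lt_coe_iff.2 hy.2⟩

theorem Coeffs.IsPropagator.rightLim_eq_of_eqOn {U : ℝ → Matrix (Fin n) (Fin n) ℂ} {σ : ℝ}
    (hU : S.IsPropagator z σ t U) (h : (σ : EReal) < t) {c : Fin n → ℂ}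
    (hu : EqOn (fun y ↦ U y *ᵥ c) u (ivl σ t)) : Function.rightLim u σ = c :=
  rightLim_congr_of_eqOn (ivl_mem_nhdsGT h) hu
    ((hU c).tendsto_start.1.mono_left (map_le_iff_le_comap.1 (tendsto_coe_nhdsGT σ)))

theorem Coeffs.IsPropagator.leftLim_eq_of_eqOn {U : ℝ → Matrix (Fin n) (Fin n) ℂ} {τ : ℝ}
    (hU : S.IsPropagator z s τ U) (h : s < (τ : EReal)) {c : Fin n → ℂ}
    (hu : EqOn (fun y ↦ U y *ᵥ c) u (ivl s τ)) : Function.leftLim u τ =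
      volterraEnd S.baseMeasure ((ivl s τ).indicator (S.coeff z)) c (fun x ↦ U x *ᵥ c) :=
  leftLim_congr_of_eqOn (ivl_mem_nhdsLT h) hu (hU c).tendsto_left_end

/-- On the interval u = Uc, and c is the right limit of u at the end point σ, which lies outside the
interval. -/
theorem Coeffs.IsSolution.eq_zero_of_rightLim_start (hS : S.Admissible a b)
    {σ : ℝ} (hst : ivl σ t ⊆ ivl a b)
    (hreg : ∀ x ∈ ivl σ t, x ∉ S.Xi a b z) (hu : S.IsSolution z σ t u)
    (h : Function.rightLim u σ = 0) {y : ℝ} (hy : y ∈ ivl σ t) : u y = 0 := by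
  obtain ⟨U, hU⟩ := Coeffs.exists_isPropagator hS hst hreg
  obtain ⟨c, hc⟩ := hU.exists_eq hS hst hreg hu
  have := hU.rightLim_eq_of_eqOn (lt_of_mem_ivl hy) (u := u) fun x hx ↦ (hc x hx).symm
  rw [hc y hy, ← this, h, mulVec_zero]

theorem Coeffs.IsSolution.eq_zero_of_leftLim_end (hS : S.Admissible a b)
    {τ : ℝ} (hst : ivl s τ ⊆ ivl a b)
    (hreg : ∀ x ∈ ivl s τ, x ∉ S.Xi a b z) (hu : S.IsSolution z s τ u)
    (h : Function.leftLim u τ = 0) {y : ℝ} (hy : y ∈ ivl s τ) : u y = 0 := by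
  obtain ⟨U, hU⟩ := Coeffs.exists_isPropagator hS hst hreg
  obtain ⟨c, hc⟩ := hU.exists_eq hS hst hreg hu
  have := hU.leftLim_eq_of_eqOn (lt_of_mem_ivl hy) (u := u) fun x hx ↦ (hc x hx).symm
  rw [h] at this
  rw [hc y hy, hU.injective_volterraEnd hS hst hreg (lt_of_mem_ivl hy) this.symm, mulVec_zero]

/-- Continuation of a solution on `(s, τ)` across `τ`. -/
theorem Coeffs.exists_isVolterra_extend (hJ : IsUnit S.J) {τ : ℝ} (hτ : τ ∈ ivl s t)
    {u₁ : ℝ → Fin n → ℂ} {c v e : Fin n → ℂ}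
    (h₁ : IsVolterra S.baseMeasure ((ivl s τ).indicator (S.coeff z)) c u₁)
    (he : volterraEnd S.baseMeasure ((ivl s τ).indicator (S.coeff z)) c u₁ = e)
    (hv : S.Bplus τ z *ᵥ v = S.J *ᵥ e) {c₂ : Fin n → ℂ} (hc₂ : S.J *ᵥ c₂ = S.Bminus τ z *ᵥ v)
    {U : ℝ → Matrix (Fin n) (Fin n) ℂ} (hU : S.IsPropagator z τ t U) :
    ∃ u, IsVolterra S.baseMeasure ((ivl s t).indicator (S.coeff z)) c u ∧
      (∀ x < τ, u x = u₁ x) ∧ u τ = v ∧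
      volterraEnd S.baseMeasure ((ivl s t).indicator (S.coeff z)) c u =
        volterraEnd S.baseMeasure ((ivl τ t).indicator (S.coeff z)) c₂ (fun x ↦ U x *ᵥ c₂) := by
  have h1 : (Iio τ).indicator ((ivl s t).indicator (S.coeff z)) =
      (ivl s τ).indicator (S.coeff z) := by
    rw [indicator_indicator]
    congr 1
    ext y
    simp only [mem_inter_iff, mem_Iio, ivl, mem_ofPred_eq, EReal.coe_lt_coe_iff]
    exact ⟨fun h ↦ ⟨h.2.1, h.1⟩, fun h ↦ ⟨h.2, h.1, (EReal.coe_lt_coe_iff.2 h.2).trans hτ.2⟩⟩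
  have h2 : (Ioi τ).indicator ((ivl s t).indicator (S.coeff z)) =
      (ivl τ t).indicator (S.coeff z) := by
    rw [indicator_indicator]
    congr 1
    ext y
    simp only [mem_inter_iff, mem_Ioi, ivl, mem_ofPred_eq, EReal.coe_lt_coe_iff]
    exact ⟨fun h ↦ ⟨h.1, h.2.2⟩, fun h ↦ ⟨h.1, hτ.1.trans (EReal.coe_lt_coe_iff.2 h.1), h.2⟩⟩
  have hA : (ivl s t).indicator (S.coeff z) τ = S.coeff z τ := indicator_of_mem hτ _
  -- B₋ = B₊ - (Δ_q - zΔ_w), so c₂ is the left limit e plus the full jump at τ. This is the starting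
  -- value which gluing requires.
  have hce : c₂ = e + S.baseMeasure.real {τ} • S.coeff z τ v := by
    apply Coeffs.J_mulVec_injective hJ
    rw [hc₂, mulVec_add, Coeffs.J_mulVec_smul_coeff hJ, ← hv, ← sub_eq_add_neg, ← sub_mulVec]
    congr 1
    rw [Coeffs.Bplus, Coeffs.Bminus]
    module
  obtain ⟨u, hu, hu1, hu2, -, hu3⟩ := IsVolterra.glue (A := (ivl s t).indicator (S.coeff z))
    (ν := S.baseMeasure) (c := c) (u₁ := u₁) (u₂ := fun x ↦ U x *ᵥ c₂) (τ := τ) (v := v)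
    (by rwa [h1]) (by rw [h1, he, hA]; exact (Coeffs.Bplus_mulVec_eq_iff hJ).1 hv)
    (by rw [h1, h2, he, hA, ← hce]; exact hU c₂)
  rw [h1, h2, he, hA, ← hce] at hu3
  exact ⟨u, hu, hu1, hu2, hu3⟩

end Local

/-! ### Solutions with compact support -/

section Compact

variable {S : Coeffs n} {a b s t : EReal} {z : ℂ} {u : ℝ → Fin n → ℂ}

/-- Adding p to K covers the case of empty K and ensures c < p < d. -/
theorem exists_Icc_of_isCompact {K : Set ℝ} (hK : IsCompact K) (hKs : K ⊆ ivl s t) {p : ℝ}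
    (hp : p ∈ ivl s t) : ∃ c ∈ ivl s p, ∃ d ∈ ivl p t, ∀ y ∈ K, c < y ∧ y < d := by
  have hK' : IsCompact (insert p K) := hK.insert p
  have hne : (insert p K).Nonempty := insert_nonempty _ _
  have hsub : insert p K ⊆ ivl s t := insert_subset hp hKs
  obtain ⟨c', hc', hc⟩ := hK'.exists_isLeast hne
  obtain ⟨d', hd', hd⟩ := hK'.exists_isGreatest hne
  obtain ⟨c, hc1, hc2⟩ := ivl_nonempty_of_lt (hsub hc').1
  obtain ⟨d, hd1, hd2⟩ := ivl_nonempty_of_lt (hsub hd').2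
  rw [EReal.coe_lt_coe_iff] at hc2 hd1
  refine ⟨c, ⟨hc1, EReal.coe_lt_coe_iff.2 (hc2.trans_le (hc (mem_insert _ _)))⟩, d,
    ⟨EReal.coe_lt_coe_iff.2 ((hd (mem_insert _ _)).trans_lt hd1), hd2⟩, fun y hy ↦ ?_⟩
  exact ⟨hc2.trans_le (hc (mem_insert_of_mem _ hy)), (hd (mem_insert_of_mem _ hy)).trans_lt hd1⟩

theorem leftLim_eq_zero_of_forall_lt {c : ℝ} (h : ∀ y < c, u y = 0) : Function.leftLim u c = 0 :=
  leftLim_congr_of_eqOn (u := fun _ ↦ 0) self_mem_nhdsWithin (fun y hy ↦ (h y hy).symm)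
    tendsto_const_nhds

theorem rightLim_eq_zero_of_forall_gt {c : ℝ} (h : ∀ y, c < y → u y = 0) :
    Function.rightLim u c = 0 :=
  rightLim_congr_of_eqOn (u := fun _ ↦ 0) self_mem_nhdsWithin (fun y hy ↦ (h y hy).symm)
    tendsto_const_nhds

/-- `w u = 0` for solutions with compact support. -/
theorem Coeffs.density_mulVec_eq_zero (hS : S.Admissible a b) (hz : z ≠ conj z)
    (hu : u ∈ S.compactSolutions z a b) :
    ∀ᵐ y ∂S.baseMeasure, y ∈ ivl a b → S.w.density S.baseMeasure y *ᵥ u y = 0 := by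
  obtain ⟨⟨hsol, h0⟩, K, hK, hKs, hKu⟩ := hu
  rcases (ivl a b).eq_empty_or_nonempty with he | ⟨p, hp⟩
  · simp [he]
  obtain ⟨c, hc, d, hd, hcd⟩ := exists_Icc_of_isCompact hK hKs hp
  have hcp := EReal.coe_lt_coe_iff.1 hc.2
  have hpd := EReal.coe_lt_coe_iff.1 hd.1
  have hc' : c ∈ ivl a b := ⟨hc.1, hc.2.trans hp.2⟩
  have hd' : d ∈ ivl a b := ⟨hp.1.trans hd.1, hd.2⟩
  -- Lagrange's identity for u with itself on an interval containing the support: the boundary terms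
  -- vanish and leave (z - z̄)∫u*Wu = 0.
  have hlag := hS.lagrange subset_rfl hsol hsol hc' hd' (hcp.trans hpd).le
  have hzero {y : ℝ} (hy : y ∉ Icc c d) : u y = 0 :=
    hKu y fun hyK ↦ hy ⟨(hcd y hyK).1.le, (hcd y hyK).2.le⟩
  rw [leftLim_eq_zero_of_forall_lt fun y hy ↦ hzero fun h ↦ (not_lt.2 h.1) hy,
    rightLim_eq_zero_of_forall_gt fun y hy ↦ hzero fun h ↦ (not_lt.2 h.2) hy] at hlag
  simp only [mulVec_zero, dotProduct_zero, sub_zero] at hlag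
  have hint := (mul_eq_zero.1 hlag.symm).resolve_left (sub_ne_zero.2 hz)
  have hW := S.isDominated_w.posSemidef_density (measurableSet_ivl a b) hS.nonneg_w
  have hsub := Icc_subset_ivl hc' hd'
  have hW' := ae_restrict_of_ae_restrict_of_subset hsub hW
  -- On [c,d] the factor u* is a constant plus a balanced primitive, hence bounded and measurable,
  -- while Wu is integrable.
  have hi : IntegrableOn (fun y ↦ star (u y) ⬝ᵥ (S.w.density S.baseMeasure y *ᵥ u y)) (Icc c d)
      S.baseMeasure := by
    obtain ⟨hui, hue⟩ := hsol.eq_balPrim hS.isUnit_J hc' hd'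
    have hWu := (S.isDominated_w.integral_Icc (hsol.boundedVariationOn_Icc hc' hd')).1
    simp only [dotProduct]
    refine integrable_finsetSum _ fun i _ ↦ ?_
    have hg := (integrable_indicator_iff measurableSet_Icc).2 (hWu.eval i)
    have hconj : Integrable (fun y ↦ conj ((Icc c d).indicator (fun x ↦ S.coeff z x (u x)) y i))
        S.baseMeasure := Complex.conjCLE.toContinuousLinearMap.integrable_comp (hui.eval i)
    have h1 := ((hg.const_mul (conj (Function.leftLim u c i))).add
      (integrable_balPrim_mul hconj hg)).integrableOn (s := Icc c d)
    refine h1.congr_fun (fun y hy ↦ ?_) measurableSet_Icc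
    simp only [Pi.add_apply, indicator_of_mem hy, ← star_balPrim, ← balPrim_apply hui]
    have e1 := congrFun (hue y hy) i
    rw [Pi.add_apply] at e1
    rw [← add_mul, ← map_add, ← e1]
    rfl
  have hre : ∫ y in Icc c d, RCLike.re (star (u y) ⬝ᵥ (S.w.density S.baseMeasure y *ᵥ u y))
      ∂S.baseMeasure = 0 := by
    rw [integral_re hi, hint]
    simp
  rw [setIntegral_eq_zero_iff_of_nonneg_ae (by
    filter_upwards [hW'] with y hy
    exact (RCLike.nonneg_iff.1 (hy.dotProduct_mulVec_nonneg (u y))).1) hi.re] at hre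
  rw [Filter.EventuallyEq, ae_restrict_iff' measurableSet_Icc] at hre
  rw [ae_restrict_iff' measurableSet_Icc] at hW'
  filter_upwards [hre, hW'] with y hy1 hy2 _
  by_cases hy : y ∈ Icc c d
  · rw [← (hy2 hy).dotProduct_mulVec_zero_iff]
    have h3 := RCLike.nonneg_iff.1 ((hy2 hy).dotProduct_mulVec_nonneg (u y))
    exact RCLike.ext (by simpa using hy1 hy) (by simpa using h3.2)
  · rw [hzero hy, mulVec_zero]

/-- Since wu = 0, the parameter drops out of the equation, and u solves it for every ζ. -/
theorem Coeffs.compactSolutions_le (hS : S.Admissible a b) (hz : z ≠ conj z) (ζ : ℂ) :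
    S.compactSolutions z a b ≤ S.compactSolutions ζ a b := by
  intro u hu
  have hWu := Coeffs.density_mulVec_eq_zero hS hz hu
  obtain ⟨⟨hsol, h0⟩, hK⟩ := hu
  refine ⟨⟨⟨hsol.locBV, hsol.balanced, fun c hc d hd hcd ↦ ?_⟩, h0⟩, hK⟩
  have h1 := hsol.eqn c hc d hd hcd
  have h2 : S.w.integral (Icc c d) u = 0 := by
    rw [(S.isDominated_w.integral_Icc (hsol.boundedVariationOn_Icc hc hd)).2]
    refine setIntegral_eq_zero_of_ae_eq_zero ?_
    filter_upwards [hWu] with y hy hy'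
    exact hy (Icc_subset_ivl hc hd hy')
  rwa [h2, smul_zero, ← smul_zero z, ← h2]

end Compact

/-! ### Solution spaces as kernels, and the dimension count -/

section SolutionSpaces

variable {S : Coeffs n} {a b : EReal} {x : Fin (m + 1) → ℝ} {z : ℂ} {u : ℝ → Fin n → ℂ}

/-- The values of a function at the partition points. -/
def evalPartition (n : ℕ) (x : Fin (m + 1) → ℝ) :
    (ℝ → Fin n → ℂ) →ₗ[ℂ] (Fin (m + 1) × Fin n → ℂ) where
  toFun u := fun r ↦ u (x r.1) r.2
  map_add' _ _ := rfl
  map_smul' _ _ := rfl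

theorem block_evalPartition (j : Fin (m + 1)) : block (evalPartition n x u) j = u (x j) := rfl

theorem Coeffs.IsSolution.eq_zero_left (hS : S.Admissible a b) (hx : StrictMono x)
    (hxab : ∀ j, x j ∈ ivl a b) (hz : S.Xi a b z ⊆ range x) (hu : S.IsSolution z a b u)
    {j : Fin (m + 1)} (h : Function.leftLim u (x j) = 0) {y : ℝ}
    (hy : y ∈ ivl (leftEnd a x j) (x j)) : u y = 0 :=
  (hu.mono (ivl_leftEnd_subset hxab j)).eq_zero_of_leftLim_end hS (ivl_leftEnd_subset hxab j)
    (notMem_Xi_of_mem hz fun i ↦ notMem_ivl_leftEnd hx i j) h hy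

theorem Coeffs.IsSolution.eq_zero_right (hS : S.Admissible a b) (hx : StrictMono x)
    (hxab : ∀ j, x j ∈ ivl a b) (hz : S.Xi a b z ⊆ range x) (hu : S.IsSolution z a b u)
    (h : Function.rightLim u (x (Fin.last m)) = 0) {y : ℝ}
    (hy : y ∈ ivl (x (Fin.last m)) b) : u y = 0 :=
  (hu.mono (ivl_last_subset hxab)).eq_zero_of_rightLim_start hS (ivl_last_subset hxab)
    (notMem_Xi_of_mem hz (notMem_ivl_last hx)) h hy

/-- By the jump conditions, Ju⁻(x_j) = B₊u(x_j) and Ju⁺(x_j) = B₋u(x_j) vanish. Uniqueness on each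
subinterval does the rest. -/
theorem Coeffs.eq_zero_of_evalPartition (hS : S.Admissible a b) (hx : StrictMono x)
    (hxab : ∀ j, x j ∈ ivl a b) (hz : S.Xi a b z ⊆ range x) (hu : u ∈ S.solutions z a b)
    (h : evalPartition n x u = 0) : u = 0 := by
  obtain ⟨hsol, h0⟩ := hu
  have hux (j : Fin (m + 1)) : u (x j) = 0 := by
    have : block (evalPartition n x u) j = 0 := by rw [h]; rfl
    exact this
  have hl (j : Fin (m + 1)) : Function.leftLim u (x j) = 0 := by
    apply Coeffs.J_mulVec_injective hS.isUnit_J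
    rw [← hsol.Bplus_mulVec hS.isUnit_J (hxab j), hux, mulVec_zero, mulVec_zero]
  have hr (j : Fin (m + 1)) : Function.rightLim u (x j) = 0 := by
    apply Coeffs.J_mulVec_injective hS.isUnit_J
    rw [← hsol.Bminus_mulVec hS.isUnit_J (hxab j), hux, mulVec_zero, mulVec_zero]
  funext y
  by_cases hy : y ∈ ivl a b
  · rcases exists_mem_ivl_of_mem (x := x) hy with ⟨j, rfl⟩ | ⟨j, hj⟩ | hj
    · exact hux j
    · exact hsol.eq_zero_left hS hx hxab hz (hl j) hj
    · exact hsol.eq_zero_right hS hx hxab hz (hr _) hj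
  · exact h0 y hy

/-- A solution with prescribed values at the partition points `x 0, …, x (k - 1)`. -/
theorem Coeffs.exists_solution_upTo (hS : S.Admissible a b) (hx : StrictMono x)
    (hxab : ∀ j, x j ∈ ivl a b) (hz : S.Xi a b z ⊆ range x) {v : Fin (m + 1) × Fin n → ℂ}
    (hv : v ∈ LinearMap.ker (S.Bm a x (conj z))ᴴ.mulVecLin) (k : Fin (m + 1)) :
    ∃ (c e : Fin n → ℂ) (u : ℝ → Fin n → ℂ),
      IsVolterra S.baseMeasure ((ivl a (x k)).indicator (S.coeff z)) c u ∧
      volterraEnd S.baseMeasure ((ivl a (x k)).indicator (S.coeff z)) c u = e ∧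
      S.Bplus (x k) z *ᵥ block v k = S.J *ᵥ e ∧ ∀ i < k, u (x i) = block v i := by
  have hJs (p : Fin n → ℂ) : ∃ q, S.J *ᵥ q = p :=
    Matrix.mulVec_surjective_iff_isUnit.2 hS.isUnit_J p
  induction k using Fin.induction with
  | zero =>
    obtain ⟨U, hU⟩ := Coeffs.exists_isPropagator_leftEnd hS hx hxab hz 0
    obtain ⟨e, he⟩ := hJs (S.Bplus (x 0) z *ᵥ block v 0)
    obtain ⟨c, hc⟩ := Matrix.mulVec_surjective_iff_isUnit.2
      (Coeffs.isUnit_transfer hS hx hxab hz 0) e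
    refine ⟨c, e, _, hU c, ?_, he.symm, fun i hi ↦ absurd hi (Fin.not_lt_zero i)⟩
    rw [← hc]
    exact (Coeffs.transfer_mulVec hS hx hxab hz hU c).symm
  | succ k ih =>
    obtain ⟨c, e, u₁, hu₁, he, hve, hi⟩ := ih
    obtain ⟨U, hU⟩ := Coeffs.exists_isPropagator_leftEnd hS hx hxab hz k.succ
    obtain ⟨c₂, hc₂⟩ := hJs (S.Bminus (x k.castSucc) z *ᵥ block v k.castSucc)
    obtain ⟨e', he'⟩ := hJs (S.Bplus (x k.succ) z *ᵥ block v k.succ)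
    have hlt := hx (Fin.castSucc_lt_succ (i := k))
    obtain ⟨u, hu, hu1, hu2, hu3⟩ := Coeffs.exists_isVolterra_extend hS.isUnit_J
      (t := x k.succ) ⟨(hxab _).1, EReal.coe_lt_coe_iff.2 hlt⟩ hu₁ he hve hc₂ hU
    -- The matching condition for v says that the transfer matrix carries the right limit c₂ at x_k
    -- to e'. So the continued solution arrives at the next point with the left limit that the
    -- prescribed value there demands.
    have hT := (Coeffs.mem_ker_Bm_conj_iff hS hxab).1 hv k
    rw [← he', ← hc₂, Coeffs.transfer_conjTranspose_mulVec_eq_iff hS hx hxab hz,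
      Coeffs.transfer_mulVec hS hx hxab hz hU] at hT
    refine ⟨c, e', u, hu, hu3.trans hT.symm, he'.symm, fun i hik ↦ ?_⟩
    rcases (Fin.le_castSucc_iff.2 hik).lt_or_eq with h | rfl
    · rw [hu1 _ (hx h), hi i h]
    · exact hu2

/-- With B₊u = Ju⁻ and B₋u = Ju⁺, membership in the kernel says that u⁻ at each later partition
point is the transfer matrix applied to u⁺ at the preceding one. Conversely a solution is built from
left to right. -/
theorem Coeffs.map_evalPartition_solutions (hS : S.Admissible a b) (hx : StrictMono x)
    (hxab : ∀ j, x j ∈ ivl a b) (hz : S.Xi a b z ⊆ range x) :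
    (S.solutions z a b).map (evalPartition n x) =
      LinearMap.ker (S.Bm a x (conj z))ᴴ.mulVecLin := by
  ext v
  constructor
  · rintro ⟨u, ⟨hsol, h0⟩, rfl⟩
    rw [Coeffs.mem_ker_Bm_conj_iff hS hxab]
    intro j
    rw [block_evalPartition, block_evalPartition, hsol.Bplus_mulVec hS.isUnit_J (hxab _),
      hsol.Bminus_mulVec hS.isUnit_J (hxab _),
      Coeffs.transfer_conjTranspose_mulVec_eq_iff hS hx hxab hz]
    obtain ⟨U, hU⟩ := Coeffs.exists_isPropagator_leftEnd hS hx hxab hz j.succ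
    have hsub := ivl_leftEnd_subset hxab j.succ
    have hlt := leftEnd_lt hx hxab j.succ
    obtain ⟨c, hc⟩ := hU.exists_eq hS hsub
      (notMem_Xi_of_mem hz fun i ↦ notMem_ivl_leftEnd hx i j.succ) (hsol.mono hsub)
    have hr := Coeffs.IsPropagator.rightLim_eq_of_eqOn (σ := x j.castSucc) hU hlt
      fun y hy ↦ (hc y hy).symm
    rw [hr, hU.leftLim_eq_of_eqOn hlt fun y hy ↦ (hc y hy).symm, Coeffs.transfer_mulVec hS hx hxab hz hU]
  · intro hv
    obtain ⟨c, e, u₁, hu₁, he, hve, hi⟩ :=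
      Coeffs.exists_solution_upTo hS hx hxab hz hv (Fin.last m)
    obtain ⟨c₂, hc₂⟩ := Matrix.mulVec_surjective_iff_isUnit.2 hS.isUnit_J
      (S.Bminus (x (Fin.last m)) z *ᵥ block v (Fin.last m))
    obtain ⟨U, hU⟩ := Coeffs.exists_isPropagator hS (ivl_last_subset hxab)
      (notMem_Xi_of_mem hz (notMem_ivl_last hx))
    obtain ⟨u, hu, hu1, hu2, -⟩ := Coeffs.exists_isVolterra_extend hS.isUnit_J (hxab (Fin.last m))
      hu₁ he hve hc₂ hU
    refine ⟨(ivl a b).indicator u, ⟨(hu.isSolution hS.isUnit_J).congr fun y hy ↦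
      (indicator_of_mem hy u).symm, fun y hy ↦ indicator_of_notMem hy u⟩, ?_⟩
    refine block_ext fun j ↦ ?_
    rw [block_evalPartition, indicator_of_mem (hxab j)]
    rcases (Fin.le_last j).lt_or_eq with h | rfl
    · rw [hu1 _ (hx h), hi j h]
    · exact hu2

/-- The two conditions mean u⁻(x_0) = 0 and u⁺(x_m) = 0 and force u to vanish on the two outer
subintervals. Conversely compact support makes u vanish near a and near b, hence on the outer
subintervals by uniqueness, as these contain no singular points. -/
theorem Coeffs.mem_compactSolutions_iff (hS : S.Admissible a b) (hx : StrictMono x)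
    (hxab : ∀ j, x j ∈ ivl a b) (hz : S.Xi a b z ⊆ range x) (hu : u ∈ S.solutions z a b) :
    u ∈ S.compactSolutions z a b ↔ S.Bplus (x 0) z *ᵥ u (x 0) = 0 ∧
      S.Bminus (x (Fin.last m)) z *ᵥ u (x (Fin.last m)) = 0 := by
  have hsol := hu.1
  have hsub₀ := ivl_leftEnd_subset hxab 0
  have hreg₀ := notMem_Xi_of_mem hz fun i ↦ notMem_ivl_leftEnd (a := a) hx i 0
  have hJ0 (p : Fin n → ℂ) : S.J *ᵥ p = 0 ↔ p = 0 :=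
    ⟨fun h ↦ Coeffs.J_mulVec_injective hS.isUnit_J (h.trans (mulVec_zero _).symm),
      fun h ↦ by rw [h, mulVec_zero]⟩
  rw [hsol.Bplus_mulVec hS.isUnit_J (hxab _), hsol.Bminus_mulVec hS.isUnit_J (hxab _), hJ0, hJ0]
  constructor
  · rintro ⟨-, K, hK, hKs, hKu⟩
    constructor
    · obtain ⟨c, hc, d, _, hcd⟩ := exists_Icc_of_isCompact hK hKs (hxab 0)
      have hleft (y : ℝ) (hy : y < c) : u y = 0 := hKu y fun h ↦ lt_asymm (hcd y h).1 hy
      obtain ⟨y, hy1, hy2⟩ := ivl_nonempty_of_lt hc.1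
      have hyc := EReal.coe_lt_coe_iff.1 hy2
      have hy : y ∈ ivl (leftEnd a x 0) (x 0) := ⟨hy1, hy2.trans hc.2⟩
      have hr : Function.rightLim u y = 0 :=
        rightLim_congr_of_eqOn (u := fun _ ↦ 0) (Ioo_mem_nhdsGT hyc)
          (fun p hp ↦ (hleft p hp.2).symm) tendsto_const_nhds
      refine leftLim_congr_of_eqOn (u := fun _ ↦ 0) (ivl_mem_nhdsLT (hxab 0).1) (fun p hp ↦ ?_)
        tendsto_const_nhds
      exact ((hsol.mono hsub₀).eq_zero_of_rightLim hS hsub₀ hreg₀ hy hr hp).symm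
    · obtain ⟨c, _, d, hd, hcd⟩ := exists_Icc_of_isCompact hK hKs (hxab (Fin.last m))
      refine rightLim_congr_of_eqOn (u := fun _ ↦ 0) (ivl_mem_nhdsGT (hxab _).2) (fun p hp ↦ ?_)
        tendsto_const_nhds
      exact ((hsol.mono (ivl_last_subset hxab)).eq_zero_of_rightLim hS (ivl_last_subset hxab)
        (notMem_Xi_of_mem hz (notMem_ivl_last hx)) hd
        (rightLim_eq_zero_of_forall_gt fun y hy ↦ hKu y fun h ↦ lt_asymm (hcd y h).2 hy) hp).symm
  · rintro ⟨hl, hr⟩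
    refine ⟨hu, Icc (x 0) (x (Fin.last m)), isCompact_Icc, Icc_subset_ivl (hxab _) (hxab _),
      fun y hy ↦ ?_⟩
    by_cases hyab : y ∈ ivl a b
    · rcases lt_or_ge y (x 0) with h | h
      · exact hsol.eq_zero_left hS hx hxab hz hl ⟨hyab.1, EReal.coe_lt_coe_iff.2 h⟩
      · have h' : x (Fin.last m) < y := lt_of_not_ge fun h' ↦ hy ⟨h, h'⟩
        exact hsol.eq_zero_right hS hx hxab hz hr ⟨EReal.coe_lt_coe_iff.2 h', hyab.2⟩
    · exact hu.2 y hyab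

theorem Coeffs.map_evalPartition_compactSolutions (hS : S.Admissible a b) (hx : StrictMono x)
    (hxab : ∀ j, x j ∈ ivl a b) (hz : S.Xi a b z ⊆ range x) :
    (S.compactSolutions z a b).map (evalPartition n x) =
      LinearMap.ker (S.B a x (conj z))ᴴ.mulVecLin := by
  ext v
  rw [Coeffs.mem_ker_B_conj_iff hS hx hxab hz, ← Coeffs.map_evalPartition_solutions hS hx hxab hz]
  constructor
  · rintro ⟨u, hu, rfl⟩
    exact ⟨⟨u, hu.1, rfl⟩, (Coeffs.mem_compactSolutions_iff hS hx hxab hz hu.1).1 hu⟩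
  · rintro ⟨⟨u, hu, rfl⟩, h⟩
    exact ⟨u, (Coeffs.mem_compactSolutions_iff hS hx hxab hz hu).2 h, rfl⟩

/-- Solutions on `(a, b)` correspond to their values at the partition points. -/
noncomputable def Coeffs.solutionsEquiv (hS : S.Admissible a b) (hx : StrictMono x)
    (hxab : ∀ j, x j ∈ ivl a b) (hz : S.Xi a b z ⊆ range x) :
    S.solutions z a b ≃ₗ[ℂ] LinearMap.ker (S.Bm a x (conj z))ᴴ.mulVecLin :=
  (LinearEquiv.ofInjective ((evalPartition n x).domRestrict (S.solutions z a b)) (by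
    rw [← LinearMap.ker_eq_bot, LinearMap.ker_eq_bot']
    exact fun u hu ↦ Subtype.ext (Coeffs.eq_zero_of_evalPartition hS hx hxab hz u.2 hu))).trans
    (LinearEquiv.ofEq _ _ (by
      rw [LinearMap.range_domRestrict, Coeffs.map_evalPartition_solutions hS hx hxab hz]))

theorem Coeffs.finrank_compactSolutions (hS : S.Admissible a b) (hx : StrictMono x)
    (hxab : ∀ j, x j ∈ ivl a b) (hz : S.Xi a b z ⊆ range x) :
    Module.finrank ℂ (S.compactSolutions z a b) =
      Module.finrank ℂ (LinearMap.ker (S.B a x (conj z))ᴴ.mulVecLin) := by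
  rw [← Coeffs.map_evalPartition_compactSolutions hS hx hxab hz, ← LinearMap.range_domRestrict]
  refine (LinearMap.finrank_range_of_inj ?_).symm
  rw [← LinearMap.ker_eq_bot, LinearMap.ker_eq_bot']
  exact fun u hu ↦ Subtype.ext (Coeffs.eq_zero_of_evalPartition hS hx hxab hz u.2.1 hu)

/-- For non-real z the compactly supported solutions for z and z̄ form the same space. Its dimension
is both dim ker B(z̄)* and dim ker B(z)*, and each is n less than that of the kernel without the
adjoint. -/
theorem Coeffs.finrank_ker_B_conj (hS : S.Admissible a b) (hx : StrictMono x)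
    (hxab : ∀ j, x j ∈ ivl a b) (hz : S.Xi a b z ⊆ range x) :
    Module.finrank ℂ (LinearMap.ker (S.B a x z).mulVecLin) =
      Module.finrank ℂ (LinearMap.ker (S.B a x (conj z)).mulVecLin) := by
  by_cases hzz : z = conj z
  · rw [← hzz]
  have hz' : S.Xi a b (conj z) ⊆ range x := by rwa [Coeffs.Xi_conj hS]
  have h1 := Coeffs.finrank_compactSolutions hS hx hxab hz
  have h2 := Coeffs.finrank_compactSolutions hS hx hxab hz'
  have h3 : S.compactSolutions z a b = S.compactSolutions (conj z) a b :=
    le_antisymm (Coeffs.compactSolutions_le hS hzz _)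
      (Coeffs.compactSolutions_le hS (by rw [Complex.conj_conj]; exact Ne.symm hzz) _)
  rw [h3, h2, Complex.conj_conj] at h1
  rw [← Coeffs.finrank_ker_B_conjTranspose, ← Coeffs.finrank_ker_B_conjTranspose, h1]

/-- dim ker B_m(z̄)* = dim ker B(z) = dim ker B(z̄) = dim ker B(z̄)* + n. -/
theorem Coeffs.ntilde_eq (hS : S.Admissible a b) (hx : StrictMono x)
    (hxab : ∀ j, x j ∈ ivl a b) (hz : S.Xi a b z ⊆ range x) : S.ntilde a x z = n := by
  have h1 := Coeffs.finrank_ker_B hS hx hxab hz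
  rw [Coeffs.finrank_ker_B_conj hS hx hxab hz, ← Coeffs.finrank_ker_B_conjTranspose] at h1
  have hle : LinearMap.ker (S.B a x (conj z))ᴴ.mulVecLin ≤
      LinearMap.ker (S.Bm a x (conj z))ᴴ.mulVecLin :=
    fun v hv ↦ ((Coeffs.mem_ker_B_conj_iff hS hx hxab hz).1 hv).1
  have h2 := Submodule.finrank_quotient_add_finrank
    ((LinearMap.ker (S.B a x (conj z))ᴴ.mulVecLin).submoduleOf
      (LinearMap.ker (S.Bm a x (conj z))ᴴ.mulVecLin))
  rw [(Submodule.submoduleOfEquivOfLe hle).finrank_eq, ← h1] at h2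
  rw [Coeffs.ntilde]
  omega

/-- Evaluation at the partition points carries this quotient to the one defining ñ(z). The use of
`Module.rank` makes finite dimensionality part of the claim. -/
theorem Coeffs.rank_solutions_quotient (hS : S.Admissible a b) (hx : StrictMono x)
    (hxab : ∀ j, x j ∈ ivl a b) (hz : S.Xi a b z ⊆ range x) :
    Module.rank ℂ (S.solutions z a b ⧸
      (S.compactSolutions z a b).submoduleOf (S.solutions z a b)) = n := by
  have hmap : ((S.compactSolutions z a b).submoduleOf (S.solutions z a b)).map
      (Coeffs.solutionsEquiv hS hx hxab hz : S.solutions z a b →ₗ[ℂ] _) =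
      (LinearMap.ker (S.B a x (conj z))ᴴ.mulVecLin).submoduleOf
        (LinearMap.ker (S.Bm a x (conj z))ᴴ.mulVecLin) := by
    ext v
    change v ∈ _ ↔ (v : Fin (m + 1) × Fin n → ℂ) ∈ LinearMap.ker _
    rw [← Coeffs.map_evalPartition_compactSolutions hS hx hxab hz]
    constructor
    · rintro ⟨u, hu, rfl⟩
      exact ⟨u.1, hu, rfl⟩
    · rintro ⟨u, hu, huv⟩
      exact ⟨⟨u, hu.1⟩, hu, Subtype.ext huv⟩
  have h := (Submodule.Quotient.equiv _ _ (Coeffs.solutionsEquiv hS hx hxab hz) hmap).rank_eq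
  rw [h, ← Module.finrank_eq_rank]
  exact congrArg _ (Coeffs.ntilde_eq hS hx hxab hz)

end SolutionSpaces

/-! ### Codiscrete sets, zeros and poles, and large atoms -/

section Codiscrete

theorem mem_codiscrete_iff_eventually {s : Set ℂ} :
    s ∈ codiscrete ℂ ↔ ∀ z, ∀ᶠ y in 𝓝[≠] z, y ∈ s := by
  simp only [mem_codiscrete, disjoint_principal_right, compl_compl]
  rfl

theorem tendsto_conj_nhdsNE (z : ℂ) : Tendsto conj (𝓝[≠] z) (𝓝[≠] (conj z)) := by
  refine tendsto_nhdsWithin_iff.2 ⟨(Complex.continuous_conj.tendsto z).mono_left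
    nhdsWithin_le_nhds, ?_⟩
  filter_upwards [self_mem_nhdsWithin] with y hy h
  exact hy ((starRingEnd ℂ).injective h)

theorem preimage_conj_mem_codiscrete {s : Set ℂ} (hs : s ∈ codiscrete ℂ) :
    conj ⁻¹' s ∈ codiscrete ℂ := by
  rw [mem_codiscrete_iff_eventually] at hs ⊢
  exact fun z ↦ (tendsto_conj_nhdsNE z).eventually (hs (conj z))

theorem eventually_not_meromorphicOrderAt_neg {f : ℂ → ℂ} (hf : MeromorphicNFOn f univ) :
    {y | ¬ meromorphicOrderAt f y < 0} ∈ codiscrete ℂ := by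
  refine mem_codiscrete_iff_eventually.2 fun z ↦ ?_
  filter_upwards [(hf (mem_univ z)).meromorphicAt.eventually_analyticAt] with y hy
  exact not_lt.2 hy.meromorphicOrderAt_nonneg

theorem eventually_not_meromorphicOrderAt_pos {f : ℂ → ℂ} (hf : MeromorphicNFOn f univ)
    (h0 : f ≠ 0) : {y | ¬ 0 < meromorphicOrderAt f y} ∈ codiscrete ℂ := by
  -- On the connected plane, infinite order at one point means infinite order at all points. The
  -- normal form then gives f = 0 at every point and not only on punctured neighbourhoods.
  have htop : ∀ z, meromorphicOrderAt f z ≠ ⊤ := by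
    have hmer : Meromorphic f := fun z ↦ (hf (mem_univ z)).meromorphicAt
    rw [← hmer.exists_meromorphicOrderAt_ne_top_iff_forall]
    by_contra! hall
    refine h0 (funext fun z ↦ ?_)
    have h1 : f =ᶠ[𝓝[≠] z] 0 := meromorphicOrderAt_eq_top_iff.1 (hall z)
    have h2 : MeromorphicNFAt (0 : ℂ → ℂ) z := analyticAt_const.meromorphicNFAt
    exact (((hf (mem_univ z)).eventuallyEq_nhdsNE_iff_eventuallyEq_nhds h2).1 h1).eq_of_nhds
  refine mem_codiscrete_iff_eventually.2 fun z ↦ ?_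
  filter_upwards [(meromorphicOrderAt_ne_top_iff_eventually_ne_zero
    (hf (mem_univ z)).meromorphicAt).1 (htop z)] with y hy
  exact ((hf (mem_univ y)).meromorphicOrderAt_eq_zero_iff.2 hy).not_gt

/-- N points of this set contribute at least Nε to ∫g. -/
theorem finite_setOf_le_measureReal_singleton_mul {ν : Measure ℝ} [IsFiniteMeasure ν] {g : ℝ → ℝ}
    (hg : Integrable g ν) (hg0 : ∀ x, 0 ≤ g x) {ε : ℝ} (hε : 0 < ε) :
    {p | ε ≤ ν.real {p} * g p}.Finite := by
  by_contra hinf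
  obtain ⟨N, hN⟩ := exists_nat_gt ((∫ x, g x ∂ν) / ε)
  obtain ⟨F, hF, hcard⟩ := Set.Infinite.exists_subset_card_eq hinf N
  have h1 : N * ε ≤ ∫ x in (F : Set ℝ), g x ∂ν := by
    rw [setIntegral_finset (hf := hg.integrableOn), ← hcard, ← nsmul_eq_mul]
    exact Finset.card_nsmul_le_sum _ _ _ fun p hp ↦ hF hp
  have h2 : ∫ x in (F : Set ℝ), g x ∂ν ≤ ∫ x, g x ∂ν :=
    setIntegral_le_integral hg (Eventually.of_forall hg0)
  rw [div_lt_iff₀ hε] at hN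
  linarith

end Codiscrete

/-! ### Discreteness of the complement of Ω -/

section Omega

variable {S : Coeffs n} {a b : EReal} {x : Fin (m + 1) → ℝ}

theorem Coeffs.coeff_eq (S : Coeffs n) (z : ℂ) (p : ℝ) (v : Fin n → ℂ) :
    S.coeff z p v = S.coeff 0 p v + z • ((S.coeff 1 p - S.coeff 0 p) v) := by
  rw [_root_.sub_apply]
  simp only [Coeffs.coeff_apply, Coeffs.potential, mul_sub, neg_mulVec, sub_mulVec,
    smul_mulVec, one_smul, zero_smul, sub_zero, Matrix.mul_smul]
  module

/-- A bound for the coefficient for all `z` with `‖z‖ ≤ R`. -/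
noncomputable def Coeffs.coeffBound (S : Coeffs n) (R : ℝ) (p : ℝ) : ℝ :=
  ‖S.coeff 0 p‖ + R * ‖S.coeff 1 p - S.coeff 0 p‖

theorem Coeffs.norm_coeff_le (S : Coeffs n) {z : ℂ} {R : ℝ} (hz : ‖z‖ ≤ R) (p : ℝ)
    (v : Fin n → ℂ) : ‖S.coeff z p v‖ ≤ S.coeffBound R p * ‖v‖ := by
  rw [Coeffs.coeff_eq, Coeffs.coeffBound, add_mul]
  refine (norm_add_le _ _).trans (add_le_add (ContinuousLinearMap.le_opNorm _ _) ?_)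
  rw [norm_smul, mul_assoc]
  exact mul_le_mul hz (ContinuousLinearMap.le_opNorm _ _) (norm_nonneg _)
    ((norm_nonneg _).trans hz)

/-- A kernel vector w satisfies w = ½ν{p}A(p)w; compare norms. -/
theorem Coeffs.two_le_of_det_Bplus_eq_zero (hJ : IsUnit S.J) {z : ℂ} {R : ℝ} (hz : ‖z‖ ≤ R)
    {p : ℝ} (h : (S.Bplus p z).det = 0) : 2 ≤ S.baseMeasure.real {p} * S.coeffBound R p := by
  obtain ⟨w, hw0, hw⟩ := Matrix.exists_mulVec_eq_zero_iff.2 h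
  have h1 := (Coeffs.Bplus_mulVec_eq_iff hJ (v := 0)).1 (hw.trans (mulVec_zero _).symm)
  rw [zero_add] at h1
  have h2 : ‖w‖ ≤ 1 / 2 * (S.baseMeasure.real {p} * (S.coeffBound R p * ‖w‖)) := by
    conv_lhs => rw [h1]
    rw [norm_smul, norm_smul, Real.norm_of_nonneg measureReal_nonneg,
      Real.norm_of_nonneg (by norm_num)]
    gcongr
    exact S.norm_coeff_le hz p w
  have h3 : 0 < ‖w‖ := norm_pos_iff.2 hw0
  by_contra! hlt
  nlinarith

/-- A singular point for some z with ‖z‖ ≤ R has ν{p}·`coeffBound` ≥ 2, which leaves finitely many.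
The case of B₋ at z is that of B₊ at z̄ by taking adjoints. -/
theorem Coeffs.finite_singular (hS : S.Admissible a b) {R : ℝ} (hR : 0 ≤ R) :
    {p ∈ ivl a b | ∃ z : ℂ, ‖z‖ ≤ R ∧ p ∈ S.Xi a b z}.Finite := by
  have hint : Integrable (S.coeffBound R) S.baseMeasure :=
    (S.integrable_coeff 0).norm.add
      (((S.integrable_coeff 1).sub (S.integrable_coeff 0)).norm.const_mul R)
  refine (finite_setOf_le_measureReal_singleton_mul hint
    (fun p ↦ add_nonneg (norm_nonneg _) (mul_nonneg hR (norm_nonneg _))) two_pos).subset ?_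
  rintro p ⟨hp, z, hz, -, hdet⟩
  rcases mul_eq_zero.1 hdet with h | h
  · exact Coeffs.two_le_of_det_Bplus_eq_zero hS.isUnit_J hz h
  · refine Coeffs.two_le_of_det_Bplus_eq_zero hS.isUnit_J (z := conj z) (by simpa using hz) ?_
    rw [← neg_neg (S.Bplus p (conj z)), ← Coeffs.Bminus_conjTranspose hS hp, det_neg,
      det_conjTranspose, h, star_zero, mul_zero]

theorem differentiable_det {M : ℂ → Matrix (Fin n) (Fin n) ℂ}
    (hM : ∀ i k, Differentiable ℂ fun z ↦ M z i k) : Differentiable ℂ fun z ↦ (M z).det := by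
  simp only [det_apply']
  fun_prop

/-- For p in (a,b) the product of the two determinants is an entire function of z, nonzero at 0, so
its zeros are isolated. -/
theorem Coeffs.notMem_Xi_mem_codiscrete {p : ℝ} (hp : p ∉ S.Xi a b 0) :
    {z | p ∉ S.Xi a b z} ∈ codiscrete ℂ := by
  by_cases hpab : p ∈ ivl a b
  · have hd : Differentiable ℂ fun z ↦ (S.Bplus p z).det * (S.Bminus p z).det := by
      refine (differentiable_det fun i k ↦ ?_).mul (differentiable_det fun i k ↦ ?_)
      · simp only [Coeffs.Bplus, Matrix.add_apply, Matrix.smul_apply, Matrix.sub_apply, smul_eq_mul]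
        fun_prop
      · simp only [Coeffs.Bminus, Matrix.smul_apply, Matrix.sub_apply, smul_eq_mul]
        fun_prop
    have ha : AnalyticOnNhd ℂ (fun z ↦ (S.Bplus p z).det * (S.Bminus p z).det) univ :=
      fun z _ ↦ hd.analyticAt z
    have := ha.preimage_zero_mem_codiscrete (x := 0) fun h ↦ hp ⟨hpab, h⟩
    filter_upwards [this] with z hz h
    exact hz h.2
  · exact univ_mem' fun z h ↦ hpab h.1

theorem Coeffs.Omega₀_mem_codiscrete (hS : S.Admissible a b) (hXi : S.Xi a b 0 ⊆ range x) :
    S.Omega₀ a b x ∈ codiscrete ℂ := by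
  refine mem_codiscrete_iff_eventually.2 fun z ↦ ?_
  have hR : 0 ≤ ‖z‖ + 1 := by positivity
  -- Near z only the finitely many points that are singular for some parameter of norm at most ‖z‖ +
  -- 1 can matter, so finitely many codiscrete conditions suffice.
  have hfin : ({p ∈ ivl a b | ∃ y : ℂ, ‖y‖ ≤ ‖z‖ + 1 ∧ p ∈ S.Xi a b y} \ range x).Finite :=
    (Coeffs.finite_singular hS hR).sdiff
  have h1 : ∀ᶠ y in 𝓝[≠] z, ∀ p ∈ {p ∈ ivl a b | ∃ y : ℂ, ‖y‖ ≤ ‖z‖ + 1 ∧ p ∈ S.Xi a b y} \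
      range x, p ∉ S.Xi a b y :=
    (eventually_all_finite hfin).2 fun p hp ↦ mem_codiscrete_iff_eventually.1
      (Coeffs.notMem_Xi_mem_codiscrete fun h ↦ hp.2 (hXi h)) z
  have h2 : ∀ᶠ y in 𝓝[≠] z, ‖y‖ < ‖z‖ + 1 :=
    (continuous_norm.tendsto z).mono_left nhdsWithin_le_nhds |>.eventually_lt_const (by linarith)
  filter_upwards [h1, h2] with y hy1 hy2 p hp
  by_contra hpx
  exact hy1 p ⟨⟨hp.1, y, hy2.le, hp⟩, hpx⟩ hp

theorem Coeffs.Omega_mem_codiscrete (hS : S.Admissible a b) (hXi : S.Xi a b 0 ⊆ range x)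
    {M N : ℕ} {Bt : Matrix (Fin M) (Fin N) (ℂ → ℂ)} (hBt : ∀ i k, MeromorphicNFOn (Bt i k) univ) :
    S.Omega a b x Bt ∈ codiscrete ℂ := by
  have hG : {y | (∀ i k, ¬ meromorphicOrderAt (Bt i k) y < 0) ∧
      (∀ i k, Bt.IsLeadingEntry i k → ¬ 0 < meromorphicOrderAt (Bt i k) y)} ∈ codiscrete ℂ := by
    refine Filter.inter_mem (eventually_all.2 fun i ↦ eventually_all.2 fun k ↦
      eventually_not_meromorphicOrderAt_neg (hBt i k)) (eventually_all.2 fun i ↦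
        eventually_all.2 fun k ↦ ?_)
    by_cases h : Bt.IsLeadingEntry i k
    · filter_upwards [eventually_not_meromorphicOrderAt_pos (hBt i k) h.2] with y hy _ using hy
    · exact Eventually.of_forall fun y h' ↦ absurd h' h
  filter_upwards [Coeffs.Omega₀_mem_codiscrete hS hXi, hG, preimage_conj_mem_codiscrete hG]
    with z h1 h2 h3
  refine ⟨h1, fun y hy ↦ ?_⟩
  rcases hy with rfl | rfl
  · exact h2
  · exact h3

end Omega

end FirstOrderSystem

open FirstOrderSystem in
theorem theoremL {n m : ℕ} (S : Coeffs n) (a b : EReal) (hS : S.Admissible a b)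
    (x : Fin (m + 1) → ℝ) (hx : StrictMono x) (hxab : ∀ j, x j ∈ ivl a b)
    (hXi : S.Xi a b 0 ⊆ Set.range x)
    (Bt : Matrix (Fin ((m + 1) * n)) (Fin ((m + 2) * n)) (ℂ → ℂ))
    (hBt : IsEchelonForm (S.B a x) Bt) :
    S.Omega a b x Bt ∈ codiscrete ℂ ∧
    ∀ z ∈ S.Omega a b x Bt,
      Module.finrank ℂ (LinearMap.ker (S.B a x z).mulVecLin) =
        Module.finrank ℂ (LinearMap.ker (S.B a x (conj z)).mulVecLin) ∧
      S.ntilde a x z = n ∧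
      Module.rank ℂ (S.solutions z a b ⧸
        (S.compactSolutions z a b).submoduleOf (S.solutions z a b)) = n :=
  ⟨Coeffs.Omega_mem_codiscrete hS hXi hBt.meromorphic, fun _ hz ↦
    ⟨Coeffs.finrank_ker_B_conj hS hx hxab hz.1, Coeffs.ntilde_eq hS hx hxab hz.1,
      Coeffs.rank_solutions_quotient hS hx hxab hz.1⟩⟩
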